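/- Let $d\ge 2$ and $T>0$. Let $\Gamma$ be the set of $\gamma\in L^2((-1,T);\mathbb R^d)$ that are affine on $(-1,0)$, with the $L^2$-metric, and let $\mathcal P(\Gamma)$ be the space of Borel probability measures on $\Gamma$ with the topology of narrow convergence (testing against bounded continuous functions on $\Gamma$). Let $\mathcal M(\Gamma)$ be the set of $\eta\in\mathcal P(\Gamma)$ with $$\int|\gamma(0)|^2\,\eta(d\gamma)\le 1,\qquad \int\|\dot\gamma\|^2_{L^2(-1,T)}\,\eta(d\gamma)\le 1,$$ where $\|\dot\gamma\|_{L^2(-1,T)}=\infty$ if $\gamma\notin W^{1,2}((-1,T);\mathbb R^d)$; such $\eta$ are concentrated on $W^{1,2}$, whose elements are identified with their continuous representatives on $[-1,T]$. Put $e_t(\gamma)=\gamma(t)$ and $W_0(\gamma)=\gamma(0)-\gamma(-1)$. For $t\in[0,T)$ let $T_t(\gamma)=\gamma|_{(t,T)}\in L^2((t,T);\mathbb R^d)$, let $(\omega^t_{\gamma'})_{\gamma'}$ be the disintegration of $\eta$ with respect to $T_t$, and let $V_t(\gamma)=\int W_0(\gamma'')\,\omega^t_{T_t(\gamma)}(d\gamma'')$.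 A measure $\eta\in\mathcal M(\Gamma)$ is a *dissipative solution* if, for a.e. $t\in[0,T]$, $\dot\gamma(t)=V_t(\gamma)$ for $\eta$-a.e. $\gamma$. A *sticky particle solution* is a dissipative solution $\eta$ concentrated on a set $S\subset\Gamma$ such that, for every $t\in[0,T)$, the maps $T_t$ and $e_t$ induce the same equivalence relation on $S$. It is a *finite sticky particle solution* if moreover it is concentrated on finitely many curves. Theorem. (i) For every dissipative solution $\eta$ there are finite sticky particle solutions $\eta^\nu$, $\nu>0$, such that $\eta^\nu\rightharpoonup\eta$ narrowly as $\nu\to0$. (ii) The set of dissipative solutions is exactly the closure, in the narrow topology of $\mathcal P(\Gamma)$, of the set of sticky particle solutions. -/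

import Mathlib

open MeasureTheory ProbabilityTheory Set Filter Topology
open scoped ENNReal NNReal

namespace PressurelessEuler

noncomputable section

/-- The space `L²((-1,T); ℝᵈ)`. -/
abbrev L2 (d : ℕ) (T : ℝ) : Type :=
  Lp (EuclideanSpace ℝ (Fin d)) 2 (volume.restrict (Ioo (-1) T))

/-- `γ` is a.e. equal to an affine function on `(-1,0)`. -/
def AffineBeforeZero {d : ℕ} {T : ℝ} (γ : L2 d T) : Prop :=
  ∃ a b : EuclideanSpace ℝ (Fin d),
    ∀ᵐ t ∂((volume.restrict (Ioo (-1) T)).restrict (Ioo (-1) 0)), γ t = a + t • b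

/-- The set `{γ ∈ L²((-1,T); ℝᵈ) : γ affine on (-1,0)}`, as a linear subspace. -/
def curveSubmodule (d : ℕ) (T : ℝ) : Submodule ℝ (L2 d T) where
  carrier := {γ | AffineBeforeZero γ}
  zero_mem' := by
    refine ⟨0, 0, ?_⟩
    filter_upwards [ae_restrict_of_ae (Lp.coeFn_zero (EuclideanSpace ℝ (Fin d)) 2
      (volume.restrict (Ioo (-1) T)))] with t ht
    simpa using ht
  add_mem' := by
    rintro f g ⟨a, b, hf⟩ ⟨a', b', hg⟩
    refine ⟨a + a', b + b', ?_⟩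
    filter_upwards [hf, hg, ae_restrict_of_ae (Lp.coeFn_add f g)] with t h1 h2 h3
    rw [h3, Pi.add_apply, h1, h2, smul_add]
    abel
  smul_mem' := by
    rintro c f ⟨a, b, hf⟩
    refine ⟨c • a, c • b, ?_⟩
    filter_upwards [hf, ae_restrict_of_ae (Lp.coeFn_smul c f)] with t h1 h3
    rw [h3, Pi.smul_apply, h1, smul_add, smul_comm]

/-- The space of curves `Γ`, with the `L²` metric. -/
abbrev Curve (d : ℕ) (T : ℝ) : Type := ↥(curveSubmodule d T)

instance (d : ℕ) (T : ℝ) : MeasurableSpace (Curve d T) := borel _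

instance (d : ℕ) (T : ℝ) : BorelSpace (Curve d T) := ⟨rfl⟩

/-- `Γ` is closed in `L²`: it is the preimage, under restriction to `(-1,0)`, of a
finite-dimensional subspace. -/
theorem isClosed_curveSubmodule (d : ℕ) (T : ℝ) :
    IsClosed (curveSubmodule d T : Set (L2 d T)) := by
  set E := EuclideanSpace ℝ (Fin d)
  set ν : Measure ℝ := (volume.restrict (Ioo (-1) T)).restrict (Ioo (-1) 0) with hν
  have hle : ν ≤ volume.restrict (Ioo (-1 : ℝ) 0) := by
    rw [hν, Measure.restrict_restrict measurableSet_Ioo]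
    exact Measure.restrict_mono inter_subset_left le_rfl
  have hm : ∀ p : E × E, MemLp (fun t : ℝ => p.1 + t • p.2) 2 ν := by
    intro p
    refine MemLp.mono_measure hle ?_
    refine (MemLp.of_bound (C := ‖p.1‖ + ‖p.2‖) (by fun_prop) ?_)
    filter_upwards [ae_restrict_mem measurableSet_Ioo] with t ht
    refine (norm_add_le _ _).trans ?_
    rw [norm_smul]
    have : ‖t‖ ≤ 1 := by
      rw [Real.norm_eq_abs, abs_le]; exact ⟨ht.1.le, ht.2.le.trans zero_le_one⟩
    have := mul_le_mul_of_nonneg_right this (norm_nonneg p.2)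
    linarith
  let L : E × E →ₗ[ℝ] Lp E 2 ν :=
    { toFun := fun p => (hm p).toLp _
      map_add' := by
        intro p q
        rw [← MemLp.toLp_add]
        refine MemLp.toLp_congr _ _ (ae_of_all _ fun t => ?_)
        simp only [Prod.fst_add, Prod.snd_add, Pi.add_apply, smul_add]
        abel
      map_smul' := by
        intro c p
        rw [RingHom.id_apply, ← MemLp.toLp_const_smul]
        refine MemLp.toLp_congr _ _ (ae_of_all _ fun t => ?_)
        simp only [Prod.smul_fst, Prod.smul_snd, Pi.smul_apply, smul_add]
        rw [smul_comm] }
  have hcl : IsClosed (LinearMap.range L : Set (Lp E 2 ν)) :=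
    Submodule.closed_of_finiteDimensional _
  have := hcl.preimage (LpToLpRestrictCLM ℝ E ℝ (volume.restrict (Ioo (-1) T)) 2
    (Ioo (-1) 0)).continuous
  convert this using 1
  ext γ
  have hr := LpToLpRestrictCLM_coeFn (F := E) ℝ (Ioo (-1) 0) γ
  constructor
  · rintro ⟨a, b, h⟩
    refine ⟨(a, b), ?_⟩
    refine Lp.ext ?_
    filter_upwards [h, hr, (hm (a, b)).coeFn_toLp] with t h1 h2 h3
    rw [h2, h1]; exact h3
  · rintro ⟨⟨a, b⟩, h⟩
    refine ⟨a, b, ?_⟩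
    filter_upwards [hr, (hm (a, b)).coeFn_toLp] with t h2 h3
    rw [← h2, ← h]; exact h3

instance (d : ℕ) (T : ℝ) : PolishSpace (Curve d T) :=
  haveI : Fact ((2 : ℝ≥0∞) ≠ ⊤) := ⟨ENNReal.ofNat_ne_top⟩
  haveI : SecondCountableTopology (L2 d T) := Lp.SecondCountableTopology
  haveI : PolishSpace (L2 d T) := inferInstance
  (isClosed_curveSubmodule d T).polishSpace

/-- The space `Γ_t = L²((t,T); ℝᵈ)`, for `-1 ≤ t`. -/
abbrev TailCurve (d : ℕ) (T t : ℝ) : Type :=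
  Lp (EuclideanSpace ℝ (Fin d)) 2 ((volume.restrict (Ioo (-1) T)).restrict (Ioo t T))

instance (d : ℕ) (T t : ℝ) : MeasurableSpace (TailCurve d T t) := borel _

instance (d : ℕ) (T t : ℝ) : BorelSpace (TailCurve d T t) := ⟨rfl⟩

/-- The restriction map `T_t : Γ → Γ_t`. -/
def restrictTail {d : ℕ} {T : ℝ} (t : ℝ) (γ : Curve d T) : TailCurve d T t :=
  LpToLpRestrictCLM ℝ (EuclideanSpace ℝ (Fin d)) ℝ (volume.restrict (Ioo (-1) T)) 2 (Ioo t T)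
    (γ : L2 d T)

/-- `γ` coincides a.e. on `(-1,T)` with the absolutely continuous function
`t ↦ c + ∫_{-1}^t g`, where `g ∈ L²((-1,T); ℝᵈ)`. -/
def IsPrimitive {d : ℕ} {T : ℝ} (γ : Curve d T) (c : EuclideanSpace ℝ (Fin d)) (g : L2 d T) :
    Prop :=
  ∀ᵐ t ∂(volume.restrict (Ioo (-1) T)), (γ : L2 d T) t = c + ∫ s in (-1)..t, g s

/-- `γ ∈ W^{1,2}((-1,T); ℝᵈ)`. -/
def IsSobolev {d : ℕ} {T : ℝ} (γ : Curve d T) : Prop :=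
  ∃ (c : EuclideanSpace ℝ (Fin d)) (g : L2 d T), IsPrimitive γ c g

open Classical in
/-- The value at `t ∈ [-1,T]` of the continuous representative of `γ ∈ W^{1,2}`
(and `0` for curves outside `W^{1,2}`). The evaluation map `e_t` is `fun γ => position γ t`. -/
def position {d : ℕ} {T : ℝ} (γ : Curve d T) (t : ℝ) : EuclideanSpace ℝ (Fin d) :=
  if h : IsSobolev γ then h.choose + ∫ s in (-1)..t, h.choose_spec.choose s else 0

/-- The velocity `γ̇(t)`: the classical derivative of the continuous representative, which exists
for a.e. `t` and is the weak derivative of `γ`. -/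
def velocity {d : ℕ} {T : ℝ} (γ : Curve d T) (t : ℝ) : EuclideanSpace ℝ (Fin d) :=
  deriv (position γ) t

open Classical in
/-- `‖γ̇‖²` in `L²((-1,T))`, equal to `∞` outside `W^{1,2}`. -/
def energy {d : ℕ} {T : ℝ} (γ : Curve d T) : ℝ≥0∞ :=
  if IsSobolev γ then ∫⁻ t in Ioo (-1) T, ‖velocity γ t‖ₑ ^ 2 else ⊤

/-- The initial velocity `W₀(γ) = γ(0) - γ(-1)`. -/
def initialVelocity {d : ℕ} {T : ℝ} (γ : Curve d T) : EuclideanSpace ℝ (Fin d) :=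
  position γ 0 - position γ (-1)

/-- `η ∈ 𝓜(Γ)`. The second condition forces `η` to be concentrated on `W^{1,2}`. -/
def IsAdmissible {d : ℕ} {T : ℝ} (η : ProbabilityMeasure (Curve d T)) : Prop :=
  ∫⁻ γ, ‖position γ 0‖ₑ ^ 2 ∂(η : Measure (Curve d T)) ≤ 1 ∧
    ∫⁻ γ, energy γ ∂(η : Measure (Curve d T)) ≤ 1

/-- The disintegration `γ' ↦ ω^t_{γ'}` of `η` with respect to the restriction map `T_t`: the
regular conditional distribution of `γ` given `T_t γ`. -/
def disintegration {d : ℕ} {T : ℝ} (η : ProbabilityMeasure (Curve d T)) (t : ℝ) :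
    Kernel (TailCurve d T t) (Curve d T) :=
  condDistrib (id : Curve d T → Curve d T) (restrictTail t) (η : Measure (Curve d T))

/-- `V_t(γ) = ∫ W₀(γ') ω^t_{T_t γ}(dγ')`, defined for each `t` up to `η`-null sets. -/
def meanVelocity {d : ℕ} {T : ℝ} (η : ProbabilityMeasure (Curve d T)) (t : ℝ) (γ : Curve d T) :
    EuclideanSpace ℝ (Fin d) :=
  ∫ γ', initialVelocity γ' ∂(disintegration η t (restrictTail t γ))

/-- Dissipative solutions: `η ∈ 𝓜(Γ)` and `γ̇(t) = V_t(γ)` for a.e. `t ∈ [0,T]` and `η`-a.e. `γ`. -/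
def IsDissipative {d : ℕ} {T : ℝ} (η : ProbabilityMeasure (Curve d T)) : Prop :=
  IsAdmissible η ∧
    ∀ᵐ t ∂(volume.restrict (Icc 0 T)), ∀ᵐ γ ∂(η : Measure (Curve d T)),
      velocity γ t = meanVelocity η t γ

/-- Sticky particle solutions: dissipative solutions concentrated on a set of curves on which, for
every `t`, the maps `T_t` and `e_t` induce the same equivalence relation (at the final time `T`
there is no future to compare, and `T_T` is by convention `e_T`). -/
def IsSticky {d : ℕ} {T : ℝ} (η : ProbabilityMeasure (Curve d T)) : Prop :=
  IsDissipative η ∧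
    ∃ S : Set (Curve d T), (∀ᵐ γ ∂(η : Measure (Curve d T)), γ ∈ S) ∧
      ∀ t ∈ Ico 0 T, ∀ γ ∈ S, ∀ γ' ∈ S,
        restrictTail t γ = restrictTail t γ' ↔ position γ t = position γ' t

/-- Sticky particle solutions concentrated on finitely many trajectories. -/
def IsFiniteSticky {d : ℕ} {T : ℝ} (η : ProbabilityMeasure (Curve d T)) : Prop :=
  IsSticky η ∧
    ∃ F : Set (Curve d T), F.Finite ∧ ∀ᵐ γ ∂(η : Measure (Curve d T)), γ ∈ F

end

end PressurelessEuler

/-! ### Sobolev curves as primitives, and their affine initial piece. -/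

namespace PressurelessEuler

noncomputable section

variable {d : ℕ} {T : ℝ}

/-! Write W for the slope of the affine piece of a curve and F_t for the σ-algebra generated by T_t.
Then V_t is the conditional expectation of W given F_t, so an admissible η is dissipative exactly
when the velocity at a.e. time is this reverse martingale (`isDissipative_iff`). The theorem says
that such measures form a closed set, in which finite sticky particle solutions are dense.

Closedness. Disintegrations are not stable under narrow limits, so the equation is used in the
integrated form `BalanceLaw`: for 0 ≤ t₁ ≤ t₂ ≤ s < T, the displacement γ(t₂) - γ(t₁) - (t₂ - t₁)W
integrates to zero against every continuous function of T_s γ bounded by 1. A dissipative solution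
satisfies it because F_s is contained in F_t for t ≤ s. Thanks to the affine piece, W is continuous
on Γ. Positions are not, but their averages over a time δ are, and the energy bound makes the error
O(√δ) uniformly in η. Hence the balance law passes to limits (`balanceLaw_of_tendsto`), while the
moment constraints pass by lower semicontinuity. The equation is recovered by differentiating in t₂
and letting s decrease to t, since F_t is generated by the F_s with s > t (`future_le_iSup`,
`BalanceLaw.isDissipative`).

Density. Cut [0,T] into n + 1 steps of length h. The variable W, its conditional expectations given
F_{kh}, and the position at time nh are approximated by functions with finitely many values, each
measurable for the σ-algebra of its own time. The joint value is a finite label; two labels are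
related at step k when their entries from k on agree, so the classes merge as k grows
(`exists_discretization`). A particle with a given label starts with the mean of W over the label,
moves during step k with the average initial velocity of its class, and is traced backwards from a
final position that depends on its class only. Class averages are conditional expectations of W on
σ-algebras smaller than F_{kh} but rich enough to be close to the one on F_{kh}. The error from
freezing the velocity during a step is controlled by the decrease of the second moment of the
reverse martingale, which integrates to at most h (`IsDissipative.exists_particle_estimate`).

Members of a class share their future, so the particle law is dissipative once it is admissible. It
is sticky if particles of different classes never meet before T. Since d ≥ 2 this holds after an
arbitrarily small change of the initial velocities: in one coordinate two given particles coincide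
at most once per step, and a second coordinate is kept from coinciding at that instant
(`exists_noncrossing`). A slight contraction of the curves makes the moment bounds strict and leaves
room for the change. The approximating curves converge to the original ones in L² of η, hence the
laws converge narrowly. -/

theorem integrable_L2 (g : L2 d T) : Integrable g (volume.restrict (Ioo (-1) T)) :=
  (Lp.memLp g).integrable one_le_two

theorem intervalIntegrable_L2 (g : L2 d T) {a b : ℝ} (ha : -1 ≤ a) (hb : -1 ≤ b) (ha' : a ≤ T)
    (hb' : b ≤ T) : IntervalIntegrable g volume a b := by
  have h1 : IntegrableOn g (Icc (-1) T) := by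
    rw [integrableOn_Icc_iff_integrableOn_Ioo]
    exact integrable_L2 g
  refine (h1.mono_set ?_).intervalIntegrable
  rw [uIcc]
  exact Icc_subset_Icc (le_inf ha hb) (sup_le ha' hb')

theorem norm_setIntegral_le_L2 {E : Type*} [NormedAddCommGroup E] [NormedSpace ℝ E]
    (μ : Measure ℝ) [IsFiniteMeasure μ] (A : Set ℝ) (g : Lp E 2 μ) :
    ‖∫ s in A, g s ∂μ‖ ≤ √((μ A).toReal) * ‖g‖ := by
  have h := eLpNorm_le_eLpNorm_mul_rpow_measure_univ (p := 1) (q := 2) one_le_two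
    ((Lp.memLp g).restrict A).aestronglyMeasurable
  have h2 := eLpNorm_restrict_le g 2 μ A
  rw [Measure.restrict_apply_univ, ENNReal.toReal_one, ENNReal.toReal_ofNat,
    show (1 / 1 - 1 / 2 : ℝ) = 1 / 2 by norm_num] at h
  refine (norm_integral_le_lintegral_norm _).trans ?_
  rw [Real.sqrt_eq_rpow, ENNReal.toReal_rpow, Lp.norm_def, mul_comm, ← ENNReal.toReal_mul]
  refine ENNReal.toReal_mono ?_ ?_
  · refine ENNReal.mul_ne_top (Lp.memLp g).eLpNorm_ne_top ?_
    exact ENNReal.rpow_ne_top_of_nonneg (by norm_num) (measure_ne_top _ _)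
  · simp_rw [ofReal_norm]
    rw [← eLpNorm_one_eq_lintegral_enorm]
    refine h.trans ?_
    gcongr

/-- Integration over a set, as a continuous linear map on `L²` of a finite measure. -/
def setIntegralL2 (E : Type*) [NormedAddCommGroup E] [NormedSpace ℝ E]
    (μ : Measure ℝ) [IsFiniteMeasure μ] (A : Set ℝ) : Lp E 2 μ →L[ℝ] E :=
  have hi : ∀ f : Lp E 2 μ, Integrable f (μ.restrict A) := fun f =>
    ((Lp.memLp f).integrable one_le_two).restrict
  LinearMap.mkContinuous (𝕜 := ℝ) (𝕜₂ := ℝ) (σ := RingHom.id ℝ)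
    { toFun := fun g : Lp E 2 μ => ∫ s in A, g s ∂μ
      map_add' := fun f g => by
        rw [← integral_add (hi f) (hi g)]
        exact integral_congr_ae (ae_restrict_of_ae (Lp.coeFn_add f g))
      map_smul' := fun c f => by
        rw [RingHom.id_apply, ← integral_smul]
        exact integral_congr_ae (ae_restrict_of_ae (Lp.coeFn_smul c f)) }
    (√((μ A).toReal)) (norm_setIntegral_le_L2 μ A)

/-- Integration of a curve over a set of times. -/
abbrev integralOn (d : ℕ) (T : ℝ) (A : Set ℝ) : L2 d T →L[ℝ] EuclideanSpace ℝ (Fin d) :=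
  setIntegralL2 _ _ A

theorem integralOn_apply (A : Set ℝ) (g : L2 d T) :
    integralOn d T A g = ∫ s in A, g s ∂(volume.restrict (Ioo (-1) T)) := rfl

theorem norm_integralOn_le (A : Set ℝ) (g : L2 d T) :
    ‖integralOn d T A g‖ ≤ √(((volume.restrict (Ioo (-1) T)) A).toReal) * ‖g‖ :=
  norm_setIntegral_le_L2 _ A g

theorem intervalIntegral_eq_integralOn (g : L2 d T) {a b : ℝ} (ha : -1 ≤ a) (hab : a ≤ b)
    (hb : b ≤ T) : ∫ s in a..b, g s = integralOn d T (Ioc a b) g := by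
  rw [integralOn_apply, intervalIntegral.integral_of_le hab, integral_Ioc_eq_integral_Ioo,
    Measure.restrict_restrict measurableSet_Ioc]
  have h1 : (Ioc a b ∩ Ioo (-1) T : Set ℝ) =ᵐ[volume] (Ioc a b ∩ Icc (-1) T : Set ℝ) :=
    Filter.EventuallyEq.inter (ae_eq_refl _) Ioo_ae_eq_Icc
  have h2 : Ioc a b ⊆ Icc (-1) T := fun x hx => ⟨ha.trans hx.1.le, hx.2.trans hb⟩
  rw [setIntegral_congr_set h1, inter_eq_left.2 h2,
    integral_Ioc_eq_integral_Ioo]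

theorem norm_intervalIntegral_le (g : L2 d T) {a b : ℝ} (ha : -1 ≤ a) (hab : a ≤ b)
    (hb : b ≤ T) : ‖∫ s in a..b, g s‖ ≤ √(b - a) * ‖g‖ := by
  rw [intervalIntegral_eq_integralOn g ha hab hb]
  refine (norm_integralOn_le _ _).trans ?_
  gcongr
  calc ((volume.restrict (Ioo (-1) T)) (Ioc a b)).toReal ≤ (volume (Ioc a b)).toReal :=
        ENNReal.toReal_mono (by simp) (Measure.restrict_apply_le _ _)
    _ = b - a := by simp [hab]

/-- The primitive of `g` with value `c` at time `-1`. -/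
def prim (c : EuclideanSpace ℝ (Fin d)) (g : L2 d T) (t : ℝ) : EuclideanSpace ℝ (Fin d) :=
  c + ∫ s in (-1)..t, g s

theorem prim_sub_prim (c : EuclideanSpace ℝ (Fin d)) (g : L2 d T) {s t : ℝ} (hs : s ∈ Icc (-1) T)
    (ht : t ∈ Icc (-1) T) : prim c g t - prim c g s = ∫ r in s..t, g r := by
  have h1 : (-1 : ℝ) ≤ T := hs.1.trans hs.2
  rw [prim, prim, add_sub_add_left_eq_sub, intervalIntegral.integral_interval_sub_left]
  · exact intervalIntegrable_L2 g le_rfl ht.1 h1 ht.2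
  · exact intervalIntegrable_L2 g le_rfl hs.1 h1 hs.2

theorem norm_prim_sub_prim_le (c : EuclideanSpace ℝ (Fin d)) (g : L2 d T) {s t : ℝ}
    (hs : s ∈ Icc (-1) T) (ht : t ∈ Icc (-1) T) :
    ‖prim c g t - prim c g s‖ ≤ √|t - s| * ‖g‖ := by
  rcases le_total s t with h | h
  · rw [prim_sub_prim c g hs ht, abs_of_nonneg (sub_nonneg.2 h)]
    exact norm_intervalIntegral_le g hs.1 h ht.2
  · rw [norm_sub_rev, prim_sub_prim c g ht hs, abs_sub_comm, abs_of_nonneg (sub_nonneg.2 h)]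
    exact norm_intervalIntegral_le g ht.1 h hs.2

theorem continuousOn_prim (c : EuclideanSpace ℝ (Fin d)) (g : L2 d T) :
    ContinuousOn (prim c g) (Icc (-1) T) := by
  intro s hs
  rw [ContinuousWithinAt, tendsto_iff_norm_sub_tendsto_zero]
  have h0 : Tendsto (fun t => √|t - s| * ‖g‖) (𝓝[Icc (-1) T] s) (𝓝 0) := by
    have : Continuous (fun t => √|t - s| * ‖g‖) := by fun_prop
    simpa using this.continuousWithinAt.tendsto (x := s) (s := Icc (-1) T)
  refine squeeze_zero' (Eventually.of_forall fun t => norm_nonneg _) ?_ h0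
  filter_upwards [self_mem_nhdsWithin] with t ht using norm_prim_sub_prim_le c g hs ht

theorem ae_hasDerivAt_prim (hT : 0 < T) (c : EuclideanSpace ℝ (Fin d)) (g : L2 d T) :
    ∀ᵐ t ∂(volume.restrict (Ioo (-1) T)), HasDerivAt (prim c g) (g t) t := by
  have h := (intervalIntegrable_L2 g (a := -1) (b := T) le_rfl (by linarith) (by linarith)
    le_rfl).ae_hasDerivAt_integral
  rw [ae_restrict_iff' measurableSet_Ioo]
  filter_upwards [h] with t ht htT
  have h1 : t ∈ uIcc (-1) T := by
    rw [uIcc_of_le (by linarith)]; exact Ioo_subset_Icc_self htT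
  exact (ht h1 (-1) left_mem_uIcc).const_add c

theorem prim_injective (hT : 0 < T) {c c' : EuclideanSpace ℝ (Fin d)} {g g' : L2 d T}
    (h : ∀ᵐ t ∂(volume.restrict (Ioo (-1) T)), prim c g t = prim c' g' t) : c = c' ∧ g = g' := by
  have hE : EqOn (prim c g) (prim c' g') (Ioo (-1) T) :=
    Measure.eqOn_open_of_ae_eq h isOpen_Ioo
      ((continuousOn_prim c g).mono Ioo_subset_Icc_self)
      ((continuousOn_prim c' g').mono Ioo_subset_Icc_self)
  have hg : g = g' := by
    refine Lp.ext ?_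
    filter_upwards [ae_hasDerivAt_prim hT c g, ae_hasDerivAt_prim hT c' g',
      ae_restrict_mem measurableSet_Ioo] with t h1 h2 ht
    exact h1.unique (h2.congr_of_eventuallyEq
      (hE.eventuallyEq_of_mem (isOpen_Ioo.mem_nhds ht)))
  subst hg
  refine ⟨?_, rfl⟩
  have := hE (show (0 : ℝ) ∈ Ioo (-1) T from ⟨by norm_num, hT⟩)
  simpa [prim] using this

theorem IsPrimitive.unique (hT : 0 < T) {γ : Curve d T} {c c' : EuclideanSpace ℝ (Fin d)}
    {g g' : L2 d T} (h : IsPrimitive γ c g) (h' : IsPrimitive γ c' g') : c = c' ∧ g = g' := by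
  refine prim_injective hT ?_
  filter_upwards [h, h'] with t h1 h2
  exact h1.symm.trans h2

theorem position_eq_prim (hT : 0 < T) {γ : Curve d T} {c : EuclideanSpace ℝ (Fin d)} {g : L2 d T}
    (h : IsPrimitive γ c g) : position γ = prim c g := by
  have hs : IsSobolev γ := ⟨c, g, h⟩
  obtain ⟨h1, h2⟩ := IsPrimitive.unique hT hs.choose_spec.choose_spec h
  ext1 t
  rw [position, dif_pos hs, h2, prim]
  rw [show hs.choose = c from h1]

theorem velocity_ae_eq (hT : 0 < T) {γ : Curve d T} {c : EuclideanSpace ℝ (Fin d)} {g : L2 d T}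
    (h : IsPrimitive γ c g) : velocity γ =ᵐ[volume.restrict (Ioo (-1) T)] g := by
  filter_upwards [ae_hasDerivAt_prim hT c g] with t ht
  rw [velocity, position_eq_prim hT h, ht.deriv]

theorem lintegral_enorm_sq_L2 (g : L2 d T) : ∫⁻ t in Ioo (-1) T, ‖g t‖ₑ ^ 2 = ‖g‖ₑ ^ 2 := by
  rw [Lp.enorm_def, eLpNorm_eq_lintegral_rpow_enorm_toReal (by norm_num) (by norm_num)]
  simp only [ENNReal.toReal_ofNat, ENNReal.rpow_ofNat, one_div]
  rw [← ENNReal.rpow_natCast, ← ENNReal.rpow_mul]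
  norm_num

theorem energy_eq (hT : 0 < T) {γ : Curve d T} {c : EuclideanSpace ℝ (Fin d)} {g : L2 d T}
    (h : IsPrimitive γ c g) : energy γ = ‖g‖ₑ ^ 2 := by
  rw [energy, if_pos ⟨c, g, h⟩, ← lintegral_enorm_sq_L2]
  refine lintegral_congr_ae ?_
  filter_upwards [velocity_ae_eq hT h] with t ht
  rw [ht]

theorem memLp_prim (c : EuclideanSpace ℝ (Fin d)) (g : L2 d T) :
    MemLp (prim c g) 2 (volume.restrict (Ioo (-1) T)) := by
  refine MemLp.of_bound
    (((continuousOn_prim c g).mono Ioo_subset_Icc_self).aestronglyMeasurable measurableSet_Ioo)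
    (‖c‖ + √(T + 1) * ‖g‖) ?_
  filter_upwards [ae_restrict_mem measurableSet_Ioo] with t ht
  refine (norm_add_le _ _).trans ?_
  gcongr
  refine (norm_intervalIntegral_le g le_rfl ht.1.le ht.2.le).trans ?_
  gcongr
  linarith [ht.2]

theorem norm_prim_le (c : EuclideanSpace ℝ (Fin d)) (g : L2 d T) {t : ℝ} (ht : t ∈ Icc (-1) T) :
    ‖prim c g t‖ ≤ ‖c‖ + √(T + 1) * ‖g‖ := by
  refine (norm_add_le _ _).trans ?_
  gcongr
  refine (norm_intervalIntegral_le g le_rfl ht.1 ht.2).trans ?_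
  gcongr
  linarith [ht.2]

theorem prim_add (c c' : EuclideanSpace ℝ (Fin d)) (g g' : L2 d T) {t : ℝ} (ht : t ∈ Icc (-1) T) :
    prim (c + c') (g + g') t = prim c g t + prim c' g' t := by
  simp only [prim, intervalIntegral_eq_integralOn _ le_rfl ht.1 ht.2, map_add]
  abel

theorem prim_smul (r : ℝ) (c : EuclideanSpace ℝ (Fin d)) (g : L2 d T) {t : ℝ}
    (ht : t ∈ Icc (-1) T) : prim (r • c) (r • g) t = r • prim c g t := by
  simp only [prim, intervalIntegral_eq_integralOn _ le_rfl ht.1 ht.2, map_smul, smul_add]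

theorem prim_sub (c c' : EuclideanSpace ℝ (Fin d)) (g g' : L2 d T) {t : ℝ} (ht : t ∈ Icc (-1) T) :
    prim (c - c') (g - g') t = prim c g t - prim c' g' t := by
  simp only [prim, intervalIntegral_eq_integralOn _ le_rfl ht.1 ht.2, map_sub]
  abel

/-- The bounded linear map sending initial value and derivative to the curve. -/
def primCLM (d : ℕ) (T : ℝ) : EuclideanSpace ℝ (Fin d) × L2 d T →L[ℝ] L2 d T :=
  LinearMap.mkContinuous (𝕜 := ℝ) (𝕜₂ := ℝ) (σ := RingHom.id ℝ)
    { toFun := fun p => (memLp_prim p.1 p.2).toLp _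
      map_add' := fun p q => by
        rw [← MemLp.toLp_add]
        refine MemLp.toLp_congr _ _ ?_
        filter_upwards [ae_restrict_mem measurableSet_Ioo] with t ht
        exact prim_add _ _ _ _ (Ioo_subset_Icc_self ht)
      map_smul' := fun r p => by
        rw [RingHom.id_apply, ← MemLp.toLp_const_smul]
        refine MemLp.toLp_congr _ _ ?_
        filter_upwards [ae_restrict_mem measurableSet_Ioo] with t ht
        exact prim_smul _ _ _ (Ioo_subset_Icc_self ht) }
    (((volume.restrict (Ioo (-1) T)) univ).toReal ^ (2 : ℝ)⁻¹ * (1 + √(T + 1))) (fun p => by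
      have h : ∀ᵐ t ∂(volume.restrict (Ioo (-1) T)), ‖prim p.1 p.2 t‖ ≤ (1 + √(T + 1)) * ‖p‖ := by
        filter_upwards [ae_restrict_mem measurableSet_Ioo] with t ht
        refine (norm_prim_le _ _ (Ioo_subset_Icc_self ht)).trans ?_
        rw [add_mul, one_mul]
        gcongr
        · exact norm_fst_le p
        · exact norm_snd_le p
      have h2 := eLpNorm_le_of_ae_bound (p := 2) h
      simp only [LinearMap.coe_mk, AddHom.coe_mk, Lp.norm_toLp]
      refine (ENNReal.toReal_mono ?_ h2).trans_eq ?_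
      · exact ENNReal.mul_ne_top (ENNReal.rpow_ne_top_of_nonneg (by norm_num) (measure_ne_top _ _))
          ENNReal.ofReal_ne_top
      · rw [ENNReal.toReal_mul, ENNReal.toReal_ofReal (by positivity), ← ENNReal.toReal_rpow,
          ENNReal.toReal_ofNat, mul_assoc])

theorem primCLM_ae_eq (c : EuclideanSpace ℝ (Fin d)) (g : L2 d T) :
    primCLM d T (c, g) =ᵐ[volume.restrict (Ioo (-1) T)] prim c g :=
  (memLp_prim c g).coeFn_toLp

theorem isPrimitive_iff {γ : Curve d T} {c : EuclideanSpace ℝ (Fin d)} {g : L2 d T} :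
    IsPrimitive γ c g ↔ (γ : L2 d T) = primCLM d T (c, g) := by
  constructor
  · intro h
    refine Lp.ext ?_
    filter_upwards [h, primCLM_ae_eq c g] with t h1 h2
    rw [h1, h2, prim]
  · intro h
    rw [IsPrimitive, h]
    exact primCLM_ae_eq c g

theorem primCLM_injective (hT : 0 < T) : Function.Injective (primCLM d T) := by
  rintro ⟨c, g⟩ ⟨c', g'⟩ h
  have : ∀ᵐ t ∂(volume.restrict (Ioo (-1) T)), prim c g t = prim c' g' t := by
    filter_upwards [primCLM_ae_eq c g, primCLM_ae_eq c' g'] with t h1 h2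
    rw [← h1, ← h2, h]
  exact Prod.ext_iff.2 (prim_injective hT this)

/-- The value at time `0` of the affine part of a curve. -/
def affineValue (d : ℕ) (T : ℝ) : Curve d T →L[ℝ] EuclideanSpace ℝ (Fin d) :=
  ((4 : ℝ) • integralOn d T (Ioc (-1 / 2) 0) - integralOn d T (Ioc (-1) 0)).comp
    (curveSubmodule d T).subtypeL

/-- The slope of the affine part of a curve. -/
def affineSlope (d : ℕ) (T : ℝ) : Curve d T →L[ℝ] EuclideanSpace ℝ (Fin d) :=
  ((8 : ℝ) • integralOn d T (Ioc (-1 / 2) 0) - (4 : ℝ) • integralOn d T (Ioc (-1) 0)).comp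
    (curveSubmodule d T).subtypeL

/-- At u = -1/2 and u = -1 the formula gives a/2 - b/8 and a - b/2. Solving for a and b produces the
coefficients 4, -1 in `affineValue` and 8, -4 in `affineSlope`, which makes both continuous for the
L² metric. -/
theorem integralOn_affine (hT : 0 < T) (γ : L2 d T) {a b : EuclideanSpace ℝ (Fin d)}
    (h : ∀ᵐ t ∂((volume.restrict (Ioo (-1) T)).restrict (Ioo (-1) 0)), γ t = a + t • b)
    {u : ℝ} (hu : -1 ≤ u) (hu0 : u ≤ 0) :
    integralOn d T (Ioc u 0) γ = (-u) • a + (-u ^ 2 / 2) • b := by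
  rw [← intervalIntegral_eq_integralOn γ hu hu0 hT.le]
  have : ∫ s in u..0, γ s = ∫ s in u..0, (a + s • b) := by
    refine intervalIntegral.integral_congr_ae ?_
    rw [uIoc_of_le hu0]
    rw [Measure.restrict_restrict measurableSet_Ioo, inter_eq_left.2
      (Ioo_subset_Ioo_right hT.le), ae_restrict_iff' measurableSet_Ioo] at h
    have h0 : ∀ᵐ t : ℝ, t ≠ 0 := by simp [ae_iff, measure_singleton]
    filter_upwards [h, h0] with t h1 h2 h3
    exact h1 ⟨hu.trans_lt h3.1, lt_of_le_of_ne h3.2 h2⟩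
  rw [this, intervalIntegral.integral_add (by simp) (by
    exact (Continuous.intervalIntegrable (by fun_prop) _ _)), intervalIntegral.integral_smul_const]
  simp

theorem affineValue_eq (hT : 0 < T) {γ : Curve d T} {a b : EuclideanSpace ℝ (Fin d)}
    (h : ∀ᵐ t ∂((volume.restrict (Ioo (-1) T)).restrict (Ioo (-1) 0)), (γ : L2 d T) t = a + t • b) :
    affineValue d T γ = a := by
  simp only [affineValue, ContinuousLinearMap.comp_apply, sub_apply,
    smul_apply, Submodule.subtypeL_apply]
  rw [integralOn_affine hT _ h (by norm_num) (by norm_num),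
    integralOn_affine hT _ h (by norm_num) (by norm_num)]
  module

theorem affineSlope_eq (hT : 0 < T) {γ : Curve d T} {a b : EuclideanSpace ℝ (Fin d)}
    (h : ∀ᵐ t ∂((volume.restrict (Ioo (-1) T)).restrict (Ioo (-1) 0)), (γ : L2 d T) t = a + t • b) :
    affineSlope d T γ = b := by
  simp only [affineSlope, ContinuousLinearMap.comp_apply, sub_apply,
    smul_apply, Submodule.subtypeL_apply]
  rw [integralOn_affine hT _ h (by norm_num) (by norm_num),
    integralOn_affine hT _ h (by norm_num) (by norm_num)]
  module

theorem ae_eq_affine (hT : 0 < T) (γ : Curve d T) :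
    ∀ᵐ t ∂((volume.restrict (Ioo (-1) T)).restrict (Ioo (-1) 0)),
      (γ : L2 d T) t = affineValue d T γ + t • affineSlope d T γ := by
  obtain ⟨a, b, h⟩ := γ.2
  rw [affineValue_eq hT h, affineSlope_eq hT h]
  exact h

theorem restrict_Ioo_neg (hT : 0 < T) :
    (volume.restrict (Ioo (-1) T)).restrict (Ioo (-1) 0) = (volume.restrict (Ioo (-1) 0) : Measure ℝ) := by
  rw [Measure.restrict_restrict measurableSet_Ioo, inter_eq_left.2 (Ioo_subset_Ioo_right hT.le)]

theorem position_affine (hT : 0 < T) {γ : Curve d T} (hγ : IsSobolev γ) {t : ℝ}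
    (ht : t ∈ Icc (-1) 0) : position γ t = affineValue d T γ + t • affineSlope d T γ := by
  obtain ⟨c, g, h⟩ := hγ
  rw [position_eq_prim hT h]
  refine Measure.eqOn_Icc_of_ae_eq (μ := volume) (a := -1) (b := 0)
    (f := prim c g) (g := fun t => affineValue d T γ + t • affineSlope d T γ) (by norm_num) ?_
    ((continuousOn_prim c g).mono (Icc_subset_Icc_right hT.le)) (by fun_prop) ht
  rw [Measure.restrict_congr_set Ioo_ae_eq_Icc.symm, ← restrict_Ioo_neg hT]
  filter_upwards [ae_eq_affine hT γ, ae_restrict_of_ae h] with s h1 h2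
  rw [← h1, h2, prim]

theorem position_zero (hT : 0 < T) {γ : Curve d T} (hγ : IsSobolev γ) :
    position γ 0 = affineValue d T γ := by
  simpa using position_affine hT hγ (t := 0) (by simp)

theorem initialVelocity_eq (hT : 0 < T) {γ : Curve d T} (hγ : IsSobolev γ) :
    initialVelocity γ = affineSlope d T γ := by
  rw [initialVelocity, position_zero hT hγ, position_affine hT hγ (t := -1) (by simp)]
  module

theorem derivative_affine (hT : 0 < T) {γ : Curve d T} {c : EuclideanSpace ℝ (Fin d)} {g : L2 d T}
    (h : IsPrimitive γ c g) :
    ∀ᵐ t ∂(volume.restrict (Ioo (-1) 0)), g t = affineSlope d T γ := by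
  have h1 := ae_restrict_of_ae (s := Ioo (-1) 0) (ae_hasDerivAt_prim hT c g)
  rw [restrict_Ioo_neg hT] at h1
  filter_upwards [h1, ae_restrict_mem measurableSet_Ioo] with t ht ht'
  have h2 : HasDerivAt (fun t => affineValue d T γ + t • affineSlope d T γ)
      (affineSlope d T γ) t := by
    simpa using ((hasDerivAt_id t).smul_const (affineSlope d T γ)).const_add (affineValue d T γ)
  refine ht.unique (h2.congr_of_eventuallyEq ?_)
  filter_upwards [isOpen_Ioo.mem_nhds ht'] with s hs
  rw [← position_eq_prim hT h]
  exact position_affine hT ⟨c, g, h⟩ (Ioo_subset_Icc_self hs)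

end

end PressurelessEuler

/-! ### Lower semicontinuity of the energy. -/

namespace PressurelessEuler

noncomputable section

variable {d : ℕ} {T : ℝ}

/-- Closed balls of a Hilbert space are weakly compact and A is weakly continuous. Preimages of a
convergent sequence have a weak cluster point in the ball, and testing with the adjoint of A shows
that it maps to the limit. -/
theorem isClosed_image_closedBall {H F : Type*} [NormedAddCommGroup H] [InnerProductSpace ℝ H]
    [CompleteSpace H] [NormedAddCommGroup F] [InnerProductSpace ℝ F] [CompleteSpace F]
    (A : H →L[ℝ] F) (r : ℝ) : IsClosed (A '' Metric.closedBall 0 r) := by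
  refine isClosed_of_closure_subset fun y hy => ?_
  obtain ⟨v, hv, hlim⟩ := mem_closure_iff_seq_limit.1 hy
  choose g hg hgv using hv
  have hK := WeakDual.isCompact_closedBall (𝕜 := ℝ) (E := H) 0 r
  let u : ℕ → WeakDual ℝ H := fun n =>
    StrongDual.toWeakDual (InnerProductSpace.toDual ℝ H (g n))
  have hu : ∀ n, u n ∈ WeakDual.toStrongDual ⁻¹' Metric.closedBall (0 : StrongDual ℝ H) r := by
    intro n
    have := hg n
    rw [mem_closedBall_zero_iff] at this
    rw [mem_preimage, mem_closedBall_zero_iff]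
    exact ((InnerProductSpace.toDual ℝ H).norm_map (g n)).trans_le this
  obtain ⟨l, hlK, hl⟩ := hK.exists_mapClusterPt (f := atTop) (u := u)
    (le_principal_iff.2 (Filter.mem_map.2 (Eventually.of_forall hu)))
  refine ⟨(InnerProductSpace.toDual ℝ H).symm (WeakDual.toStrongDual l), ?_, ?_⟩
  · rw [mem_closedBall_zero_iff, LinearIsometryEquiv.norm_map]
    exact mem_closedBall_zero_iff.1 hlK
  · refine ext_inner_right ℝ fun z => ?_
    have hc : Continuous fun k : WeakDual ℝ H => k (A.adjoint z) := WeakDual.eval_continuous _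
    have h1 : MapClusterPt (l (A.adjoint z)) atTop ((fun k : WeakDual ℝ H => k (A.adjoint z)) ∘ u) :=
      hl.continuousAt_comp hc.continuousAt
    have h2 : Tendsto ((fun k : WeakDual ℝ H => k (A.adjoint z)) ∘ u) atTop
        (𝓝 (inner ℝ y z)) := by
      have : ((fun k : WeakDual ℝ H => k (A.adjoint z)) ∘ u) = fun n => inner ℝ (v n) z := by
        ext n
        show (InnerProductSpace.toDual ℝ H (g n)) (A.adjoint z) = _
        rw [InnerProductSpace.toDual_apply_apply, ContinuousLinearMap.adjoint_inner_right, hgv]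
      rw [this]
      exact hlim.inner tendsto_const_nhds
    have h3 : (𝓝 (l (A.adjoint z)) ⊓ 𝓝 (inner ℝ y z)).NeBot :=
      Filter.NeBot.mono h1 (inf_le_inf_left _ h2)
    rw [← eq_of_nhds_neBot h3, ← ContinuousLinearMap.adjoint_inner_right,
      InnerProductSpace.toDual_symm_apply]
    rfl

/-- The value at time -1 is value minus slope of the affine piece, a continuous function of γ. Once
it is subtracted only the derivative remains free, so energy sublevels become preimages of the image
of a ball. -/
theorem energy_le_iff (hT : 0 < T) (γ : Curve d T) (r : ℝ≥0) :
    energy γ ≤ r ↔ (γ : L2 d T) - primCLM d T (affineValue d T γ - affineSlope d T γ, 0) ∈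
      ((primCLM d T).comp (ContinuousLinearMap.inr ℝ _ _)) '' Metric.closedBall 0 (√r) := by
  have key : ∀ g : L2 d T, ‖g‖ₑ ^ 2 ≤ (r : ℝ≥0∞) ↔ ‖g‖ ≤ √r := by
    intro g
    have hr : (0 : ℝ) ≤ r := r.2
    rw [← ofReal_norm, ← ENNReal.ofReal_pow (norm_nonneg _), ← ENNReal.ofReal_coe_nnreal,
      ENNReal.ofReal_le_ofReal_iff hr, Real.le_sqrt (norm_nonneg _) hr]
  constructor
  · intro h
    have hs : IsSobolev γ := by
      by_contra hn
      rw [energy, if_neg hn] at h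
      exact absurd h (by simp)
    obtain ⟨c, g, hcg⟩ := hs
    rw [energy_eq hT hcg, key] at h
    refine ⟨g, by simpa using h, ?_⟩
    have hc : affineValue d T γ - affineSlope d T γ = c := by
      have := position_affine hT ⟨c, g, hcg⟩ (t := -1) (by simp)
      rw [position_eq_prim hT hcg] at this
      simp only [prim, intervalIntegral.integral_same, add_zero] at this
      rw [this]; module
    rw [hc, isPrimitive_iff.1 hcg, ← map_sub]
    simp
  · rintro ⟨g, hg, h⟩
    have hcg : IsPrimitive γ (affineValue d T γ - affineSlope d T γ) g := by
      rw [eq_sub_iff_add_eq] at h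
      rw [isPrimitive_iff, ← h]
      simp only [ContinuousLinearMap.comp_apply, ContinuousLinearMap.inr_apply, ← map_add]
      simp
    rw [energy_eq hT hcg, key]
    simpa using hg

theorem lowerSemicontinuous_energy (hT : 0 < T) :
    LowerSemicontinuous (energy : Curve d T → ℝ≥0∞) := by
  rw [lowerSemicontinuous_iff_isClosed_preimage]
  intro r
  rcases eq_or_ne r ⊤ with rfl | hr
  · simp
  lift r to ℝ≥0 using hr
  have : energy ⁻¹' Iic (r : ℝ≥0∞) = (fun γ : Curve d T => (γ : L2 d T) -
      primCLM d T (affineValue d T γ - affineSlope d T γ, 0)) ⁻¹'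
      (((primCLM d T).comp (ContinuousLinearMap.inr ℝ _ _)) '' Metric.closedBall 0 (√r)) := by
    ext γ
    exact energy_le_iff hT γ r
  rw [this]
  refine (isClosed_image_closedBall _ _).preimage ?_
  fun_prop

theorem measurable_energy (hT : 0 < T) : Measurable (energy : Curve d T → ℝ≥0∞) :=
  (lowerSemicontinuous_energy hT).measurable

theorem isSobolev_of_energy_lt_top {γ : Curve d T} (h : energy γ < ⊤) : IsSobolev γ := by
  by_contra hn
  rw [energy, if_neg hn] at h
  exact lt_irrefl _ h

/-- Layer-cake formula, the portmanteau inequality on the open superlevel sets, and Fatou's lemma in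
the level variable. Truncating f at M keeps the values finite; monotone convergence removes M. -/
theorem lintegral_le_of_tendsto {Ω : Type*} [MeasurableSpace Ω] [TopologicalSpace Ω]
    [OpensMeasurableSpace Ω] [HasOuterApproxClosed Ω] {f : Ω → ℝ≥0∞} (hf : LowerSemicontinuous f)
    {μs : ℕ → ProbabilityMeasure Ω} {μ : ProbabilityMeasure Ω} (h : Tendsto μs atTop (𝓝 μ))
    {C : ℝ≥0∞} (hC : ∀ n, ∫⁻ x, f x ∂(μs n : Measure Ω) ≤ C) :
    ∫⁻ x, f x ∂(μ : Measure Ω) ≤ C := by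
  have htop : ∀ M : ℕ, ∀ x, min (f x) M ≠ ⊤ := fun M x =>
    ne_top_of_le_ne_top (ENNReal.natCast_ne_top M) (min_le_right _ _)
  have hopen : ∀ (M : ℕ) (t : ℝ), 0 ≤ t → IsOpen {x | t < (min (f x) M).toReal} := by
    intro M t ht
    have : {x | t < (min (f x) M).toReal} = {x | ENNReal.ofReal t < f x} ∩
        {x | ENNReal.ofReal t < M} := by
      ext x
      simp only [mem_ofPred_eq, mem_inter_iff]
      rw [← ENNReal.ofReal_lt_iff_lt_toReal ht (htop M x), lt_min_iff]
    rw [this]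
    exact (hf.isOpen_preimage _).inter isOpen_const
  have hM : ∀ M : ℕ, ∫⁻ x, min (f x) M ∂(μ : Measure Ω) ≤ C := by
    intro M
    have hlc : ∀ ν : Measure Ω, ∫⁻ x, min (f x) M ∂ν =
        ∫⁻ t in Ioi (0 : ℝ), ν {x | t < (min (f x) M).toReal} := by
      intro ν
      rw [← lintegral_eq_lintegral_meas_lt ν (f := fun x => (min (f x) M).toReal)
        (Eventually.of_forall fun x => ENNReal.toReal_nonneg)
        ((hf.measurable.min measurable_const).ennreal_toReal.aemeasurable)]
      exact lintegral_congr fun x => (ENNReal.ofReal_toReal (htop M x)).symm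
    rw [hlc]
    calc ∫⁻ t in Ioi (0 : ℝ), (μ : Measure Ω) {x | t < (min (f x) M).toReal}
        ≤ ∫⁻ t in Ioi (0 : ℝ),
          liminf (fun n => (μs n : Measure Ω) {x | t < (min (f x) M).toReal}) atTop := by
          refine setLIntegral_mono' measurableSet_Ioi fun t ht => ?_
          exact ProbabilityMeasure.le_liminf_measure_open_of_tendsto h (hopen M t (le_of_lt ht))
      _ ≤ liminf (fun n => ∫⁻ t in Ioi (0 : ℝ),
          (μs n : Measure Ω) {x | t < (min (f x) M).toReal}) atTop :=
          lintegral_liminf_le fun n => Antitone.measurable fun s t hst =>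
            measure_mono fun x hx => lt_of_le_of_lt hst hx
      _ ≤ C := by
          refine liminf_le_of_le (by isBoundedDefault) fun b hb => ?_
          obtain ⟨n, hn⟩ := hb.exists
          refine hn.trans ?_
          rw [← hlc]
          exact (lintegral_mono fun x => min_le_left _ _).trans (hC n)
  have hsup : ∀ x, ⨆ M : ℕ, min (f x) (M : ℝ≥0∞) = f x := by
    intro x
    rw [← inf_iSup_eq (f x) (fun M : ℕ => (M : ℝ≥0∞)), ENNReal.iSup_natCast, inf_top_eq]
  calc ∫⁻ x, f x ∂(μ : Measure Ω) = ∫⁻ x, ⨆ M : ℕ, min (f x) (M : ℝ≥0∞) ∂(μ : Measure Ω) := by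
        simp_rw [hsup]
    _ = ⨆ M : ℕ, ∫⁻ x, min (f x) (M : ℝ≥0∞) ∂(μ : Measure Ω) := by
        refine lintegral_iSup (fun M => hf.measurable.min measurable_const) ?_
        intro M N hMN x
        exact min_le_min_left _ (by exact_mod_cast hMN)
    _ ≤ C := iSup_le hM

/-! ### Borel versions of initial data, positions and velocities. -/

/-- A jointly continuous extension to all times of the primitive. -/
def primExt (p : EuclideanSpace ℝ (Fin d) × L2 d T) (t : ℝ) : EuclideanSpace ℝ (Fin d) :=
  p.1 + ∫ s in (-1)..t, p.2 s ∂(volume.restrict (Ioo (-1) T))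

theorem primExt_eq (p : EuclideanSpace ℝ (Fin d) × L2 d T) {t : ℝ} (ht : t ∈ Icc (-1) T) :
    primExt p t = prim p.1 p.2 t := by
  rw [primExt, prim, intervalIntegral_eq_integralOn _ le_rfl ht.1 ht.2,
    intervalIntegral.integral_of_le ht.1, integralOn_apply]

/-- The map is continuous in time for fixed data and Lipschitz in the data uniformly in time. Joint
continuity is what makes the time derivative and its domain Borel in (γ, t). -/
theorem continuous_uncurry_primExt :
    Continuous (Function.uncurry (primExt (d := d) (T := T))) := by
  set C := √(((volume.restrict (Ioo (-1) T)) univ).toReal)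
  have hb : ∀ (t : ℝ) (g : L2 d T),
      ‖∫ s in (-1)..t, g s ∂(volume.restrict (Ioo (-1) T))‖ ≤ C * ‖g‖ := by
    intro t g
    have h : ∀ A, ‖∫ s in A, g s ∂(volume.restrict (Ioo (-1) T))‖ ≤ C * ‖g‖ := by
      intro A
      refine (norm_setIntegral_le_L2 _ A g).trans ?_
      refine mul_le_mul_of_nonneg_right (Real.sqrt_le_sqrt ?_) (norm_nonneg _)
      exact ENNReal.toReal_mono (measure_ne_top _ _) (measure_mono (subset_univ _))
    rcases le_total (-1) t with h1 | h1
    · rw [intervalIntegral.integral_of_le h1]; exact h _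
    · rw [intervalIntegral.integral_of_ge h1, norm_neg]; exact h _
  have hii : ∀ (g : L2 d T) (a b : ℝ),
      IntervalIntegrable g (volume.restrict (Ioo (-1) T)) a b := fun g a b =>
    (integrable_L2 g).intervalIntegrable
  refine continuous_prod_of_continuous_lipschitzWith _ (1 + C).toNNReal ?_ ?_
  · intro p
    exact (continuous_const (y := p.1)).add
      (intervalIntegral.continuous_primitive (hii p.2) (-1))
  · intro t
    refine LipschitzWith.of_dist_le_mul fun p q => ?_
    rw [dist_eq_norm, dist_eq_norm, Real.coe_toNNReal _ (by positivity)]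
    have h1 : ∫ s in (-1)..t, (p.2 - q.2 : L2 d T) s ∂(volume.restrict (Ioo (-1) T)) =
        (∫ s in (-1)..t, p.2 s ∂(volume.restrict (Ioo (-1) T))) -
          ∫ s in (-1)..t, q.2 s ∂(volume.restrict (Ioo (-1) T)) := by
      rw [← intervalIntegral.integral_sub (hii _ _ _) (hii _ _ _)]
      refine intervalIntegral.integral_congr_ae ?_
      filter_upwards [Lp.coeFn_sub p.2 q.2] with s hs _
      rw [hs, Pi.sub_apply]
    have h2 : Function.uncurry (primExt (d := d) (T := T)) (p, t) -
        Function.uncurry (primExt (d := d) (T := T)) (q, t) = (p - q).1 +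
          ∫ s in (-1)..t, (p - q).2 s ∂(volume.restrict (Ioo (-1) T)) := by
      rw [Prod.snd_sub, h1]
      simp only [Function.uncurry, primExt, Prod.fst_sub]
      abel
    rw [h2]
    refine (norm_add_le _ _).trans ?_
    rw [add_mul, one_mul]
    gcongr
    · exact norm_fst_le (p - q)
    · exact (hb t _).trans (by gcongr; exact norm_snd_le (p - q))

/-- Initial value and derivative of a Sobolev curve. -/
def curveData (γ : Curve d T) : EuclideanSpace ℝ (Fin d) × L2 d T :=
  Function.invFun (primCLM d T) (γ : L2 d T)

theorem isPrimitive_curveData {γ : Curve d T} (h : IsSobolev γ) :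
    IsPrimitive γ (curveData γ).1 (curveData γ).2 := by
  obtain ⟨c, g, h⟩ := h
  rw [isPrimitive_iff]
  rw [isPrimitive_iff] at h
  exact (Function.invFun_eq ⟨(c, g), h.symm⟩).symm

theorem curveData_eq (hT : 0 < T) {γ : Curve d T} {c : EuclideanSpace ℝ (Fin d)} {g : L2 d T}
    (h : IsPrimitive γ c g) : curveData γ = (c, g) := by
  rw [curveData, isPrimitive_iff.1 h]
  exact Function.leftInverse_invFun (primCLM_injective hT) _

instance (d : ℕ) (T : ℝ) : PolishSpace (L2 d T) :=
  haveI : Fact ((2 : ℝ≥0∞) ≠ ⊤) := ⟨ENNReal.ofNat_ne_top⟩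
  haveI : SecondCountableTopology (L2 d T) := Lp.SecondCountableTopology
  inferInstance

/-- An injective continuous map between Polish spaces has Borel images of Borel sets
(Lusin-Souslin), so the inverse of `primCLM`, extended by a constant off its range, is Borel. -/
theorem measurable_curveData (hT : 0 < T) :
    Measurable[_, borel (EuclideanSpace ℝ (Fin d) × L2 d T)] (curveData (d := d) (T := T)) := by
  borelize (L2 d T)
  have hb : borel (EuclideanSpace ℝ (Fin d) × L2 d T) = Prod.instMeasurableSpace :=
    (BorelSpace.measurable_eq (α := EuclideanSpace ℝ (Fin d) × L2 d T)).symm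
  rw [hb]
  have he : MeasurableEmbedding (primCLM d T) :=
    (primCLM d T).continuous.measurableEmbedding (primCLM_injective hT)
  have hinv : Measurable (Function.invFun (primCLM d T)) := by
    convert he.measurable_extend measurable_id (measurable_const (a := Classical.choice inferInstance))
      using 1
    ext1 y
    by_cases h : ∃ p, primCLM d T p = y
    · obtain ⟨p, rfl⟩ := h
      rw [he.injective.extend_apply]
      exact Function.leftInverse_invFun he.injective p
    · rw [Function.extend_apply' _ _ _ h, Function.invFun_neg h]
  have hval : Measurable fun γ : Curve d T => (γ : L2 d T) :=
    (continuous_subtype_val (p := fun γ : L2 d T => γ ∈ curveSubmodule d T)).measurable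
  exact hinv.comp hval

theorem measurableSet_isSobolev (hT : 0 < T) : MeasurableSet {γ : Curve d T | IsSobolev γ} := by
  have : {γ : Curve d T | IsSobolev γ} = energy ⁻¹' Iio ⊤ := by
    ext γ
    refine ⟨fun h => ?_, isSobolev_of_energy_lt_top⟩
    obtain ⟨c, g, h⟩ := h
    rw [mem_preimage, energy_eq hT h, mem_Iio]
    exact ENNReal.pow_lt_top enorm_lt_top
  rw [this]
  exact measurable_energy hT measurableSet_Iio

theorem position_eq_primExt (hT : 0 < T) {γ : Curve d T} (h : IsSobolev γ) {t : ℝ}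
    (ht : t ∈ Icc (-1) T) : position γ t = primExt (curveData γ) t := by
  rw [position_eq_prim hT (isPrimitive_curveData h), primExt_eq _ ht]

theorem eventually_position_eq_primExt (hT : 0 < T) {γ : Curve d T} (h : IsSobolev γ) {t : ℝ}
    (ht : t ∈ Ioo (-1) T) : position γ =ᶠ[𝓝 t] primExt (curveData γ) := by
  filter_upwards [isOpen_Ioo.mem_nhds ht] with s hs
  exact position_eq_primExt hT h (Ioo_subset_Icc_self hs)

/-- A jointly measurable version of the velocity. -/
def velocityExt (p : Curve d T × ℝ) : EuclideanSpace ℝ (Fin d) :=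
  deriv (primExt (curveData p.1)) p.2

theorem velocity_eq_velocityExt (hT : 0 < T) {γ : Curve d T} (h : IsSobolev γ) {t : ℝ}
    (ht : t ∈ Ioo (-1) T) : velocity γ t = velocityExt (γ, t) :=
  (eventually_position_eq_primExt hT h ht).deriv_eq

theorem measurable_velocityExt (hT : 0 < T) : Measurable (velocityExt (d := d) (T := T)) := by
  let _ : MeasurableSpace (EuclideanSpace ℝ (Fin d) × L2 d T) := borel _
  have : BorelSpace (EuclideanSpace ℝ (Fin d) × L2 d T) := ⟨rfl⟩
  exact (measurable_deriv_with_param continuous_uncurry_primExt).comp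
    (((measurable_curveData hT).comp measurable_fst).prodMk measurable_snd)

theorem measurable_primExt_curveData (hT : 0 < T) (t : ℝ) :
    Measurable (fun γ : Curve d T => primExt (curveData γ) t) := by
  let _ : MeasurableSpace (EuclideanSpace ℝ (Fin d) × L2 d T) := borel _
  have : BorelSpace (EuclideanSpace ℝ (Fin d) × L2 d T) := ⟨rfl⟩
  have : Continuous fun p : EuclideanSpace ℝ (Fin d) × L2 d T => primExt p t :=
    continuous_uncurry_primExt.comp (continuous_id.prodMk continuous_const)
  exact this.measurable.comp (measurable_curveData hT)

theorem measurableSet_differentiableAt_primExt (hT : 0 < T) : MeasurableSet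
    {p : Curve d T × ℝ | DifferentiableAt ℝ (primExt (curveData p.1)) p.2} := by
  let _ : MeasurableSpace (EuclideanSpace ℝ (Fin d) × L2 d T) := borel _
  have : BorelSpace (EuclideanSpace ℝ (Fin d) × L2 d T) := ⟨rfl⟩
  exact (measurableSet_of_differentiableAt_with_param ℝ continuous_uncurry_primExt).preimage
    (((measurable_curveData hT).comp measurable_fst).prodMk measurable_snd)

end

end PressurelessEuler

/-! ### Tails of curves and the decreasing family of future σ-algebras. -/

namespace PressurelessEuler

noncomputable section

variable {d : ℕ} {T : ℝ}

theorem memLp_indicator_tail {s : ℝ} (t : ℝ) (f : TailCurve d T s) :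
    MemLp ((Ioo s T).indicator f) 2 ((volume.restrict (Ioo (-1) T)).restrict (Ioo t T)) :=
  ((memLp_indicator_iff_restrict measurableSet_Ioo).2 (Lp.memLp f)).restrict _

theorem indicator_tail_ae_congr {s : ℝ} (t : ℝ) {f g : ℝ → EuclideanSpace ℝ (Fin d)}
    (h : f =ᵐ[(volume.restrict (Ioo (-1) T)).restrict (Ioo s T)] g) :
    (Ioo s T).indicator f =ᵐ[(volume.restrict (Ioo (-1) T)).restrict (Ioo t T)]
      (Ioo s T).indicator g := by
  refine ae_restrict_of_ae ?_
  rw [Filter.EventuallyEq, ae_restrict_iff' measurableSet_Ioo] at h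
  filter_upwards [h] with r hr
  by_cases hrs : r ∈ Ioo s T
  · rw [indicator_of_mem hrs, indicator_of_mem hrs, hr hrs]
  · rw [indicator_of_notMem hrs, indicator_of_notMem hrs]

/-- The map between spaces of tails which restricts to `(t,T)` if `s ≤ t` and extends by zero if
`t ≤ s`. -/
def tailMap (d : ℕ) (T s t : ℝ) : TailCurve d T s →L[ℝ] TailCurve d T t :=
  LinearMap.mkContinuous (𝕜 := ℝ) (𝕜₂ := ℝ) (σ := RingHom.id ℝ)
    { toFun := fun f => (memLp_indicator_tail t f).toLp _
      map_add' := fun f g => by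
        rw [← MemLp.toLp_add]
        refine MemLp.toLp_congr _ _ ?_
        rw [← indicator_add']
        exact indicator_tail_ae_congr t (Lp.coeFn_add f g)
      map_smul' := fun c f => by
        rw [RingHom.id_apply, ← MemLp.toLp_const_smul]
        refine MemLp.toLp_congr _ _ ?_
        have h : c • (Ioo s T).indicator f = (Ioo s T).indicator (c • ⇑f) :=
          (indicator_const_smul (Ioo s T) c f).symm
        rw [h]
        exact indicator_tail_ae_congr t (Lp.coeFn_smul c f) }
    1 (fun f => by
      rw [one_mul, Lp.norm_def f]
      refine (Lp.norm_toLp _ (memLp_indicator_tail t f)).trans_le ?_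
      refine ENNReal.toReal_mono (Lp.memLp f).eLpNorm_ne_top ?_
      refine (eLpNorm_restrict_le _ _ _ _).trans ?_
      rw [eLpNorm_indicator_eq_eLpNorm_restrict measurableSet_Ioo])

theorem tailMap_ae_eq (s t : ℝ) (f : TailCurve d T s) :
    tailMap d T s t f =ᵐ[(volume.restrict (Ioo (-1) T)).restrict (Ioo t T)]
      (Ioo s T).indicator f :=
  (memLp_indicator_tail t f).coeFn_toLp

theorem restrictTail_ae_eq (t : ℝ) (γ : Curve d T) :
    restrictTail t γ =ᵐ[(volume.restrict (Ioo (-1) T)).restrict (Ioo t T)] (γ : L2 d T) :=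
  LpToLpRestrictCLM_coeFn ℝ (Ioo t T) (γ : L2 d T)

theorem continuous_restrictTail (t : ℝ) : Continuous (restrictTail (d := d) (T := T) t) :=
  (LpToLpRestrictCLM ℝ (EuclideanSpace ℝ (Fin d)) ℝ (volume.restrict (Ioo (-1) T)) 2
    (Ioo t T)).continuous.comp continuous_subtype_val

theorem measurable_restrictTail (t : ℝ) : Measurable (restrictTail (d := d) (T := T) t) :=
  (continuous_restrictTail t).measurable

theorem tailMap_restrictTail {s t : ℝ} (hst : s ≤ t) (γ : Curve d T) :
    tailMap d T s t (restrictTail s γ) = restrictTail t γ := by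
  refine Lp.ext ?_
  filter_upwards [tailMap_ae_eq s t (restrictTail s γ),
    indicator_tail_ae_congr t (restrictTail_ae_eq s γ), restrictTail_ae_eq t γ,
    ae_restrict_mem measurableSet_Ioo] with r h1 h2 h3 h4
  rw [h1, h2, h3, indicator_of_mem (Ioo_subset_Ioo_left hst h4)]

/-- The two functions differ only on (t, u n], where the difference is -γ; its L² norm there
vanishes by absolute continuity of the integral. -/
theorem tendsto_tailMap_restrictTail (t : ℝ) {u : ℕ → ℝ} (hu : Tendsto u atTop (𝓝 t))
    (γ : Curve d T) :
    Tendsto (fun n => tailMap d T (u n) t (restrictTail (u n) γ)) atTop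
      (𝓝 (restrictTail t γ)) := by
  rw [Lp.tendsto_Lp_iff_tendsto_eLpNorm']
  set ν := (volume.restrict (Ioo (-1) T)).restrict (Ioo t T) with hν
  have h1 : ∀ n, eLpNorm (⇑(tailMap d T (u n) t (restrictTail (u n) γ)) - ⇑(restrictTail t γ)) 2 ν
      ≤ (∫⁻ r in Ioc t (u n), ‖(γ : L2 d T) r‖ₑ ^ (2 : ℝ) ∂ν) ^ (2 : ℝ)⁻¹ := by
    intro n
    have h2 : ⇑(tailMap d T (u n) t (restrictTail (u n) γ)) - ⇑(restrictTail t γ) =ᵐ[ν]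
        (Ioc t (u n)).indicator (-⇑(γ : L2 d T)) := by
      filter_upwards [tailMap_ae_eq (u n) t (restrictTail (u n) γ),
        indicator_tail_ae_congr t (restrictTail_ae_eq (u n) γ), restrictTail_ae_eq t γ,
        ae_restrict_mem measurableSet_Ioo] with r h1 h2 h3 h4
      rw [Pi.sub_apply, h1, h2, h3]
      by_cases hr : r ≤ u n
      · rw [indicator_of_notMem (fun h => absurd h.1 (not_lt.2 hr)),
          indicator_of_mem (show r ∈ Ioc t (u n) from ⟨h4.1, hr⟩), zero_sub, Pi.neg_apply]
      · rw [indicator_of_mem (show r ∈ Ioo (u n) T from ⟨not_le.1 hr, h4.2⟩),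
          indicator_of_notMem (fun h => hr h.2), sub_self]
    rw [eLpNorm_congr_ae h2, eLpNorm_indicator_eq_eLpNorm_restrict measurableSet_Ioc, eLpNorm_neg,
      eLpNorm_eq_lintegral_rpow_enorm_toReal (by norm_num) (by norm_num)]
    simp
  have hfin : ∫⁻ r, ‖(γ : L2 d T) r‖ₑ ^ (2 : ℝ) ∂ν ≠ ⊤ := by
    exact (lintegral_rpow_enorm_lt_top_of_eLpNorm_lt_top (by norm_num) (by norm_num)
      ((Lp.memLp (γ : L2 d T)).restrict (Ioo t T)).2).ne
  have h0 : Tendsto (fun n => ν (Ioc t (u n))) atTop (𝓝 0) := by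
    have h2 : Tendsto (fun n => ENNReal.ofReal (u n - t)) atTop (𝓝 0) := by
      have := ENNReal.tendsto_ofReal (hu.sub_const t)
      simpa using this
    refine tendsto_of_tendsto_of_tendsto_of_le_of_le tendsto_const_nhds h2 (fun n => zero_le)
      fun n => ?_
    rw [← Real.volume_Ioc]
    exact (Measure.restrict_apply_le _ _).trans (Measure.restrict_apply_le _ _)
  have h2 := tendsto_setLIntegral_zero hfin (s := fun n => Ioc t (u n)) h0
  have h3 := (ENNReal.continuous_rpow_const (y := (2 : ℝ)⁻¹)).tendsto 0 |>.comp h2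
  rw [ENNReal.zero_rpow_of_pos (by norm_num)] at h3
  exact tendsto_of_tendsto_of_tendsto_of_le_of_le tendsto_const_nhds h3 (fun n => zero_le) h1

/-- The σ-algebra of events determined by the curve on `(t,T)`. -/
@[reducible]
def future (d : ℕ) (T t : ℝ) : MeasurableSpace (Curve d T) :=
  MeasurableSpace.comap (restrictTail t) inferInstance

theorem future_le (t : ℝ) : future d T t ≤ (inferInstance : MeasurableSpace (Curve d T)) :=
  (measurable_restrictTail t).comap_le

theorem future_anti {s t : ℝ} (hst : s ≤ t) : future d T t ≤ future d T s := by
  have : restrictTail (d := d) (T := T) t = tailMap d T s t ∘ restrictTail s := by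
    ext1 γ
    exact (tailMap_restrictTail hst γ).symm
  rw [future, this, ← MeasurableSpace.comap_comp]
  exact MeasurableSpace.comap_mono (tailMap d T s t).continuous.measurable.comap_le

theorem measurable_future_restrictTail (t : ℝ) :
    Measurable[future d T t] (restrictTail (d := d) (T := T) t) :=
  comap_measurable _

/-- Right continuity of the family: T_t γ is a pointwise limit of functions of the tails T_{u n} γ,
extended by zero. -/
theorem future_le_iSup {t : ℝ} {u : ℕ → ℝ} (hu : Tendsto u atTop (𝓝 t)) :
    future d T t ≤ ⨆ n, future d T (u n) := by
  refine Measurable.comap_le ?_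
  refine @measurable_of_tendsto_metrizable _ _ (⨆ n, future d T (u n)) _ _ _ _
    (fun n γ => tailMap d T (u n) t (restrictTail (u n) γ)) _ (fun n => ?_)
    (tendsto_pi_nhds.2 fun γ => tendsto_tailMap_restrictTail t hu γ)
  exact (tailMap d T (u n) t).continuous.measurable.comp
    ((measurable_future_restrictTail (u n)).mono (le_iSup (fun n => future d T (u n)) n) le_rfl)

/-- The mean of `γ` over `(s, s + δ)`. -/
def forwardMean (d : ℕ) (T s δ : ℝ) : Curve d T →L[ℝ] EuclideanSpace ℝ (Fin d) :=
  δ⁻¹ • (integralOn d T (Ioc s (s + δ))).comp (curveSubmodule d T).subtypeL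

theorem forwardMean_apply (s δ : ℝ) (γ : Curve d T) :
    forwardMean d T s δ γ = δ⁻¹ • integralOn d T (Ioc s (s + δ)) γ := rfl

theorem measurable_future_forwardMean {s t : ℝ} (hst : t ≤ s) (δ : ℝ) :
    Measurable[future d T t] (forwardMean d T s δ) := by
  have h : ∀ γ : Curve d T, forwardMean d T s δ γ = δ⁻¹ • setIntegralL2 (EuclideanSpace ℝ (Fin d))
      ((volume.restrict (Ioo (-1) T)).restrict (Ioo t T)) (Ioc s (s + δ)) (restrictTail t γ) := by
    intro γ
    rw [forwardMean_apply, integralOn_apply]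
    congr 1
    change _ = ∫ r in Ioc s (s + δ), restrictTail t γ r
      ∂((volume.restrict (Ioo (-1) T)).restrict (Ioo t T))
    rw [integral_congr_ae (ae_restrict_of_ae (restrictTail_ae_eq t γ)),
      Measure.restrict_restrict (μ := volume.restrict (Ioo (-1) T)) (t := Ioo t T)
        measurableSet_Ioc]
    have hset : (Ioc s (s + δ) : Set ℝ) =ᵐ[volume.restrict (Ioo (-1) T)]
        (Ioc s (s + δ) ∩ Ioo t T : Set ℝ) := by
      filter_upwards [ae_restrict_mem measurableSet_Ioo] with r hr
      refine propext ⟨fun h => ⟨h, hst.trans_lt h.1, hr.2⟩, fun h => h.1⟩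
    rw [setIntegral_congr_set hset]
  have : ⇑(forwardMean d T s δ) = (fun f => δ⁻¹ • setIntegralL2 (EuclideanSpace ℝ (Fin d))
      ((volume.restrict (Ioo (-1) T)).restrict (Ioo t T)) (Ioc s (s + δ)) f) ∘ restrictTail t :=
    funext h
  rw [this]
  refine Measurable.comp ?_ (measurable_future_restrictTail t)
  exact Continuous.measurable (by fun_prop)

theorem norm_forwardMean_sub_position_le (hT : 0 < T) {γ : Curve d T}
    {c : EuclideanSpace ℝ (Fin d)} {g : L2 d T} (h : IsPrimitive γ c g) {s δ : ℝ} (hs : -1 ≤ s)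
    (hδ : 0 < δ) (hsδ : s + δ ≤ T) :
    ‖forwardMean d T s δ γ - position γ s‖ ≤ √δ * ‖g‖ := by
  have hsT : s ∈ Icc (-1) T := ⟨hs, by linarith⟩
  have hsub : Icc s (s + δ) ⊆ Icc (-1) T := Icc_subset_Icc hs hsδ
  have h1 : ∫ r in s..(s + δ), (γ : L2 d T) r = ∫ r in s..(s + δ), prim c g r := by
    refine intervalIntegral.integral_congr_ae ?_
    have h2 := h
    rw [IsPrimitive, ae_restrict_iff' measurableSet_Ioo] at h2
    have h3 : ∀ᵐ r : ℝ, r ≠ T := by simp [ae_iff, measure_singleton]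
    filter_upwards [h2, h3] with r hr hrT hr2
    rw [uIoc_of_le (by linarith)] at hr2
    exact hr ⟨by linarith [hr2.1], lt_of_le_of_ne (by linarith [hr2.2]) hrT⟩
  have hint : IntervalIntegrable (prim c g) volume s (s + δ) :=
    ((continuousOn_prim c g).mono (by rwa [uIcc_of_le (by linarith)])).intervalIntegrable
  have h2 : forwardMean d T s δ γ - position γ s =
      δ⁻¹ • ∫ r in s..(s + δ), (prim c g r - prim c g s) := by
    rw [forwardMean_apply, ← intervalIntegral_eq_integralOn _ hs (by linarith) hsδ, h1,
      position_eq_prim hT h, intervalIntegral.integral_sub hint (by simp),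
      intervalIntegral.integral_const, add_sub_cancel_left, smul_sub, smul_smul,
      inv_mul_cancel₀ hδ.ne', one_smul]
  rw [h2, norm_smul, norm_inv, Real.norm_of_nonneg hδ.le, inv_mul_le_iff₀ hδ]
  refine (intervalIntegral.norm_integral_le_of_norm_le_const (C := √δ * ‖g‖) fun r hr => ?_).trans ?_
  · rw [uIoc_of_le (by linarith)] at hr
    refine (norm_prim_sub_prim_le c g hsT (hsub ⟨hr.1.le, hr.2⟩)).trans ?_
    gcongr
    rw [abs_of_nonneg (by linarith [hr.1])]
    linarith [hr.2]
  · rw [add_sub_cancel_left, abs_of_pos hδ, mul_comm]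

theorem tendsto_forwardMean (hT : 0 < T) {γ : Curve d T} (h : IsSobolev γ) {s : ℝ} (hs : -1 ≤ s)
    (hsT : s < T) {δ : ℕ → ℝ} (hδ : Tendsto δ atTop (𝓝 0)) (hδ0 : ∀ n, 0 < δ n) :
    Tendsto (fun n => forwardMean d T s (δ n) γ) atTop (𝓝 (position γ s)) := by
  obtain ⟨c, g, h⟩ := h
  rw [tendsto_iff_norm_sub_tendsto_zero]
  have h0 : Tendsto (fun n => √(δ n) * ‖g‖) atTop (𝓝 0) := by
    have := ((Real.continuous_sqrt.tendsto 0).comp hδ).mul_const ‖g‖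
    simpa using this
  refine squeeze_zero' (Eventually.of_forall fun n => norm_nonneg _) ?_ h0
  filter_upwards [hδ.eventually (gt_mem_nhds (sub_pos.2 hsT))] with n hn
  exact norm_forwardMean_sub_position_le hT h hs (hδ0 n) (by linarith)

/-- An exact formula for the position at time `s` in terms of the curve on `(s,T)`. -/
def positionLim (s : ℝ) (γ : Curve d T) : EuclideanSpace ℝ (Fin d) :=
  limUnder atTop fun n : ℕ => forwardMean d T s (1 / ((n : ℝ) + 1)) γ

/-- An exact formula for the velocity at time `t` in terms of the curve on `(t,T)`. -/
def velocityLim (t : ℝ) (γ : Curve d T) : EuclideanSpace ℝ (Fin d) :=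
  limUnder atTop fun n : ℕ =>
    ((n : ℝ) + 1) • (positionLim (t + 1 / ((n : ℝ) + 1)) γ - positionLim t γ)

/-- `position` integrates from time -1, so its dependence on the tail alone is not visible. Forward
means over (s, s + δ) see only times after s, and their limit is measurable for the future
everywhere, not merely up to null sets. -/
theorem stronglyMeasurable_positionLim {s t : ℝ} (hst : t ≤ s) :
    StronglyMeasurable[future d T t] (positionLim (d := d) (T := T) s) :=
  @StronglyMeasurable.limUnder _ _ _ (future d T t) _ _ _ _ _ _ _ fun _ =>
    (measurable_future_forwardMean hst _).stronglyMeasurable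

theorem stronglyMeasurable_velocityLim (t : ℝ) :
    StronglyMeasurable[future d T t] (velocityLim (d := d) (T := T) t) :=
  @StronglyMeasurable.limUnder _ _ _ (future d T t) _ _ _ _ _ _ _ fun n =>
    StronglyMeasurable.fun_const_smul ((stronglyMeasurable_positionLim
      (le_add_of_nonneg_right (show (0 : ℝ) ≤ 1 / ((n : ℝ) + 1) by positivity))).sub
      (stronglyMeasurable_positionLim le_rfl)) _

theorem positionLim_eq (hT : 0 < T) {γ : Curve d T} (h : IsSobolev γ) {s : ℝ} (hs : -1 ≤ s)
    (hsT : s < T) : positionLim s γ = position γ s :=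
  (tendsto_forwardMean hT h hs hsT tendsto_one_div_add_atTop_nhds_zero_nat
    fun n => by positivity).limUnder_eq

theorem velocityLim_eq (hT : 0 < T) {γ : Curve d T} (h : IsSobolev γ) {t : ℝ} (ht : -1 ≤ t)
    (htT : t < T) (hd : DifferentiableAt ℝ (position γ) t) : velocityLim t γ = velocity γ t := by
  refine Tendsto.limUnder_eq ?_
  have h1 := hd.hasDerivAt.tendsto_slope
  have hu : Tendsto (fun n : ℕ => t + 1 / ((n : ℝ) + 1)) atTop (𝓝[≠] t) := by
    refine tendsto_nhdsWithin_iff.2 ⟨?_, Eventually.of_forall fun n => ?_⟩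
    · simpa using tendsto_one_div_add_atTop_nhds_zero_nat.const_add t
    · have : (0 : ℝ) < 1 / ((n : ℝ) + 1) := by positivity
      simp only [mem_compl_iff, mem_singleton_iff]
      linarith
  have h2 := h1.comp hu
  refine h2.congr' ?_
  filter_upwards [(tendsto_nhdsWithin_iff.1 hu).1.eventually (gt_mem_nhds htT)] with n hn
  have hn0 : (0 : ℝ) < 1 / ((n : ℝ) + 1) := by positivity
  rw [Function.comp_apply, slope, positionLim_eq hT h (by linarith) hn, positionLim_eq hT h ht htT]
  simp

end

end PressurelessEuler

/-! ### The equation of motion as a conditional expectation. -/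

namespace PressurelessEuler

noncomputable section

variable {d : ℕ} {T : ℝ}

theorem eLpNorm_two_sq {α F : Type*} [MeasurableSpace α] [NormedAddCommGroup F] (f : α → F)
    (μ : Measure α) : eLpNorm f 2 μ ^ 2 = ∫⁻ x, ‖f x‖ₑ ^ 2 ∂μ := by
  rw [eLpNorm_eq_lintegral_rpow_enorm_toReal (by norm_num) (by norm_num)]
  simp only [ENNReal.toReal_ofNat, ENNReal.rpow_ofNat, one_div]
  rw [← ENNReal.rpow_natCast, ← ENNReal.rpow_mul]
  norm_num

theorem memLp_two_of_lintegral_sq_ne_top {α F : Type*} [MeasurableSpace α] [NormedAddCommGroup F]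
    {f : α → F} {μ : Measure α} (hf : AEStronglyMeasurable f μ) (h : ∫⁻ x, ‖f x‖ₑ ^ 2 ∂μ ≠ ⊤) :
    MemLp f 2 μ := by
  refine ⟨hf, lt_top_iff_ne_top.2 fun htop => h ?_⟩
  rw [← eLpNorm_two_sq, htop]
  rfl

instance (η : ProbabilityMeasure (Curve d T)) : IsFiniteMeasure (η : Measure (Curve d T)) :=
  IsZeroOrProbabilityMeasure.toIsFiniteMeasure _

instance (η : ProbabilityMeasure (Curve d T)) : SFinite (η : Measure (Curve d T)) :=
  @instSFiniteOfSigmaFinite _ _ _ (IsFiniteMeasure.toSigmaFinite _)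

instance (η : ProbabilityMeasure (Curve d T)) (t : ℝ) :
    SigmaFinite ((η : Measure (Curve d T)).trim (future_le t)) :=
  @IsFiniteMeasure.toSigmaFinite _ _ _ (isFiniteMeasure_trim (future_le t))

variable {η : ProbabilityMeasure (Curve d T)}

theorem IsAdmissible.ae_isSobolev (hT : 0 < T) (h : IsAdmissible η) :
    ∀ᵐ γ ∂(η : Measure (Curve d T)), IsSobolev γ := by
  filter_upwards [ae_lt_top (measurable_energy hT) (ne_top_of_le_ne_top ENNReal.one_ne_top h.2)]
    with γ hγ using isSobolev_of_energy_lt_top hγ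

theorem enorm_affineSlope_sq_le_energy (hT : 0 < T) {γ : Curve d T} (h : IsSobolev γ) :
    ‖affineSlope d T γ‖ₑ ^ 2 ≤ energy γ := by
  obtain ⟨c, g, h⟩ := h
  rw [energy_eq hT h, ← lintegral_enorm_sq_L2]
  calc ‖affineSlope d T γ‖ₑ ^ 2 = ∫⁻ t in Ioo (-1 : ℝ) 0, ‖affineSlope d T γ‖ₑ ^ 2 := by simp
    _ = ∫⁻ t in Ioo (-1 : ℝ) 0, ‖g t‖ₑ ^ 2 := by
      refine lintegral_congr_ae ?_
      filter_upwards [derivative_affine hT h] with t ht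
      rw [ht]
    _ ≤ ∫⁻ t in Ioo (-1 : ℝ) T, ‖g t‖ₑ ^ 2 := lintegral_mono_set (Ioo_subset_Ioo_right hT.le)

theorem IsAdmissible.lintegral_affineSlope_le (hT : 0 < T) (h : IsAdmissible η) :
    ∫⁻ γ, ‖affineSlope d T γ‖ₑ ^ 2 ∂(η : Measure (Curve d T)) ≤ 1 := by
  refine le_trans (lintegral_mono_ae ?_) h.2
  filter_upwards [h.ae_isSobolev hT] with γ hγ using enorm_affineSlope_sq_le_energy hT hγ

theorem lintegral_affineValue_eq (hT : 0 < T)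
    (h : ∀ᵐ γ ∂(η : Measure (Curve d T)), IsSobolev γ) :
    ∫⁻ γ, ‖affineValue d T γ‖ₑ ^ 2 ∂(η : Measure (Curve d T)) =
      ∫⁻ γ, ‖position γ 0‖ₑ ^ 2 ∂(η : Measure (Curve d T)) := by
  refine lintegral_congr_ae ?_
  filter_upwards [h] with γ hγ
  rw [position_zero hT hγ]

theorem IsAdmissible.memLp_affineSlope (hT : 0 < T) (h : IsAdmissible η) :
    MemLp (affineSlope d T) 2 (η : Measure (Curve d T)) :=
  memLp_two_of_lintegral_sq_ne_top (affineSlope d T).continuous.aestronglyMeasurable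
    (ne_top_of_le_ne_top ENNReal.one_ne_top (h.lintegral_affineSlope_le hT))

theorem IsAdmissible.memLp_affineValue (hT : 0 < T) (h : IsAdmissible η) :
    MemLp (affineValue d T) 2 (η : Measure (Curve d T)) := by
  refine memLp_two_of_lintegral_sq_ne_top (affineValue d T).continuous.aestronglyMeasurable ?_
  rw [lintegral_affineValue_eq hT (h.ae_isSobolev hT)]
  exact ne_top_of_le_ne_top ENNReal.one_ne_top h.1

theorem meanVelocity_ae_eq (hT : 0 < T) (h : IsAdmissible η) (t : ℝ) :
    meanVelocity η t =ᵐ[(η : Measure (Curve d T))]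
      (η : Measure (Curve d T))[affineSlope d T | future d T t] := by
  have h1 : affineSlope d T =ᵐ[(η : Measure (Curve d T))] initialVelocity := by
    filter_upwards [h.ae_isSobolev hT] with γ hγ using (initialVelocity_eq hT hγ).symm
  have hi : Integrable initialVelocity (η : Measure (Curve d T)) :=
    (h.memLp_affineSlope hT |>.integrable one_le_two).congr h1
  refine EventuallyEq.trans ?_ (condExp_congr_ae h1.symm)
  exact (condExp_ae_eq_integral_condDistrib_id (measurable_restrictTail t) hi).symm

theorem velocityExt_ae_eq (hT : 0 < T) {γ : Curve d T} {c : EuclideanSpace ℝ (Fin d)} {g : L2 d T}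
    (h : IsPrimitive γ c g) :
    (fun t => velocityExt (γ, t)) =ᵐ[volume.restrict (Ioo (-1) T)] g := by
  filter_upwards [velocity_ae_eq hT h, ae_restrict_mem measurableSet_Ioo] with t h1 h2
  rw [← velocity_eq_velocityExt hT ⟨c, g, h⟩ h2, h1]

theorem lintegral_velocityExt (hT : 0 < T) {γ : Curve d T} (h : IsSobolev γ) :
    ∫⁻ t in Ioo (-1) T, ‖velocityExt (γ, t)‖ₑ ^ 2 = energy γ := by
  obtain ⟨c, g, h⟩ := h
  rw [energy_eq hT h, ← lintegral_enorm_sq_L2]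
  refine lintegral_congr_ae ?_
  filter_upwards [velocityExt_ae_eq hT h] with t ht
  rw [ht]

theorem lintegral_lintegral_velocityExt (hT : 0 < T)
    (h : ∀ᵐ γ ∂(η : Measure (Curve d T)), IsSobolev γ) :
    ∫⁻ t in Ioo (-1) T, ∫⁻ γ, ‖velocityExt (γ, t)‖ₑ ^ 2 ∂(η : Measure (Curve d T)) =
      ∫⁻ γ, energy γ ∂(η : Measure (Curve d T)) := by
  rw [lintegral_lintegral_swap]
  · refine lintegral_congr_ae ?_
    filter_upwards [h] with γ hγ using lintegral_velocityExt hT hγ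
  · exact (((measurable_velocityExt hT).comp measurable_swap).enorm.pow_const 2).aemeasurable

theorem IsAdmissible.memLp_velocityExt (hT : 0 < T) (h : IsAdmissible η) :
    MemLp velocityExt 2 ((η : Measure (Curve d T)).prod (volume.restrict (Ioo (-1) T))) := by
  refine memLp_two_of_lintegral_sq_ne_top (measurable_velocityExt hT).aestronglyMeasurable ?_
  rw [lintegral_prod _ ((measurable_velocityExt hT).enorm.pow_const 2).aemeasurable]
  refine ne_top_of_le_ne_top ENNReal.one_ne_top (le_trans (le_of_eq (lintegral_congr_ae ?_)) h.2)
  filter_upwards [h.ae_isSobolev hT] with γ hγ using lintegral_velocityExt hT hγ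

theorem IsAdmissible.ae_memLp_velocityExt (hT : 0 < T) (h : IsAdmissible η) :
    ∀ᵐ t ∂(volume.restrict (Ioo (-1) T)),
      MemLp (fun γ => velocityExt (γ, t)) 2 (η : Measure (Curve d T)) := by
  have h1 := lintegral_lintegral_velocityExt hT (h.ae_isSobolev hT)
  have hm : Measurable fun t : ℝ =>
      ∫⁻ γ, ‖velocityExt (γ, t)‖ₑ ^ 2 ∂(η : Measure (Curve d T)) :=
    ((measurable_velocityExt hT).enorm.pow_const 2).lintegral_prod_left'
  filter_upwards [ae_lt_top hm (h1.trans_ne (ne_top_of_le_ne_top ENNReal.one_ne_top h.2))]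
    with t ht
  exact memLp_two_of_lintegral_sq_ne_top
    ((measurable_velocityExt hT).comp measurable_prodMk_right).aestronglyMeasurable ht.ne

/-- Each Sobolev curve is differentiable at a.e. time; Fubini turns this into differentiability at t
of almost every curve, for a.e. t. Hence the velocity at t has a version measurable for the future
of t. -/
theorem ae_velocityExt_eq_velocityLim (hT : 0 < T)
    (h : ∀ᵐ γ ∂(η : Measure (Curve d T)), IsSobolev γ) :
    ∀ᵐ t ∂(volume.restrict (Ioo (-1) T)),
      (fun γ => velocityExt (γ, t)) =ᵐ[(η : Measure (Curve d T))] velocityLim t := by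
  have h1 : ∀ᵐ γ ∂(η : Measure (Curve d T)), ∀ᵐ t ∂(volume.restrict (Ioo (-1) T)),
      DifferentiableAt ℝ (primExt (curveData γ)) t := by
    filter_upwards [h] with γ hγ
    filter_upwards [ae_hasDerivAt_prim hT (curveData γ).1 (curveData γ).2,
      ae_restrict_mem measurableSet_Ioo] with t ht htT
    refine ht.differentiableAt.congr_of_eventuallyEq ?_
    rw [← position_eq_prim hT (isPrimitive_curveData hγ)]
    exact (eventually_position_eq_primExt hT hγ htT).symm
  have h2 := (Measure.ae_ae_comm (measurableSet_differentiableAt_primExt hT)).1 h1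
  filter_upwards [h2, ae_restrict_mem measurableSet_Ioo] with t ht htT
  filter_upwards [ht, h] with γ h3 h4
  have h5 := eventually_position_eq_primExt hT h4 htT
  rw [velocityLim_eq hT h4 htT.1.le htT.2 (h3.congr_of_eventuallyEq h5),
    velocity_eq_velocityExt hT h4 htT]

theorem restrict_Ioo_zero_le (T : ℝ) :
    (volume.restrict (Ioo 0 T) : Measure ℝ) ≤ volume.restrict (Ioo (-1) T) :=
  Measure.restrict_mono (Ioo_subset_Ioo_left (by norm_num)) le_rfl

theorem isDissipative_iff (hT : 0 < T) : IsDissipative η ↔ IsAdmissible η ∧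
    ∀ᵐ t ∂(volume.restrict (Ioo 0 T)), (fun γ => velocityExt (γ, t)) =ᵐ[(η : Measure (Curve d T))]
      (η : Measure (Curve d T))[affineSlope d T | future d T t] := by
  refine and_congr_right fun h => ?_
  rw [← Measure.restrict_congr_set (Ioo_ae_eq_Icc (a := (0 : ℝ)) (b := T))]
  have key : ∀ t ∈ Ioo 0 T, ((∀ᵐ γ ∂(η : Measure (Curve d T)),
      velocity γ t = meanVelocity η t γ) ↔ (fun γ => velocityExt (γ, t)) =ᵐ[(η : Measure (Curve d T))]
      (η : Measure (Curve d T))[affineSlope d T | future d T t]) := by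
    intro t ht
    refine eventually_congr ?_
    filter_upwards [h.ae_isSobolev hT, meanVelocity_ae_eq hT h t] with γ h1 h2
    rw [h2, velocity_eq_velocityExt hT h1 ⟨by linarith [ht.1], ht.2⟩]
  rw [ae_restrict_iff' measurableSet_Ioo, ae_restrict_iff' measurableSet_Ioo]
  refine eventually_congr (Eventually.of_forall fun t => ?_)
  exact forall_congr' fun ht => key t ht

/-- Equal integrals over future events characterise the conditional expectation only for a function
measurable for the future; `velocityLim` supplies that for a.e. t. -/
theorem velocityExt_ae_eq_condExp_iff (hT : 0 < T) (h : IsAdmissible η) :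
    ∀ᵐ t ∂(volume.restrict (Ioo 0 T)), ((fun γ => velocityExt (γ, t)) =ᵐ[(η : Measure (Curve d T))]
      (η : Measure (Curve d T))[affineSlope d T | future d T t] ↔
      ∀ B, MeasurableSet[future d T t] B → ∫ γ in B, velocityExt (γ, t) ∂(η : Measure (Curve d T)) =
        ∫ γ in B, affineSlope d T γ ∂(η : Measure (Curve d T))) := by
  have h1 := h.ae_memLp_velocityExt hT
  have h2 := ae_velocityExt_eq_velocityLim hT (h.ae_isSobolev hT)
  have hW := (h.memLp_affineSlope hT).integrable one_le_two
  filter_upwards [ae_mono (restrict_Ioo_zero_le T) h1, ae_mono (restrict_Ioo_zero_le T) h2]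
    with t ht1 ht2
  constructor
  · intro he B hB
    rw [← setIntegral_condExp (future_le t) hW hB]
    exact integral_congr_ae (ae_restrict_of_ae he)
  · intro he
    refine ae_eq_condExp_of_forall_setIntegral_eq (future_le t) hW
      (fun s _ _ => (ht1.integrable one_le_two).integrableOn) (fun B hB _ => he B hB) ?_
    exact ⟨velocityLim t, stronglyMeasurable_velocityLim t, ht2⟩

end

end PressurelessEuler

/-! ### The balance law and its stability under narrow limits. -/

namespace PressurelessEuler

noncomputable section

variable {d : ℕ} {T : ℝ}

theorem abs_sub_clamp_le {x M : ℝ} (hM : 0 < M) : |x - max (-M) (min x M)| ≤ x ^ 2 / M := by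
  rcases le_total |x| M with h | h
  · rw [abs_le] at h
    rw [min_eq_left h.2, max_eq_right h.1, sub_self, abs_zero]
    positivity
  · have h1 : |x| ≤ x ^ 2 / M := by
      rw [le_div_iff₀ hM, ← sq_abs, sq]
      gcongr
    refine le_trans ?_ h1
    rcases le_total 0 x with hx | hx
    · rw [abs_of_nonneg hx] at h ⊢
      rw [min_eq_right h, max_eq_right (by linarith), abs_le]
      constructor <;> linarith
    · rw [abs_of_nonpos hx] at h ⊢
      rw [min_eq_left (by linarith), max_eq_left (by linarith), abs_le]
      constructor <;> linarith

theorem integral_sq_le_of_lintegral {Ω : Type*} [MeasurableSpace Ω] {μ : Measure Ω} {f : Ω → ℝ}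
    (hf : AEStronglyMeasurable f μ) {K : ℝ} (hK0 : 0 ≤ K)
    (h : ∫⁻ x, ‖f x‖ₑ ^ 2 ∂μ ≤ ENNReal.ofReal K) :
    Integrable (fun x => f x ^ 2) μ ∧ ∫ x, f x ^ 2 ∂μ ≤ K := by
  have hL := memLp_two_of_lintegral_sq_ne_top hf (ne_top_of_le_ne_top ENNReal.ofReal_ne_top h)
  refine ⟨hL.integrable_sq, ?_⟩
  rw [integral_eq_lintegral_of_nonneg_ae (Eventually.of_forall fun x => sq_nonneg _)
    hL.integrable_sq.aestronglyMeasurable]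
  refine ENNReal.toReal_le_of_le_ofReal hK0 (le_trans (le_of_eq (lintegral_congr fun x => ?_)) h)
  rw [← sq_abs, ENNReal.ofReal_pow (abs_nonneg _), ← Real.norm_eq_abs, ofReal_norm]

theorem abs_integral_sub_clamp_le {Ω : Type*} [MeasurableSpace Ω]
    {μ : Measure Ω} [IsProbabilityMeasure μ] {f : Ω → ℝ} (hf : AEStronglyMeasurable f μ) {K : ℝ}
    (hK0 : 0 ≤ K) (h : ∫⁻ x, ‖f x‖ₑ ^ 2 ∂μ ≤ ENNReal.ofReal K) {M : ℝ} (hM : 0 < M) :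
    |∫ x, f x ∂μ - ∫ x, max (-M) (min (f x) M) ∂μ| ≤ K / M := by
  obtain ⟨hi, hb⟩ := integral_sq_le_of_lintegral hf hK0 h
  have hfi : Integrable f μ := (memLp_two_of_lintegral_sq_ne_top hf
    (ne_top_of_le_ne_top ENNReal.ofReal_ne_top h)).integrable one_le_two
  have hci : Integrable (fun x => max (-M) (min (f x) M)) μ := by
    refine Integrable.of_bound (aestronglyMeasurable_const.sup (hf.inf aestronglyMeasurable_const)) M
      (Eventually.of_forall fun x => ?_)
    rw [Real.norm_eq_abs, abs_le]
    exact ⟨le_max_left _ _, max_le (by linarith) (min_le_right _ _)⟩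
  rw [← integral_sub hfi hci, ← Real.norm_eq_abs]
  refine (norm_integral_le_integral_norm _).trans ?_
  calc ∫ x, ‖f x - max (-M) (min (f x) M)‖ ∂μ ≤ ∫ x, f x ^ 2 / M ∂μ :=
        integral_mono (hfi.sub hci).norm (hi.div_const M) fun x => abs_sub_clamp_le hM
    _ = (∫ x, f x ^ 2 ∂μ) / M := integral_div _ _
    _ ≤ K / M := by gcongr

/-- A uniform second moment gives uniform integrability: clamping f to [-M, M] changes each integral
by at most K / M, and the clamped function is bounded and continuous. -/
theorem tendsto_integral_of_sq_bound {Ω : Type*} [MeasurableSpace Ω] [TopologicalSpace Ω]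
    [OpensMeasurableSpace Ω] {μs : ℕ → ProbabilityMeasure Ω} {μ : ProbabilityMeasure Ω}
    (h : Tendsto μs atTop (𝓝 μ)) {f : Ω → ℝ} (hf : Continuous f) {K : ℝ} (hK0 : 0 ≤ K)
    (hK : ∀ n, ∫⁻ x, ‖f x‖ₑ ^ 2 ∂(μs n : Measure Ω) ≤ ENNReal.ofReal K)
    (hKμ : ∫⁻ x, ‖f x‖ₑ ^ 2 ∂(μ : Measure Ω) ≤ ENNReal.ofReal K) :
    Tendsto (fun n => ∫ x, f x ∂(μs n : Measure Ω)) atTop (𝓝 (∫ x, f x ∂(μ : Measure Ω))) := by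
  rw [Metric.tendsto_atTop]
  intro ε hε
  obtain ⟨M, hM0, hM⟩ : ∃ M : ℝ, 0 < M ∧ K / M < ε / 3 := by
    refine ⟨4 * (K + 1) / ε, by positivity, ?_⟩
    rw [div_lt_iff₀ (by positivity)]
    field_simp
    linarith
  let F : BoundedContinuousFunction Ω ℝ := BoundedContinuousFunction.ofNormedAddCommGroup
    (fun x => max (-M) (min (f x) M)) (by fun_prop) M (fun x => by
      rw [Real.norm_eq_abs, abs_le]
      exact ⟨le_max_left _ _, max_le (by linarith) (min_le_right _ _)⟩)
  have hF := (ProbabilityMeasure.tendsto_iff_forall_integral_tendsto.1 h) F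
  rw [Metric.tendsto_atTop] at hF
  obtain ⟨N, hN⟩ := hF (ε / 3) (by linarith)
  refine ⟨N, fun n hn => ?_⟩
  have h1 := hN n hn
  have h2 := abs_integral_sub_clamp_le (μ := (μs n : Measure Ω))
    hf.aestronglyMeasurable hK0 (hK n) hM0
  have h3 := abs_integral_sub_clamp_le (μ := (μ : Measure Ω))
    hf.aestronglyMeasurable hK0 hKμ hM0
  have hFeq : ∀ x, F x = max (-M) (min (f x) M) := fun x => rfl
  simp_rw [hFeq] at h1
  rw [Real.dist_eq] at h1 ⊢
  rw [abs_lt] at h1 ⊢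
  rw [abs_le] at h2 h3
  constructor <;> linarith

theorem exists_enorm_sq_le_energy (hT : 0 < T) : ∃ C : ℝ≥0, ∀ γ : Curve d T, IsSobolev γ →
    ‖γ‖ₑ ^ 2 ≤ C * (‖position γ 0‖ₑ ^ 2 + energy γ) := by
  -- The 5 is from (x + 2y)² ≤ 5(x² + y²), where x = |γ(0)| and y = ‖γ̇‖: the datum at time -1 has
  -- norm at most x + y, since the slope is bounded by y.
  refine ⟨5 * ‖primCLM d T‖₊ ^ 2, fun γ hγ => ?_⟩
  have hW := enorm_affineSlope_sq_le_energy hT hγ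
  have h0 := position_zero hT hγ
  have h1 := position_affine hT hγ (t := -1) (by simp)
  obtain ⟨c, g, h⟩ := hγ
  rw [energy_eq hT h] at hW ⊢
  have hW' : ‖affineSlope d T γ‖ ≤ ‖g‖ := by
    have : ‖affineSlope d T γ‖ₑ ≤ ‖g‖ₑ := by
      simpa using (ENNReal.pow_le_pow_left_iff two_ne_zero).1 hW
    exact enorm_le_iff_norm_le.1 this
  have hc : c = position γ 0 - affineSlope d T γ := by
    rw [position_eq_prim hT h] at h1
    simp only [prim, intervalIntegral.integral_same, add_zero] at h1
    rw [h1, h0]; module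
  have hn : ‖γ‖ ≤ ‖primCLM d T‖ * (‖position γ 0‖ + 2 * ‖g‖) := by
    have : ‖γ‖ = ‖primCLM d T (c, g)‖ := by
      rw [← isPrimitive_iff.1 h]; rfl
    rw [this]
    refine ((primCLM d T).le_opNorm _).trans ?_
    gcongr
    rw [Prod.norm_def]
    refine max_le ?_ ?_
    · rw [hc]
      refine (norm_sub_le _ _).trans ?_
      linarith [norm_nonneg g]
    · linarith [norm_nonneg g, norm_nonneg (position γ 0)]
  have hsq : ‖γ‖ ^ 2 ≤ 5 * ‖primCLM d T‖ ^ 2 * (‖position γ 0‖ ^ 2 + ‖g‖ ^ 2) := by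
    calc ‖γ‖ ^ 2 ≤ (‖primCLM d T‖ * (‖position γ 0‖ + 2 * ‖g‖)) ^ 2 := by gcongr
      _ = ‖primCLM d T‖ ^ 2 * (‖position γ 0‖ + 2 * ‖g‖) ^ 2 := by ring
      _ ≤ ‖primCLM d T‖ ^ 2 * (5 * (‖position γ 0‖ ^ 2 + ‖g‖ ^ 2)) := by
        gcongr
        nlinarith [sq_nonneg (2 * ‖position γ 0‖ - ‖g‖)]
      _ = _ := by ring
  simp only [← ofReal_norm, ← ENNReal.ofReal_pow (norm_nonneg _)]
  rw [← ENNReal.ofReal_add (by positivity) (by positivity), ← ENNReal.ofReal_coe_nnreal,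
    ← ENNReal.ofReal_mul (by positivity)]
  exact ENNReal.ofReal_le_ofReal (by simpa using hsq)

theorem exists_lintegral_enorm_sq_le (hT : 0 < T) : ∃ C : ℝ≥0,
    ∀ η : ProbabilityMeasure (Curve d T), IsAdmissible η →
      ∫⁻ γ, ‖γ‖ₑ ^ 2 ∂(η : Measure (Curve d T)) ≤ C := by
  obtain ⟨C, hC⟩ := exists_enorm_sq_le_energy (d := d) hT
  refine ⟨C * 2, fun η h => ?_⟩
  calc ∫⁻ γ, ‖γ‖ₑ ^ 2 ∂(η : Measure (Curve d T))
      ≤ ∫⁻ γ, C * (‖position γ 0‖ₑ ^ 2 + energy γ) ∂(η : Measure (Curve d T)) := by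
        refine lintegral_mono_ae ?_
        filter_upwards [h.ae_isSobolev hT] with γ hγ using hC γ hγ
    _ = C * (∫⁻ γ, ‖position γ 0‖ₑ ^ 2 ∂(η : Measure (Curve d T)) +
          ∫⁻ γ, energy γ ∂(η : Measure (Curve d T))) := by
        rw [lintegral_const_mul' _ _ (by simp), lintegral_add_right _ (measurable_energy hT)]
    _ ≤ C * (1 + 1) := by
        gcongr
        · exact h.1
        · exact h.2
    _ = _ := by norm_num

variable {η : ProbabilityMeasure (Curve d T)}

theorem IsAdmissible.integrable_energy (hT : 0 < T) (h : IsAdmissible η) :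
    Integrable (fun γ => (energy γ).toReal) (η : Measure (Curve d T)) :=
  integrable_toReal_of_lintegral_ne_top (measurable_energy hT).aemeasurable
    (ne_top_of_le_ne_top ENNReal.one_ne_top h.2)

theorem IsAdmissible.integral_energy_le (hT : 0 < T) (h : IsAdmissible η) :
    ∫ γ, (energy γ).toReal ∂(η : Measure (Curve d T)) ≤ 1 := by
  rw [integral_toReal (measurable_energy hT).aemeasurable
    (ae_lt_top (measurable_energy hT) (ne_top_of_le_ne_top ENNReal.one_ne_top h.2))]
  exact ENNReal.toReal_le_of_le_ofReal zero_le_one (by simpa using h.2)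

theorem norm_le_one_add_energy (hT : 0 < T) {γ : Curve d T} {c : EuclideanSpace ℝ (Fin d)}
    {g : L2 d T} (h : IsPrimitive γ c g) : ‖g‖ ≤ 1 + (energy γ).toReal := by
  rw [energy_eq hT h, ENNReal.toReal_pow, toReal_enorm]
  nlinarith [sq_nonneg (‖g‖ - 1)]

theorem IsAdmissible.integrable_position (hT : 0 < T) (h : IsAdmissible η) {t : ℝ}
    (ht : t ∈ Icc (-1) T) :
    Integrable (fun γ => position γ t) (η : Measure (Curve d T)) := by
  have hA := ((h.memLp_affineValue hT).integrable one_le_two).norm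
  have hW := ((h.memLp_affineSlope hT).integrable one_le_two).norm
  have hE : Integrable (fun γ => 1 + (energy γ).toReal) (η : Measure (Curve d T)) :=
    (integrable_const 1).add (h.integrable_energy hT)
  refine ((hA.add hW).add (hE.const_mul √(T + 1))).mono' ?_ ?_
  · refine ⟨fun γ => primExt (curveData γ) t,
      (measurable_primExt_curveData hT t).stronglyMeasurable, ?_⟩
    filter_upwards [h.ae_isSobolev hT] with γ hγ using position_eq_primExt hT hγ ht
  · filter_upwards [h.ae_isSobolev hT] with γ hγ
    have h1 := position_affine hT hγ (t := -1) (by simp)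
    obtain ⟨c, g, h⟩ := hγ
    have hc : c = affineValue d T γ - affineSlope d T γ := by
      rw [position_eq_prim hT h] at h1
      simp only [prim, intervalIntegral.integral_same, add_zero] at h1
      rw [h1]; module
    rw [position_eq_prim hT h]
    refine (norm_prim_le c g ht).trans ?_
    refine add_le_add ?_ ?_
    · rw [hc]; exact norm_sub_le _ _
    · exact mul_le_mul_of_nonneg_left (norm_le_one_add_energy hT h) (Real.sqrt_nonneg _)

/-- The displacement over `(t₁, t₂)` minus the one with constant initial velocity. -/
def excess (t₁ t₂ : ℝ) (γ : Curve d T) : EuclideanSpace ℝ (Fin d) :=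
  position γ t₂ - position γ t₁ - (t₂ - t₁) • affineSlope d T γ

/-- Time-averaged displacement, a continuous approximation of `excess`. -/
def meanExcess (d : ℕ) (T t₁ t₂ δ : ℝ) : Curve d T →L[ℝ] EuclideanSpace ℝ (Fin d) :=
  forwardMean d T t₂ δ - forwardMean d T t₁ δ - (t₂ - t₁) • affineSlope d T

theorem meanExcess_apply (t₁ t₂ δ : ℝ) (γ : Curve d T) : meanExcess d T t₁ t₂ δ γ =
    forwardMean d T t₂ δ γ - forwardMean d T t₁ δ γ - (t₂ - t₁) • affineSlope d T γ := rfl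

theorem IsAdmissible.integrable_excess (hT : 0 < T) (h : IsAdmissible η) {t₁ t₂ : ℝ}
    (ht₁ : t₁ ∈ Icc (-1) T) (ht₂ : t₂ ∈ Icc (-1) T) :
    Integrable (excess t₁ t₂) (η : Measure (Curve d T)) :=
  ((h.integrable_position hT ht₂).sub (h.integrable_position hT ht₁)).sub
    (((h.memLp_affineSlope hT).integrable one_le_two).fun_smul _)

/-- The integrated form of the equation for dissipative solutions. -/
def BalanceLaw (η : ProbabilityMeasure (Curve d T)) : Prop :=
  ∀ t₁ t₂ s, 0 ≤ t₁ → t₁ ≤ t₂ → t₂ ≤ s → s < T → ∀ φ : TailCurve d T s → ℝ, Continuous φ →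
    (∀ x, |φ x| ≤ 1) → ∫ γ, φ (restrictTail s γ) • excess t₁ t₂ γ ∂(η : Measure (Curve d T)) = 0

theorem norm_meanExcess_sub_excess_le (hT : 0 < T) {γ : Curve d T}
    {c : EuclideanSpace ℝ (Fin d)} {g : L2 d T} (h : IsPrimitive γ c g) {t₁ t₂ δ : ℝ}
    (h1 : -1 ≤ t₁) (h2 : -1 ≤ t₂) (hδ : 0 < δ) (h1δ : t₁ + δ ≤ T) (h2δ : t₂ + δ ≤ T) :
    ‖meanExcess d T t₁ t₂ δ γ - excess t₁ t₂ γ‖ ≤ 2 * √δ * ‖g‖ := by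
  have e : meanExcess d T t₁ t₂ δ γ - excess t₁ t₂ γ =
      (forwardMean d T t₂ δ γ - position γ t₂) - (forwardMean d T t₁ δ γ - position γ t₁) := by
    rw [meanExcess_apply, excess]; abel
  rw [e]
  refine (norm_sub_le _ _).trans ?_
  have := norm_forwardMean_sub_position_le hT h h1 hδ h1δ
  have := norm_forwardMean_sub_position_le hT h h2 hδ h2δ
  linarith

/-- The pointwise error is at most 2√δ‖γ̇‖. Bounding ‖γ̇‖ by 1 + energy, whose mean is at most 2,
yields 4√δ with no dependence on η. -/
theorem norm_integral_meanExcess_sub_le (hT : 0 < T) (h : IsAdmissible η) {t₁ t₂ δ : ℝ}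
    (h1 : -1 ≤ t₁) (h2 : -1 ≤ t₂) (hδ : 0 < δ) (h1δ : t₁ + δ ≤ T) (h2δ : t₂ + δ ≤ T)
    {φ : Curve d T → ℝ} (hφ : Continuous φ) (hφ1 : ∀ x, |φ x| ≤ 1) :
    Integrable (fun γ => φ γ • meanExcess d T t₁ t₂ δ γ) (η : Measure (Curve d T)) ∧
      Integrable (fun γ => φ γ • excess t₁ t₂ γ) (η : Measure (Curve d T)) ∧
    ‖∫ γ, φ γ • meanExcess d T t₁ t₂ δ γ ∂(η : Measure (Curve d T)) -
      ∫ γ, φ γ • excess t₁ t₂ γ ∂(η : Measure (Curve d T))‖ ≤ 4 * √δ := by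
  have hi2 : Integrable (fun γ => φ γ • excess t₁ t₂ γ) (η : Measure (Curve d T)) :=
    (h.integrable_excess hT ⟨h1, by linarith⟩ ⟨h2, by linarith⟩).bdd_smul 1
      hφ.aestronglyMeasurable (Eventually.of_forall hφ1)
  have hE : Integrable (fun γ => 2 * √δ * (1 + (energy γ).toReal)) (η : Measure (Curve d T)) :=
    ((integrable_const 1).add (h.integrable_energy hT)).const_mul _
  have hb : ∀ᵐ γ ∂(η : Measure (Curve d T)),
      ‖φ γ • meanExcess d T t₁ t₂ δ γ - φ γ • excess t₁ t₂ γ‖ ≤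
        2 * √δ * (1 + (energy γ).toReal) := by
    filter_upwards [h.ae_isSobolev hT] with γ hγ
    obtain ⟨c, g, hg⟩ := hγ
    rw [← smul_sub, norm_smul, Real.norm_eq_abs]
    refine (mul_le_of_le_one_left (norm_nonneg _) (hφ1 γ)).trans ?_
    refine (norm_meanExcess_sub_excess_le hT hg h1 h2 hδ h1δ h2δ).trans ?_
    gcongr
    exact norm_le_one_add_energy hT hg
  have hi3 : Integrable (fun γ => φ γ • meanExcess d T t₁ t₂ δ γ - φ γ • excess t₁ t₂ γ)
      (η : Measure (Curve d T)) :=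
    hE.mono' ((by fun_prop : Continuous fun γ => φ γ • meanExcess d T t₁ t₂ δ γ)
      |>.aestronglyMeasurable.sub hi2.aestronglyMeasurable) hb
  have hi1 : Integrable (fun γ => φ γ • meanExcess d T t₁ t₂ δ γ) (η : Measure (Curve d T)) := by
    refine (hi3.add hi2).congr (Eventually.of_forall fun γ => ?_)
    rw [Pi.add_apply, sub_add_cancel]
  refine ⟨hi1, hi2, ?_⟩
  rw [← integral_sub hi1 hi2]
  refine (norm_integral_le_of_norm_le hE hb).trans ?_
  rw [integral_const_mul, integral_add (integrable_const 1) (h.integrable_energy hT)]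
  have := h.integral_energy_le hT
  simp only [integral_const, probReal_univ, smul_eq_mul, one_mul]
  nlinarith [Real.sqrt_nonneg δ]

theorem isAdmissible_of_tendsto (hT : 0 < T) {ηs : ℕ → ProbabilityMeasure (Curve d T)}
    (h : Tendsto ηs atTop (𝓝 η)) (ha : ∀ n, IsAdmissible (ηs n)) : IsAdmissible η := by
  have h2 : ∫⁻ γ, energy γ ∂(η : Measure (Curve d T)) ≤ 1 :=
    lintegral_le_of_tendsto (lowerSemicontinuous_energy hT) h fun n => (ha n).2
  have hs : ∀ᵐ γ ∂(η : Measure (Curve d T)), IsSobolev γ := by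
    filter_upwards [ae_lt_top (measurable_energy hT) (ne_top_of_le_ne_top ENNReal.one_ne_top h2)]
      with γ hγ using isSobolev_of_energy_lt_top hγ
  refine ⟨?_, h2⟩
  rw [← lintegral_affineValue_eq hT hs]
  refine lintegral_le_of_tendsto (Continuous.lowerSemicontinuous (by fun_prop)) h fun n => ?_
  rw [lintegral_affineValue_eq hT ((ha n).ae_isSobolev hT)]
  exact (ha n).1

/-- Replacing positions by forward means turns the integrand into a continuous function of γ with
uniformly bounded second moment, so the limit in n can be taken at fixed δ; afterwards δ tends to 0.
-/
theorem balanceLaw_of_tendsto (hT : 0 < T) {ηs : ℕ → ProbabilityMeasure (Curve d T)}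
    (h : Tendsto ηs atTop (𝓝 η)) (ha : ∀ n, IsAdmissible (ηs n)) (hb : ∀ n, BalanceLaw (ηs n)) :
    BalanceLaw η := by
  have haη := isAdmissible_of_tendsto hT h ha
  intro t₁ t₂ s h1 h12 h2s hsT φ hφ hφ1
  obtain ⟨C, hC⟩ := exists_lintegral_enorm_sq_le (d := d) hT
  have hφc : Continuous fun γ : Curve d T => φ (restrictTail s γ) :=
    hφ.comp (continuous_restrictTail s)
  refine ext_inner_left ℝ fun e => ?_
  rw [inner_zero_right]
  -- One 4√δ is inherited from the balance law of the approximating measures, the other is the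
  -- averaging error for η itself.
  have key : ∀ δ, 0 < δ → t₂ + δ ≤ T →
      |inner ℝ e (∫ γ, φ (restrictTail s γ) • excess t₁ t₂ γ ∂(η : Measure (Curve d T)))| ≤
        ‖e‖ * (8 * √δ) := by
    intro δ hδ hδT
    have hb1 : ∀ ν : ProbabilityMeasure (Curve d T), IsAdmissible ν → _ := fun ν hν =>
      norm_integral_meanExcess_sub_le (η := ν) hT hν (t₁ := t₁) (t₂ := t₂)
      (by linarith) (by linarith) hδ (by linarith) hδT hφc (fun x => hφ1 _)
    set A := meanExcess d T t₁ t₂ δ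
    set f : Curve d T → ℝ := fun γ => inner ℝ e (φ (restrictTail s γ) • A γ) with hf
    have hfc : Continuous f := continuous_const.inner (hφc.smul A.continuous)
    have hfK : ∀ ν : ProbabilityMeasure (Curve d T), IsAdmissible ν →
        ∫⁻ γ, ‖f γ‖ₑ ^ 2 ∂(ν : Measure (Curve d T)) ≤
          ENNReal.ofReal ((‖e‖ * ‖A‖) ^ 2 * C) := by
      intro ν hν
      calc ∫⁻ γ, ‖f γ‖ₑ ^ 2 ∂(ν : Measure (Curve d T))
          ≤ ∫⁻ γ, ENNReal.ofReal ((‖e‖ * ‖A‖) ^ 2) * ‖γ‖ₑ ^ 2 ∂(ν : Measure (Curve d T)) := by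
            refine lintegral_mono fun γ => ?_
            simp only [← ofReal_norm, ← ENNReal.ofReal_pow (norm_nonneg _)]
            rw [← ENNReal.ofReal_mul (by positivity)]
            refine ENNReal.ofReal_le_ofReal ?_
            rw [← mul_pow]
            gcongr
            refine (norm_inner_le_norm _ _).trans ?_
            rw [norm_smul, mul_assoc]
            refine mul_le_mul_of_nonneg_left ?_ (norm_nonneg e)
            refine (mul_le_of_le_one_left (norm_nonneg _) (hφ1 _)).trans (A.le_opNorm γ)
        _ ≤ ENNReal.ofReal ((‖e‖ * ‖A‖) ^ 2) * C := by
            rw [lintegral_const_mul' _ _ ENNReal.ofReal_ne_top]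
            gcongr
            exact hC ν hν
        _ = _ := by rw [ENNReal.ofReal_mul (by positivity), ENNReal.ofReal_coe_nnreal]
    have hlim := tendsto_integral_of_sq_bound h hfc (by positivity)
      (fun n => hfK _ (ha n)) (hfK _ haη)
    have hfi : ∀ ν : ProbabilityMeasure (Curve d T), IsAdmissible ν →
        ∫ γ, f γ ∂(ν : Measure (Curve d T)) =
        inner ℝ e (∫ γ, φ (restrictTail s γ) • A γ ∂(ν : Measure (Curve d T))) := fun ν hν =>
      integral_inner (hb1 ν hν).1 e
    have hn : ∀ n, |∫ γ, f γ ∂(ηs n : Measure (Curve d T))| ≤ ‖e‖ * (4 * √δ) := by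
      intro n
      have h3 := (hb1 (ηs n) (ha n)).2.2
      rw [hb n t₁ t₂ s h1 h12 h2s hsT φ hφ hφ1, sub_zero] at h3
      rw [hfi _ (ha n)]
      refine (abs_real_inner_le_norm _ _).trans ?_
      gcongr
    have h4 : |∫ γ, f γ ∂(η : Measure (Curve d T))| ≤ ‖e‖ * (4 * √δ) :=
      le_of_tendsto hlim.abs (Eventually.of_forall hn)
    rw [hfi _ haη] at h4
    have h5 := (hb1 η haη).2.2
    have h6 : |inner ℝ e (∫ γ, φ (restrictTail s γ) • A γ ∂(η : Measure (Curve d T)) -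
        ∫ γ, φ (restrictTail s γ) • excess t₁ t₂ γ ∂(η : Measure (Curve d T)))| ≤
        ‖e‖ * (4 * √δ) :=
      (abs_real_inner_le_norm _ _).trans (by gcongr)
    rw [inner_sub_right] at h6
    rw [abs_le] at h4 h6 ⊢
    constructor <;> linarith
  have hlim : Tendsto (fun δ => ‖e‖ * (8 * √δ)) (𝓝[>] 0) (𝓝 0) := by
    have : Continuous fun δ => ‖e‖ * (8 * √δ) := by fun_prop
    have := (this.tendsto 0).mono_left (nhdsWithin_le_nhds (s := Ioi 0))
    simpa using this
  have : |inner ℝ e (∫ γ, φ (restrictTail s γ) • excess t₁ t₂ γ ∂(η : Measure (Curve d T)))|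
      ≤ 0 := by
    refine ge_of_tendsto hlim ?_
    have hT2 : 0 < T - t₂ := by linarith
    filter_upwards [self_mem_nhdsWithin, nhdsWithin_le_nhds (gt_mem_nhds hT2)] with δ hδ hδT
    exact key δ hδ (by linarith)
  exact abs_nonpos_iff.1 this

end

end PressurelessEuler

/-! ### Equivalence of the balance law with dissipativity, and closedness. -/

namespace PressurelessEuler

noncomputable section

variable {d : ℕ} {T : ℝ} {η : ProbabilityMeasure (Curve d T)}

theorem restrict_Ioc_le {t₁ t₂ : ℝ} (h1 : -1 ≤ t₁) (h2 : t₂ < T) :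
    (volume.restrict (Ioc t₁ t₂) : Measure ℝ) ≤ volume.restrict (Ioo (-1) T) :=
  Measure.restrict_mono (s := Ioc t₁ t₂) (s' := Ioo (-1) T)
    (fun _ hr => ⟨h1.trans_lt hr.1, hr.2.trans_lt h2⟩) le_rfl

theorem restrict_restrict_Ioc {t₁ t₂ : ℝ} (h1 : -1 ≤ t₁) (h2 : t₂ < T) :
    (volume.restrict (Ioo (-1) T)).restrict (Ioc t₁ t₂) =
      (volume.restrict (Ioc t₁ t₂) : Measure ℝ) := by
  rw [Measure.restrict_restrict measurableSet_Ioc, inter_eq_left.2]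
  exact fun _ hr => ⟨h1.trans_lt hr.1, hr.2.trans_lt h2⟩

theorem excess_eq_integral (hT : 0 < T) {γ : Curve d T} (hγ : IsSobolev γ) {t₁ t₂ : ℝ}
    (h1 : -1 ≤ t₁) (h12 : t₁ ≤ t₂) (h2 : t₂ < T) :
    excess t₁ t₂ γ = ∫ t in Ioc t₁ t₂, (velocityExt (γ, t) - affineSlope d T γ) := by
  obtain ⟨c, g, h⟩ := hγ
  have hg : IntegrableOn g (Ioc t₁ t₂) := by
    exact (integrable_L2 g).mono_measure (restrict_Ioc_le h1 h2)
  have hae : ∀ᵐ t ∂(volume.restrict (Ioc t₁ t₂)), velocityExt (γ, t) - affineSlope d T γ =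
      g t - affineSlope d T γ := by
    filter_upwards [ae_mono (restrict_Ioc_le h1 h2) (velocityExt_ae_eq hT h)] with t ht
    rw [ht]
  rw [integral_congr_ae hae, integral_sub hg (integrable_const _),
    ← intervalIntegral.integral_of_le h12, excess, position_eq_prim hT h,
    prim_sub_prim c g ⟨h1, by linarith⟩ ⟨by linarith, h2.le⟩]
  simp [h12]

theorem IsAdmissible.integrable_velocityExt_sub (hT : 0 < T) (h : IsAdmissible η) :
    Integrable (fun p : Curve d T × ℝ => velocityExt p - affineSlope d T p.1)
      ((η : Measure (Curve d T)).prod (volume.restrict (Ioo (-1) T))) :=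
  ((h.memLp_velocityExt hT).integrable one_le_two).sub
    (((h.memLp_affineSlope hT).integrable one_le_two).comp_fst _)

theorem integral_smul_excess_eq (hT : 0 < T) (h : IsAdmissible η) {t₁ t₂ : ℝ}
    (h1 : -1 ≤ t₁) (h12 : t₁ ≤ t₂) (h2 : t₂ < T) {ψ : Curve d T → ℝ} (hψ : Measurable ψ)
    (hψ1 : ∀ x, |ψ x| ≤ 1) :
    Integrable (fun p : Curve d T × ℝ => ψ p.1 • (velocityExt p - affineSlope d T p.1))
      ((η : Measure (Curve d T)).prod (volume.restrict (Ioo (-1) T))) ∧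
    ∫ γ, ψ γ • excess t₁ t₂ γ ∂(η : Measure (Curve d T)) =
      ∫ t in Ioc t₁ t₂, ∫ γ, ψ γ • (velocityExt (γ, t) - affineSlope d T γ)
        ∂(η : Measure (Curve d T)) := by
  have hi : Integrable (fun p : Curve d T × ℝ => ψ p.1 • (velocityExt p - affineSlope d T p.1))
      ((η : Measure (Curve d T)).prod (volume.restrict (Ioo (-1) T))) :=
    (h.integrable_velocityExt_sub hT).bdd_smul 1
      (hψ.comp measurable_fst).aestronglyMeasurable (Eventually.of_forall fun p => hψ1 p.1)
  refine ⟨hi, ?_⟩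
  have hi2 : Integrable (fun p : Curve d T × ℝ => ψ p.1 • (velocityExt p - affineSlope d T p.1))
      ((η : Measure (Curve d T)).prod (volume.restrict (Ioc t₁ t₂))) := by
    have := hi.restrict (s := univ ×ˢ Ioc t₁ t₂)
    rwa [← Measure.prod_restrict, Measure.restrict_univ, restrict_restrict_Ioc h1 h2] at this
  rw [← integral_integral_swap (f := fun (γ : Curve d T) (t : ℝ) =>
    ψ γ • (velocityExt (γ, t) - affineSlope d T γ)) hi2]
  refine integral_congr_ae ?_
  filter_upwards [h.ae_isSobolev hT] with γ hγ
  rw [integral_smul, excess_eq_integral hT hγ h1 h12 h2]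

/-- For t ≤ s the test function of T_s γ is measurable for the future of t and can be pulled out of
the conditional expectation. Thus the integrand of the time integral vanishes for a.e. t. -/
theorem IsDissipative.balanceLaw (hT : 0 < T) (h : IsDissipative η) : BalanceLaw η := by
  intro t₁ t₂ s h1 h12 h2s hsT φ hφ hφ1
  obtain ⟨ha, hd⟩ := (isDissipative_iff hT).1 h
  have hW := (ha.memLp_affineSlope hT).integrable one_le_two
  have hψ : Measurable fun γ : Curve d T => φ (restrictTail s γ) :=
    hφ.measurable.comp (measurable_restrictTail s)
  rw [(integral_smul_excess_eq hT ha (by linarith) h12 (by linarith) hψ fun x => hφ1 _).2]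
  refine integral_eq_zero_of_ae ?_
  have hle : (volume.restrict (Ioc t₁ t₂) : Measure ℝ) ≤ volume.restrict (Ioo 0 T) :=
    Measure.restrict_mono (s := Ioc t₁ t₂) (s' := Ioo 0 T)
      (fun r hr => ⟨by linarith [hr.1], by linarith [hr.2]⟩) le_rfl
  have hm := ae_mono (restrict_Ioc_le (T := T) (t₁ := t₁) (t₂ := t₂) (by linarith) (by linarith))
    (ha.ae_memLp_velocityExt hT)
  filter_upwards [ae_mono hle hd, hm, ae_restrict_mem measurableSet_Ioc] with t ht htm htI
  have hφm : Measurable[future d T t] fun γ : Curve d T => φ (restrictTail s γ) :=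
    hφ.measurable.comp ((measurable_future_restrictTail s).mono
      (future_anti (htI.2.trans h2s)) le_rfl)
  have hi1 : Integrable ((fun γ : Curve d T => φ (restrictTail s γ)) • ⇑(affineSlope d T))
      (η : Measure (Curve d T)) :=
    hW.bdd_smul 1 hψ.aestronglyMeasurable (Eventually.of_forall fun γ => hφ1 _)
  have hi2 : Integrable (fun γ : Curve d T => φ (restrictTail s γ) • velocityExt (γ, t))
      (η : Measure (Curve d T)) :=
    (htm.integrable one_le_two).bdd_smul 1 hψ.aestronglyMeasurable
      (Eventually.of_forall fun γ => hφ1 _)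
  have hpull := condExp_smul_of_aestronglyMeasurable_left (m := future d T t)
    (μ := (η : Measure (Curve d T))) (hφm.stronglyMeasurable.aestronglyMeasurable) hi1 hW
  have hI := integral_condExp (μ := (η : Measure (Curve d T))) (future_le t)
    (f := (fun γ : Curve d T => φ (restrictTail s γ)) • ⇑(affineSlope d T))
  have e : ∫ γ, φ (restrictTail s γ) • velocityExt (γ, t) ∂(η : Measure (Curve d T)) =
      ∫ γ, φ (restrictTail s γ) • affineSlope d T γ ∂(η : Measure (Curve d T)) := by
    refine Eq.trans (integral_congr_ae ?_) hI
    filter_upwards [hpull, ht] with γ h3 h4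
    rw [h3, h4]
    rfl
  simp_rw [smul_sub]
  have hi1' : Integrable (fun γ => φ (restrictTail s γ) • affineSlope d T γ)
    (η : Measure (Curve d T)) := hi1
  rw [integral_sub hi2 hi1', e]
  exact sub_self _

/-- Indicators of closed sets are bounded pointwise limits of continuous functions; closed sets form
a π-system generating the Borel sets. -/
theorem integral_preimage_eq_zero_of_forall_continuous {Ω Y E : Type*} [MeasurableSpace Ω]
    {μ : Measure Ω} [NormedAddCommGroup E] [NormedSpace ℝ E] [MeasurableSpace Y]
    [TopologicalSpace Y] [BorelSpace Y] [HasOuterApproxClosed Y] {S : Ω → Y} (hS : Measurable S)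
    {X : Ω → E} (hX : Integrable X μ)
    (h : ∀ φ : Y → ℝ, Continuous φ → (∀ y, |φ y| ≤ 1) → ∫ ω, φ (S ω) • X ω ∂μ = 0)
    {A : Set Y} (hA : MeasurableSet A) : ∫ ω in S ⁻¹' A, X ω ∂μ = 0 := by
  have hcl : ∀ F : Set Y, IsClosed F → ∫ ω in S ⁻¹' F, X ω ∂μ = 0 := by
    intro F hF
    have hlim : Tendsto (fun n => ∫ ω, ((hF.apprSeq n (S ω) : ℝ≥0) : ℝ) • X ω ∂μ) atTop
        (𝓝 (∫ ω, (S ⁻¹' F).indicator X ω ∂μ)) := by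
      refine tendsto_integral_of_dominated_convergence (fun ω => ‖X ω‖) (fun n => ?_) hX.norm
        (fun n => Eventually.of_forall fun ω => ?_) (Eventually.of_forall fun ω => ?_)
      · refine AEStronglyMeasurable.smul ?_ hX.aestronglyMeasurable
        have : Continuous fun y => ((hF.apprSeq n y : ℝ≥0) : ℝ) :=
          NNReal.continuous_coe.comp (hF.apprSeq n).continuous
        exact (this.measurable.comp hS).aestronglyMeasurable
      · rw [norm_smul]
        refine mul_le_of_le_one_left (norm_nonneg _) ?_
        rw [Real.norm_of_nonneg (NNReal.coe_nonneg _)]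
        exact_mod_cast HasOuterApproxClosed.apprSeq_apply_le_one hF n (S ω)
      · have h1 := tendsto_pi_nhds.1 (HasOuterApproxClosed.tendsto_apprSeq hF) (S ω)
        have h2 := ((NNReal.continuous_coe.tendsto _).comp h1).smul_const (X ω)
        have e : (S ⁻¹' F).indicator X ω =
            ((F.indicator (fun _ => (1 : ℝ≥0)) (S ω) : ℝ≥0) : ℝ) • X ω := by
          by_cases hω : S ω ∈ F
          · rw [indicator_of_mem (show ω ∈ S ⁻¹' F from hω), indicator_of_mem hω]; simp
          · rw [indicator_of_notMem (show ω ∉ S ⁻¹' F from hω), indicator_of_notMem hω]; simp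
        rw [e]
        exact h2
    rw [← integral_indicator (hS hF.measurableSet)]
    refine tendsto_nhds_unique hlim (tendsto_const_nhds.congr fun n => ?_)
    refine (h (fun y => ((hF.apprSeq n y : ℝ≥0) : ℝ))
      (NNReal.continuous_coe.comp (hF.apprSeq n).continuous) fun y => ?_).symm
    rw [abs_of_nonneg (NNReal.coe_nonneg _)]
    exact_mod_cast HasOuterApproxClosed.apprSeq_apply_le_one hF n y
  have huniv : ∫ ω, X ω ∂μ = 0 := by simpa using hcl univ isClosed_univ
  refine MeasurableSpace.induction_on_inter
    (C := fun B _ => ∫ ω in S ⁻¹' B, X ω ∂μ = 0) (s := {F | IsClosed F})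
    (by rw [BorelSpace.measurable_eq (α := Y), borel_eq_generateFrom_isClosed])
    (fun F hF G hG _ => IsClosed.inter hF hG) (by simp) hcl ?_ ?_ A hA
  · intro B hB hB0
    rw [preimage_compl, setIntegral_compl (hS hB) hX, huniv, hB0, sub_zero]
  · intro f hf hfm hf0
    rw [preimage_iUnion, integral_iUnion (fun i => hS (hfm i))
      (fun i j hij => (hf hij).preimage S) hX.integrableOn]
    simp [hf0]

theorem BalanceLaw.setIntegral_excess (hT : 0 < T) (h : IsAdmissible η) (hb : BalanceLaw η)
    {t₁ t₂ s : ℝ} (h1 : 0 ≤ t₁) (h12 : t₁ ≤ t₂) (h2 : t₂ ≤ s) (hs : s < T)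
    {A : Set (TailCurve d T s)} (hA : MeasurableSet A) :
    ∫ γ in restrictTail s ⁻¹' A, excess t₁ t₂ γ ∂(η : Measure (Curve d T)) = 0 :=
  integral_preimage_eq_zero_of_forall_continuous (measurable_restrictTail s)
    (h.integrable_excess hT ⟨by linarith, by linarith⟩ ⟨by linarith, by linarith⟩)
    (fun φ hφ hφ1 => hb t₁ t₂ s h1 h12 h2 hs φ hφ hφ1) hA

theorem ae_eq_zero_of_forall_intervalIntegral_eq_zero {E : Type*} [NormedAddCommGroup E]
    [NormedSpace ℝ E] [CompleteSpace E] {G : ℝ → E} {a b : ℝ} (hab : a ≤ b)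
    (hG : IntervalIntegrable G volume a b) (h : ∀ t ∈ Icc a b, ∫ r in a..t, G r = 0) :
    ∀ᵐ t ∂(volume.restrict (Ioo a b)), G t = 0 := by
  rw [ae_restrict_iff' measurableSet_Ioo]
  filter_upwards [hG.ae_hasDerivAt_integral] with t ht htI
  have h1 := ht (by rw [uIcc_of_le hab]; exact Ioo_subset_Icc_self htI) a left_mem_uIcc
  have h2 : HasDerivAt (fun _ : ℝ => (0 : E)) (G t) t := by
    refine h1.congr_of_eventuallyEq ?_
    filter_upwards [isOpen_Ioo.mem_nhds htI] with r hr
    exact (h r (Ioo_subset_Icc_self hr)).symm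
  exact h2.unique (hasDerivAt_const t 0)

/-- With t₁ = 0 and t₂ = t the balance law says that a primitive in t vanishes on [0, s]; Lebesgue
differentiation kills the integrand. The exceptional null set of times depends on A. -/
theorem BalanceLaw.ae_setIntegral_eq (hT : 0 < T) (h : IsAdmissible η) (hb : BalanceLaw η)
    {s : ℝ} (hs0 : 0 < s) (hs : s < T) {A : Set (TailCurve d T s)} (hA : MeasurableSet A) :
    ∀ᵐ t ∂(volume.restrict (Ioo 0 s)), ∫ γ in restrictTail s ⁻¹' A,
      (velocityExt (γ, t) - affineSlope d T γ) ∂(η : Measure (Curve d T)) = 0 := by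
  set B := restrictTail s ⁻¹' A
  have hB : MeasurableSet B := measurable_restrictTail s hA
  set ψ : Curve d T → ℝ := B.indicator 1
  have hψ : Measurable ψ := measurable_one.indicator hB
  have hψ1 : ∀ x, |ψ x| ≤ 1 := by
    intro x
    by_cases hx : x ∈ B <;> simp [ψ, hx]
  have hψs : ∀ X : Curve d T → EuclideanSpace ℝ (Fin d),
      ∫ γ, ψ γ • X γ ∂(η : Measure (Curve d T)) = ∫ γ in B, X γ ∂(η : Measure (Curve d T)) := by
    intro X
    rw [← integral_indicator hB]
    refine integral_congr_ae (Eventually.of_forall fun γ => ?_)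
    by_cases hx : γ ∈ B <;> simp [ψ, hx]
  have key := fun (t : ℝ) (ht : t ∈ Icc 0 s) =>
    integral_smul_excess_eq hT h (t₁ := 0) (t₂ := t) (by norm_num) ht.1 (ht.2.trans_lt hs) hψ hψ1
  have hint : Integrable (fun t => ∫ γ, ψ γ • (velocityExt (γ, t) - affineSlope d T γ)
      ∂(η : Measure (Curve d T))) (volume.restrict (Ioo (-1) T)) :=
    (key 0 ⟨le_rfl, hs0.le⟩).1.integral_prod_right
  have := ae_eq_zero_of_forall_intervalIntegral_eq_zero hs0.le (G := fun t =>
    ∫ γ, ψ γ • (velocityExt (γ, t) - affineSlope d T γ) ∂(η : Measure (Curve d T))) ?_ ?_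
  · filter_upwards [this] with t ht
    rw [← hψs]
    exact ht
  · rw [intervalIntegrable_iff, uIoc_of_le hs0.le]
    exact hint.mono_measure (restrict_Ioc_le (by norm_num) hs)
  · intro t ht
    rw [intervalIntegral.integral_of_le ht.1, ← (key t ht).2, hψs]
    exact hb.setIntegral_excess hT h le_rfl ht.1 ht.2 hs hA

theorem exists_countable_isPiSystem (α : Type*) [TopologicalSpace α] [SecondCountableTopology α]
    [m : MeasurableSpace α] [BorelSpace α] : ∃ S : Set (Set α), S.Countable ∧ IsPiSystem S ∧
      univ ∈ S ∧ m = MeasurableSpace.generateFrom S := by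
  set b := TopologicalSpace.countableBasis α
  have hb := TopologicalSpace.isBasis_countableBasis α
  refine ⟨sInter '' {F | F.Finite ∧ F ⊆ b}, ?_, ?_, ?_, ?_⟩
  · exact (Set.countable_ofPred_finite_subset
      (TopologicalSpace.countable_countableBasis α)).image _
  · rintro _ ⟨F, hF, rfl⟩ _ ⟨G, hG, rfl⟩ _
    exact ⟨F ∪ G, ⟨hF.1.union hG.1, union_subset hF.2 hG.2⟩, sInter_union F G⟩
  · exact ⟨∅, ⟨finite_empty, empty_subset _⟩, sInter_empty⟩
  · rw [BorelSpace.measurable_eq (α := α), hb.borel_eq_generateFrom]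
    refine le_antisymm (MeasurableSpace.generateFrom_le fun s hs => ?_)
      (MeasurableSpace.generateFrom_le ?_)
    · refine MeasurableSpace.measurableSet_generateFrom ⟨{s}, ⟨finite_singleton s, ?_⟩, ?_⟩
      · simpa using hs
      · exact sInter_singleton s
    · rintro _ ⟨F, hF, rfl⟩
      refine MeasurableSet.sInter hF.1.countable fun s hs => ?_
      exact MeasurableSpace.measurableSet_generateFrom (hF.2 hs)

theorem setIntegral_eq_zero_of_isPiSystem {Ω E : Type*} [NormedAddCommGroup E] [NormedSpace ℝ E]
    {m₀ m : MeasurableSpace Ω} {μ : Measure[m₀] Ω} (hm : m ≤ m₀) {X : Ω → E} (hX : Integrable X μ)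
    {S : Set (Set Ω)} (hgen : m = MeasurableSpace.generateFrom S) (hpi : IsPiSystem S)
    (huniv : univ ∈ S) (h : ∀ B ∈ S, ∫ ω in B, X ω ∂μ = 0) {B : Set Ω} (hB : MeasurableSet[m] B) :
    ∫ ω in B, X ω ∂μ = 0 := by
  have hu : ∫ ω, X ω ∂μ = 0 := by simpa using h univ huniv
  refine MeasurableSpace.induction_on_inter (m := m)
    (C := fun B _ => ∫ ω in B, X ω ∂μ = 0) hgen hpi (by simp) h ?_ ?_ B hB
  · intro B hB hB0
    rw [setIntegral_compl (hm _ hB) hX, hu, hB0, sub_zero]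
  · intro f hf hfm hf0
    rw [integral_iUnion (fun i => hm _ (hfm i)) hf hX.integrableOn]
    simp [hf0]

instance (d : ℕ) (T t : ℝ) : SecondCountableTopology (TailCurve d T t) :=
  haveI : Fact ((2 : ℝ≥0∞) ≠ ⊤) := ⟨ENNReal.ofNat_ne_top⟩
  Lp.SecondCountableTopology

/-- A countable π-system generating the tail σ-algebra makes one null set of times serve all events.
-/
theorem BalanceLaw.ae_forall_setIntegral_eq (hT : 0 < T) (h : IsAdmissible η)
    (hb : BalanceLaw η) {s : ℝ} (hs0 : 0 < s) (hs : s < T) :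
    ∀ᵐ t ∂(volume.restrict (Ioo 0 s)), ∀ B, MeasurableSet[future d T s] B → ∫ γ in B,
      (velocityExt (γ, t) - affineSlope d T γ) ∂(η : Measure (Curve d T)) = 0 := by
  obtain ⟨S, hSc, hSpi, hSu, hSg⟩ := exists_countable_isPiSystem (TailCurve d T s)
  have h1 : ∀ᵐ t ∂(volume.restrict (Ioo 0 s)), ∀ A ∈ S, ∫ γ in restrictTail s ⁻¹' A,
      (velocityExt (γ, t) - affineSlope d T γ) ∂(η : Measure (Curve d T)) = 0 := by
    rw [ae_ball_iff hSc]
    intro A hA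
    refine hb.ae_setIntegral_eq hT h hs0 hs ?_
    rw [hSg]
    exact MeasurableSpace.measurableSet_generateFrom hA
  have hle : (volume.restrict (Ioo 0 s) : Measure ℝ) ≤ volume.restrict (Ioo (-1) T) :=
    Measure.restrict_mono (Ioo_subset_Ioo (by norm_num) hs.le) le_rfl
  filter_upwards [h1, ae_mono hle (h.ae_memLp_velocityExt hT)] with t ht htm B hB
  have hX : Integrable (fun γ => velocityExt (γ, t) - affineSlope d T γ)
      (η : Measure (Curve d T)) :=
    (htm.integrable one_le_two).sub ((h.memLp_affineSlope hT).integrable one_le_two)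
  refine setIntegral_eq_zero_of_isPiSystem (m := future d T s) (future_le s) hX
    (S := preimage (restrictTail s) '' S) ?_ ?_ ⟨univ, hSu, preimage_univ⟩ ?_ hB
  · rw [← MeasurableSpace.comap_generateFrom, ← hSg]
  · rintro _ ⟨A, hA, rfl⟩ _ ⟨A', hA', rfl⟩ hne
    rw [← preimage_inter] at hne ⊢
    exact ⟨A ∩ A', hSpi A hA A' hA' (let ⟨x, hx⟩ := hne; ⟨_, hx⟩), rfl⟩
  · rintro _ ⟨A, hA, rfl⟩
    exact ht A hA

/-- The identity is available for all rational q > t at once. As q decreases to t the futures of q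
increase, and their union is a π-system generating a σ-algebra that contains the future of t. -/
theorem BalanceLaw.isDissipative (hT : 0 < T) (h : IsAdmissible η) (hb : BalanceLaw η) :
    IsDissipative η := by
  rw [isDissipative_iff hT]
  refine ⟨h, ?_⟩
  have h1 : ∀ᵐ t ∂(volume.restrict (Ioo 0 T)), ∀ q : ℚ, t < (q : ℝ) → (q : ℝ) < T →
      ∀ B, MeasurableSet[future d T q] B → ∫ γ in B,
        (velocityExt (γ, t) - affineSlope d T γ) ∂(η : Measure (Curve d T)) = 0 := by
    refine (ae_all_iff (ι := ℚ)).2 fun q => ?_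
    rw [ae_restrict_iff' measurableSet_Ioo]
    by_cases hq : 0 < (q : ℝ) ∧ (q : ℝ) < T
    · have := hb.ae_forall_setIntegral_eq hT h hq.1 hq.2
      rw [ae_restrict_iff' measurableSet_Ioo] at this
      filter_upwards [this] with t ht htT htq _
      exact ht ⟨htT.1, htq⟩
    · refine Eventually.of_forall fun t ht htq hqT => ?_
      exact absurd ⟨ht.1.trans htq, hqT⟩ hq
  filter_upwards [h1, velocityExt_ae_eq_condExp_iff hT h, ae_restrict_mem measurableSet_Ioo,
    ae_mono (restrict_Ioo_zero_le T) (h.ae_memLp_velocityExt hT)] with t ht hiff htI htm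
  have hW := (h.memLp_affineSlope hT).integrable one_le_two
  have hX : Integrable (fun γ => velocityExt (γ, t) - affineSlope d T γ)
      (η : Measure (Curve d T)) := (htm.integrable one_le_two).sub hW
  rw [hiff]
  intro B hB
  have hq : ∀ n : ℕ, ∃ q : ℚ, t < q ∧ (q : ℝ) < min T (t + 1 / ((n : ℝ) + 1)) := fun n =>
    exists_rat_btwn (lt_min htI.2 (lt_add_of_pos_right t (by positivity)))
  choose q hq1 hq2 using hq
  have hlim : Tendsto (fun n => (q n : ℝ)) atTop (𝓝 t) := by
    refine tendsto_of_tendsto_of_tendsto_of_le_of_le tendsto_const_nhds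
      (h := fun n : ℕ => t + 1 / ((n : ℝ) + 1)) ?_ (fun n => (hq1 n).le)
      (fun n => ((hq2 n).trans_le (min_le_right _ _)).le)
    simpa using tendsto_one_div_add_atTop_nhds_zero_nat.const_add t
  have hB' := future_le_iSup hlim B hB
  have hdir : Directed (· ⊆ ·) fun n => {B | MeasurableSet[future d T (q n)] B} := by
    intro n k
    rcases le_total (q n : ℝ) (q k) with hle | hle
    · exact ⟨n, subset_rfl, fun B hB => future_anti hle B hB⟩
    · exact ⟨k, fun B hB => future_anti hle B hB, subset_rfl⟩
  have hz : ∫ γ in B, (velocityExt (γ, t) - affineSlope d T γ) ∂(η : Measure (Curve d T)) = 0 := by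
    refine setIntegral_eq_zero_of_isPiSystem (m := ⨆ n, future d T (q n))
      (iSup_le fun n => future_le _) hX
      (S := ⋃ n, {B | MeasurableSet[future d T (q n)] B})
      (MeasurableSpace.generateFrom_iUnion_measurableSet _).symm ?_ ?_ ?_ hB'
    · refine isPiSystem_iUnion_of_directed_le _ (fun n => ?_) hdir
      exact @MeasurableSpace.isPiSystem_measurableSet _ (future d T (q n))
    · exact mem_iUnion.2 ⟨0, @MeasurableSet.univ _ (future d T (q 0))⟩
    · intro B hB
      obtain ⟨n, hn⟩ := mem_iUnion.1 hB
      exact ht (q n) (hq1 n) ((hq2 n).trans_le (min_le_left _ _)) B hn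
  rw [integral_sub (htm.integrable one_le_two).integrableOn hW.integrableOn] at hz
  exact sub_eq_zero.1 hz

theorem isClosed_setOf_isDissipative (hT : 0 < T) :
    IsClosed {η : ProbabilityMeasure (Curve d T) | IsDissipative η} := by
  refine isClosed_of_closure_subset fun η hη => ?_
  obtain ⟨ηs, h1, h2⟩ := mem_closure_iff_seq_limit.1 hη
  exact (balanceLaw_of_tendsto hT h2 (fun n => (h1 n).1) fun n =>
    (h1 n).balanceLaw hT).isDissipative hT (isAdmissible_of_tendsto hT h2 fun n => (h1 n).1)

end

end PressurelessEuler

/-! ### Particle systems driven by class averages. -/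

namespace PressurelessEuler

noncomputable section

variable {d : ℕ} {T : ℝ}

section ClassAverage

variable {ι F G : Type*} [Fintype ι] [MeasurableSpace ι] [NormedAddCommGroup F] [NormedSpace ℝ F]
  [NormedAddCommGroup G] [NormedSpace ℝ G]

open Classical in
/-- The `μ`-average of `f` over the class of `i` with respect to `r`. -/
def classAvg (F : Type*) [NormedAddCommGroup F] [NormedSpace ℝ F] (μ : Measure ι) (r : Setoid ι)
    (i : ι) : (ι → F) →ₗ[ℝ] F :=
  (∑ j with r i j, μ.real {j})⁻¹ • ∑ j with r i j, μ.real {j} • LinearMap.proj j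

open Classical in
theorem classAvg_apply (μ : Measure ι) (r : Setoid ι) (i : ι) (f : ι → F) :
    classAvg F μ r i f =
      (∑ j with r i j, μ.real {j})⁻¹ • ∑ j with r i j, μ.real {j} • f j := by
  simp [classAvg]

theorem classAvg_congr (μ : Measure ι) {r : Setoid ι} {i j : ι} (h : r i j) (f : ι → F) :
    classAvg F μ r i f = classAvg F μ r j f := by
  have : ∀ k, r i k ↔ r j k := fun k => ⟨fun hk => r.trans (r.symm h) hk, fun hk => r.trans h hk⟩
  classical
  rw [classAvg_apply, classAvg_apply, Finset.filter_congr fun k _ => this k]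

theorem map_classAvg (μ : Measure ι) (r : Setoid ι) (i : ι) (f : ι → F) (L : F →L[ℝ] G) :
    L (classAvg F μ r i f) = classAvg G μ r i fun j => L (f j) := by
  simp only [classAvg_apply, map_smul, map_sum]

theorem norm_classAvg_le (μ : Measure ι) (r : Setoid ι) (i : ι) (f : ι → F) :
    ‖classAvg F μ r i f‖ ≤ ∑ j, ‖f j‖ := by
  classical
  rw [classAvg_apply, Finset.smul_sum]
  refine (norm_sum_le _ _).trans ?_
  refine (Finset.sum_le_sum fun j hj => ?_).trans
    (Finset.sum_le_univ_sum_of_nonneg (s := Finset.univ.filter fun j => r i j)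
      fun j => norm_nonneg (f j))
  rw [smul_smul, norm_smul]
  refine mul_le_of_le_one_left (norm_nonneg _) ?_
  have h0 : ∀ k : ι, 0 ≤ μ.real {k} := fun k => measureReal_nonneg
  have hs : 0 ≤ ∑ k with r i k, μ.real {k} := Finset.sum_nonneg fun k _ => h0 k
  rw [Real.norm_of_nonneg (mul_nonneg (inv_nonneg.2 hs) (h0 j)), inv_mul_eq_div]
  exact div_le_one_of_le₀ (Finset.single_le_sum (fun k _ => h0 k) hj) hs

/-- Class averaging is conditional expectation on a finite space. After exchanging the double sum,
the weights given to j by the members of its class add up to 1, unless j has zero mass and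
contributes nothing. -/
theorem setIntegral_classAvg [MeasurableSingletonClass ι] (μ : Measure ι) [IsFiniteMeasure μ]
    (r : Setoid ι) (f : ι → F) [CompleteSpace F] {B : Set ι} (hB : ∀ i j, r i j → i ∈ B → j ∈ B) :
    ∫ i in B, classAvg F μ r i f ∂μ = ∫ i in B, f i ∂μ := by
  classical
  have hBm : MeasurableSet B := B.toFinite.measurableSet
  rw [← integral_indicator hBm, ← integral_indicator hBm, integral_fintype .of_finite,
    integral_fintype .of_finite]
  have e1 : ∀ i, μ.real {i} • B.indicator (fun i => classAvg F μ r i f) i =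
      ∑ j, if r i j then (μ.real {i} * (∑ k with r i k, μ.real {k})⁻¹) •
        B.indicator (fun i => μ.real {i} • f i) j else 0 := by
    intro i
    rw [← Finset.sum_filter]
    by_cases hi : i ∈ B
    · rw [indicator_of_mem hi, classAvg_apply, smul_smul, Finset.smul_sum]
      refine Finset.sum_congr rfl fun j hj => ?_
      rw [indicator_of_mem (hB i j (Finset.mem_filter.1 hj).2 hi)]
    · rw [indicator_of_notMem hi, smul_zero]
      refine (Finset.sum_eq_zero fun j hj => ?_).symm
      rw [indicator_of_notMem (fun h => hi (hB j i (r.symm (Finset.mem_filter.1 hj).2) h)),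
        smul_zero]
  rw [Finset.sum_congr rfl fun i _ => e1 i, Finset.sum_comm]
  refine Finset.sum_congr rfl fun j _ => ?_
  rw [← Finset.sum_filter, ← Finset.sum_smul]
  by_cases hj : j ∈ B
  · rw [indicator_of_mem hj, indicator_of_mem hj]
    rcases eq_or_ne (μ.real {j}) 0 with h0 | h0
    · rw [h0, zero_smul, smul_zero]
    have e2 : ∑ i with r i j, μ.real {i} * (∑ k with r i k, μ.real {k})⁻¹ = 1 := by
      have e3 : ∀ i, r i j ↔ r j i := fun i => ⟨r.symm, r.symm⟩
      have e4 : ∀ i ∈ Finset.univ.filter fun i => r i j,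
          μ.real {i} * (∑ k with r i k, μ.real {k})⁻¹ =
          μ.real {i} * (∑ k with r j k, μ.real {k})⁻¹ := by
        intro i hi
        have : ∀ k, r i k ↔ r j k := fun k =>
          ⟨fun hk => r.trans (r.symm (Finset.mem_filter.1 hi).2) hk,
            fun hk => r.trans (Finset.mem_filter.1 hi).2 hk⟩
        simp only [this]
      rw [Finset.sum_congr rfl e4, ← Finset.sum_mul]
      simp only [e3]
      refine mul_inv_cancel₀ (ne_of_gt ?_)
      exact (lt_of_le_of_ne measureReal_nonneg h0.symm).trans_le
        (Finset.single_le_sum (f := fun k => μ.real {k}) (fun k _ => measureReal_nonneg)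
          (Finset.mem_filter.2 ⟨Finset.mem_univ j, r.refl j⟩))
    rw [e2, one_smul]
  · rw [indicator_of_notMem hj, indicator_of_notMem hj, smul_zero, smul_zero]

theorem classAvg_single_self [DecidableEq ι] (μ : Measure ι) (r : Setoid ι) {i : ι}
    (hi : 0 < μ.real {i}) : 0 < classAvg ℝ μ r i (Pi.single i 1) := by
  classical
  have hs : μ.real {i} ≤ ∑ k with r i k, μ.real {k} :=
    Finset.single_le_sum (f := fun k => μ.real {k}) (fun k _ => measureReal_nonneg)
      (Finset.mem_filter.2 ⟨Finset.mem_univ i, r.refl i⟩)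
  rw [classAvg_apply]
  refine mul_pos (inv_pos.2 (hi.trans_le hs)) ?_
  rw [Finset.sum_eq_single_of_mem i (Finset.mem_filter.2 ⟨Finset.mem_univ i, r.refl i⟩)]
  · simpa using hi
  · intro j _ hj
    simp [hj]

theorem classAvg_single_of_not_rel [DecidableEq ι] (μ : Measure ι) {r : Setoid ι} {i j : ι}
    (h : ¬ r i j) : classAvg ℝ μ r j (Pi.single i 1) = 0 := by
  classical
  rw [classAvg_apply]
  refine smul_eq_zero_of_right _ (Finset.sum_eq_zero fun k hk => ?_)
  have : k ≠ i := by
    rintro rfl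
    exact h (r.symm (Finset.mem_filter.1 hk).2)
  simp [this]

/-- The class of i is the only one that feels the initial velocity of i. This monotonicity shows
later that two distinct classes react differently to that velocity. -/
theorem classAvg_single_le [DecidableEq ι] (μ : Measure ι) (r : Setoid ι) {i : ι} (j : ι)
    (hi : 0 < μ.real {i}) :
    classAvg ℝ μ r j (Pi.single i 1) ≤ classAvg ℝ μ r i (Pi.single i 1) := by
  by_cases h : r i j
  · exact (classAvg_congr μ h _).ge
  · rw [classAvg_single_of_not_rel μ h]
    exact (classAvg_single_self μ r hi).le

end ClassAverage

section Drift

variable {ι F G : Type*} [Fintype ι] [MeasurableSpace ι] [NormedAddCommGroup F] [NormedSpace ℝ F]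
  [NormedAddCommGroup G] [NormedSpace ℝ G]

/-- The velocity of particle `i`: its initial value before time `0`, and the average of the initial
velocities over the class of `i` with respect to `R k` during `[k h, (k + 1) h)`. -/
def stepVelocity (μ : Measure ι) (R : ℕ → Setoid ι) (h : ℝ) (f : ι → F) (i : ι) (t : ℝ) : F :=
  if t < 0 then f i else classAvg F μ (R ⌊t / h⌋₊) i f

variable {μ : Measure ι} {R : ℕ → Setoid ι} {h : ℝ}

theorem stronglyMeasurable_stepVelocity (f : ι → F) (i : ι) :
    StronglyMeasurable (stepVelocity μ R h f i) := by
  refine StronglyMeasurable.ite measurableSet_Iio stronglyMeasurable_const ?_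
  have : StronglyMeasurable fun n : ℕ => classAvg F μ (R n) i f :=
    StronglyMeasurable.of_discrete
  exact this.comp_measurable (Nat.measurable_floor.comp (measurable_id.div_const h))

theorem norm_stepVelocity_le (f : ι → F) (i : ι) (t : ℝ) :
    ‖stepVelocity μ R h f i t‖ ≤ ∑ j, ‖f j‖ := by
  rw [stepVelocity]
  split_ifs
  · exact Finset.single_le_sum (f := fun j => ‖f j‖) (fun j _ => norm_nonneg _) (Finset.mem_univ i)
  · exact norm_classAvg_le μ _ i f

theorem stepVelocity_add (f f' : ι → F) (i : ι) (t : ℝ) :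
    stepVelocity μ R h (f + f') i t = stepVelocity μ R h f i t + stepVelocity μ R h f' i t := by
  simp only [stepVelocity]
  split_ifs <;> simp

theorem stepVelocity_smul (c : ℝ) (f : ι → F) (i : ι) (t : ℝ) :
    stepVelocity μ R h (c • f) i t = c • stepVelocity μ R h f i t := by
  simp only [stepVelocity]
  split_ifs <;> simp

theorem map_stepVelocity (f : ι → F) (i : ι) (t : ℝ) (L : F →L[ℝ] G) :
    L (stepVelocity μ R h f i t) = stepVelocity μ R h (fun j => L (f j)) i t := by
  simp only [stepVelocity]
  split_ifs
  · rfl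
  · exact map_classAvg μ _ i f L

theorem stepVelocity_of_neg (f : ι → F) (i : ι) {t : ℝ} (ht : t < 0) :
    stepVelocity μ R h f i t = f i := if_pos ht

theorem stepVelocity_of_nonneg (f : ι → F) (i : ι) {t : ℝ} (ht : 0 ≤ t) :
    stepVelocity μ R h f i t = classAvg F μ (R ⌊t / h⌋₊) i f := if_neg ht.not_gt

theorem stepVelocity_of_mem (hh : 0 < h) (f : ι → F) (i : ι) {k : ℕ} {t : ℝ}
    (ht : t ∈ Ico (k * h) ((k + 1) * h)) :
    stepVelocity μ R h f i t = classAvg F μ (R k) i f := by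
  have h0 : 0 ≤ t := (mul_nonneg k.cast_nonneg hh.le).trans ht.1
  rw [stepVelocity_of_nonneg f i h0, (Nat.floor_eq_iff (div_nonneg h0 hh.le)).2
    ⟨(le_div_iff₀ hh).2 ht.1, (div_lt_iff₀ hh).2 ht.2⟩]

theorem stepVelocity_congr (hh : 0 < h) (hR : Monotone R) (f : ι → F) {i j : ι} {k : ℕ}
    (hij : R k i j) {t : ℝ} (ht : k * h ≤ t) :
    stepVelocity μ R h f i t = stepVelocity μ R h f j t := by
  have h0 : 0 ≤ t := (mul_nonneg k.cast_nonneg hh.le).trans ht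
  rw [stepVelocity_of_nonneg f i h0, stepVelocity_of_nonneg f j h0]
  exact classAvg_congr μ (hR (Nat.le_floor ((le_div_iff₀ hh).2 ht)) hij) f

theorem intervalIntegrable_stepVelocity (f : ι → F) (i : ι) (a b : ℝ) :
    IntervalIntegrable (stepVelocity μ R h f i) volume a b := by
  rw [intervalIntegrable_iff]
  exact Measure.integrableOn_of_bounded measure_Ioc_lt_top.ne
    (stronglyMeasurable_stepVelocity f i).aestronglyMeasurable
    (Eventually.of_forall fun t => norm_stepVelocity_le f i t)

/-- The displacement of particle `i` between times `t` and `T`. -/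
def drift (F : Type*) [NormedAddCommGroup F] [NormedSpace ℝ F] (μ : Measure ι) (R : ℕ → Setoid ι)
    (h T : ℝ) (i : ι) (t : ℝ) : (ι → F) →ₗ[ℝ] F where
  toFun f := ∫ s in t..T, stepVelocity μ R h f i s
  map_add' f f' := by
    simp only [stepVelocity_add]
    exact intervalIntegral.integral_add (intervalIntegrable_stepVelocity f i t T)
      (intervalIntegrable_stepVelocity f' i t T)
  map_smul' c f := by
    simp only [stepVelocity_smul, intervalIntegral.integral_smul, RingHom.id_apply]

theorem drift_apply (f : ι → F) (i : ι) (t : ℝ) :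
    drift F μ R h T i t f = ∫ s in t..T, stepVelocity μ R h f i s := rfl

theorem map_drift [CompleteSpace F] [CompleteSpace G] (f : ι → F) (i : ι) (t : ℝ) (L : F →L[ℝ] G) :
    L (drift F μ R h T i t f) = drift G μ R h T i t fun j => L (f j) := by
  simp only [drift_apply, ← map_stepVelocity]
  exact (L.intervalIntegral_comp_comm (intervalIntegrable_stepVelocity f i t T)).symm

theorem drift_step [CompleteSpace F] (hh : 0 < h) (f : ι → F) (i : ι) {k : ℕ} {s t : ℝ}
    (hs : k * h ≤ s) (hst : s ≤ t) (ht : t < (k + 1) * h) :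
    drift F μ R h T i s f = drift F μ R h T i t f + (t - s) • classAvg F μ (R k) i f := by
  rw [drift_apply, drift_apply, ← intervalIntegral.integral_add_adjacent_intervals
    (intervalIntegrable_stepVelocity f i s t) (intervalIntegrable_stepVelocity f i t T), add_comm]
  congr 1
  have : EqOn (stepVelocity μ R h f i) (fun _ => classAvg F μ (R k) i f) (uIcc s t) := by
    intro r hr
    rw [uIcc_of_le hst] at hr
    exact stepVelocity_of_mem hh f i ⟨hs.trans hr.1, hr.2.trans_lt ht⟩
  rw [intervalIntegral.integral_congr this, intervalIntegral.integral_const]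

theorem drift_congr (hh : 0 < h) (hR : Monotone R) (f : ι → F) {i j : ι} {k : ℕ}
    (hij : R k i j) {t : ℝ} (ht : k * h ≤ t) (htT : t ≤ T) :
    drift F μ R h T i t f = drift F μ R h T j t f := by
  refine intervalIntegral.integral_congr fun s hs => ?_
  rw [uIcc_of_le htT] at hs
  exact stepVelocity_congr hh hR f hij (ht.trans hs.1)

/-- A unit initial velocity given to i alone moves i at every time at least as much as j, and
strictly more until the end of the current step, where j does not feel it. So the difference of the
two displacements is a nonzero linear functional of the initial velocities. -/
theorem drift_single_lt [DecidableEq ι] (hh : 0 < h) {i j : ι} (hi : 0 < μ.real {i}) {k : ℕ}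
    (hij : ¬ R k i j) {t : ℝ} (ht : k * h ≤ t) (htk : t < (k + 1) * h) (htT : t < T) :
    drift ℝ μ R h T j t (Pi.single i 1) < drift ℝ μ R h T i t (Pi.single i 1) := by
  obtain ⟨τ, h1, h2⟩ := exists_between (lt_min htk htT)
  have h0 : 0 ≤ t := (mul_nonneg k.cast_nonneg hh.le).trans ht
  rw [drift_step hh _ i ht h1.le (h2.trans_le (min_le_left _ _)),
    drift_step hh _ j ht h1.le (h2.trans_le (min_le_left _ _))]
  refine add_lt_add_of_le_of_lt ?_ ?_
  · refine intervalIntegral.integral_mono_on (h2.le.trans (min_le_right _ _))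
      (intervalIntegrable_stepVelocity _ _ _ _) (intervalIntegrable_stepVelocity _ _ _ _)
      fun s hs => ?_
    have hs0 : 0 ≤ s := h0.trans (h1.le.trans hs.1)
    rw [stepVelocity_of_nonneg _ _ hs0, stepVelocity_of_nonneg _ _ hs0]
    exact classAvg_single_le μ _ j hi
  · rw [classAvg_single_of_not_rel μ hij, smul_zero]
    exact mul_pos (sub_pos.2 h1) (classAvg_single_self μ _ hi)

end Drift

/-! ### Generic absence of collisions in dimension at least two. -/

section Generic

theorem isOpen_dense_setOf_ne {V : Type*} [NormedAddCommGroup V] [NormedSpace ℝ V]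
    [FiniteDimensional ℝ V] (ℓ : V →ₗ[ℝ] ℝ) {v : V} (hv : ℓ v ≠ 0) (c : ℝ) :
    IsOpen {f | ℓ f ≠ c} ∧ Dense {f | ℓ f ≠ c} := by
  have hc : Continuous ℓ := ℓ.continuous_of_finiteDimensional
  refine ⟨isOpen_ne.preimage hc, ?_⟩
  have hs : Function.Surjective ℓ := fun y => ⟨(y / ℓ v) • v, by simp [hv]⟩
  exact (dense_compl_singleton c).preimage (ℓ.isOpenMap_of_finiteDimensional hs)

variable {ι : Type*} [Fintype ι] [MeasurableSpace ι] {μ : Measure ι} {R : ℕ → Setoid ι} {h : ℝ}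

/-- Each constraint excludes an affine hyperplane, the zero set of a nonconstant affine function by
`drift_single_lt`. There are countably many triples, so Baire's theorem gives a dense set of
admissible choices. -/
theorem exists_forall_drift_sub_ne (hh : 0 < h) (f : ι → ℝ) {δ : ℝ} (hδ : 0 < δ)
    (τ : ι → ι → ℕ → ℝ) (c : ι → ι → ℝ) : ∃ f' : ι → ℝ, (∀ i, |f' i - f i| < δ) ∧
      ∀ i j k, 0 < μ.real {i} → ¬ R k i j → k * h ≤ τ i j k → τ i j k < (k + 1) * h →
        τ i j k < T →
        drift ℝ μ R h T i (τ i j k) f' - drift ℝ μ R h T j (τ i j k) f' ≠ c i j := by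
  classical
  let I := {q : ι × ι × ℕ // 0 < μ.real {q.1} ∧ ¬ R q.2.2 q.1 q.2.1 ∧
    q.2.2 * h ≤ τ q.1 q.2.1 q.2.2 ∧ τ q.1 q.2.1 q.2.2 < (q.2.2 + 1) * h ∧ τ q.1 q.2.1 q.2.2 < T}
  have key : ∀ q : I, IsOpen {f' : ι → ℝ | (drift ℝ μ R h T q.1.1 (τ q.1.1 q.1.2.1 q.1.2.2) -
      drift ℝ μ R h T q.1.2.1 (τ q.1.1 q.1.2.1 q.1.2.2)) f' ≠ c q.1.1 q.1.2.1} ∧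
      Dense {f' : ι → ℝ | (drift ℝ μ R h T q.1.1 (τ q.1.1 q.1.2.1 q.1.2.2) -
      drift ℝ μ R h T q.1.2.1 (τ q.1.1 q.1.2.1 q.1.2.2)) f' ≠ c q.1.1 q.1.2.1} := by
    rintro ⟨⟨i, j, k⟩, h1, h2, h3, h4, h5⟩
    refine isOpen_dense_setOf_ne _ (v := Pi.single i 1) ?_ _
    exact (sub_pos.2 (drift_single_lt hh h1 h2 h3 h4 h5)).ne'
  have hd := dense_iInter_of_isOpen (fun q => (key q).1) fun q => (key q).2
  obtain ⟨f', h1, h2⟩ := hd.exists_dist_lt f hδ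
  refine ⟨f', fun i => ?_, fun i j k a1 a2 a3 a4 a5 => ?_⟩
  · rw [dist_comm, dist_pi_lt_iff hδ] at h2
    exact h2 i
  · exact mem_iInter.1 h1 ⟨⟨i, j, k⟩, a1, a2, a3, a4, a5⟩

theorem exists_noncrossing (hd : 2 ≤ d) (hh : 0 < h)
    (a b : ι → EuclideanSpace ℝ (Fin d)) {δ : ℝ} (hδ : 0 < δ) :
    ∃ a' : ι → EuclideanSpace ℝ (Fin d), ‖a' - a‖ < δ ∧
      ∀ i j, 0 < μ.real {i} → ∀ t ∈ Ico 0 T,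
        b i - drift _ μ R h T i t a' = b j - drift _ μ R h T j t a' → R ⌊t / h⌋₊ i j := by
  have h01 : (⟨0, by omega⟩ : Fin d) ≠ ⟨1, by omega⟩ := by simp
  set l₀ : Fin d := ⟨0, by omega⟩
  set l₁ : Fin d := ⟨1, by omega⟩
  have hδ3 : 0 < δ / 3 := by positivity
  -- The zeroth coordinates are chosen so that unrelated particles differ there at the start k h of
  -- every step before T.
  obtain ⟨f, hf1, hf2⟩ := exists_forall_drift_sub_ne (μ := μ) (R := R) (T := T) hh
    (fun i => a i l₀) hδ3 (fun _ _ k => k * h) (fun i j => b i l₀ - b j l₀)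
  let P : ι → ι → ℕ → ℝ → Prop := fun i j k t => k * h ≤ t ∧ t < (k + 1) * h ∧ t < T ∧
    drift ℝ μ R h T i t f - drift ℝ μ R h T j t f = b i l₀ - b j l₀
  -- Within a step the difference of the zeroth coordinates is affine in time and nonzero at the
  -- start, hence it vanishes at most once.
  have hP : ∀ i j k, 0 < μ.real {i} → ¬ R k i j → ∀ s t, s ≤ t → P i j k s → P i j k t → s = t := by
    rintro i j k h1 h2 s t hst ⟨hs1, hs2, hs3, hs4⟩ ⟨ht1, ht2, ht3, ht4⟩
    have e0 := hf2 i j k h1 h2 le_rfl (by linarith) (by linarith)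
    have e1 := drift_step (μ := μ) (R := R) (T := T) hh f i hs1 hst ht2
    have e2 := drift_step (μ := μ) (R := R) (T := T) hh f j hs1 hst ht2
    have e3 := drift_step (μ := μ) (R := R) (T := T) hh f i le_rfl hs1 hs2
    have e4 := drift_step (μ := μ) (R := R) (T := T) hh f j le_rfl hs1 hs2
    simp only [smul_eq_mul] at e1 e2 e3 e4
    have e5 : (t - s) * (classAvg ℝ μ (R k) i f - classAvg ℝ μ (R k) j f) = 0 := by linarith
    rcases mul_eq_zero.1 e5 with e | e
    · linarith
    · refine absurd ?_ e0
      have : (s - k * h) * (classAvg ℝ μ (R k) i f - classAvg ℝ μ (R k) j f) = 0 := by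
        rw [e, mul_zero]
      linarith
  choose τ hτ using fun i j k => (Classical.em (∃ t, P i j k t)).elim
    (fun ⟨t, ht⟩ => (⟨t, fun _ => ht⟩ : ∃ τ, (∃ t, P i j k t) → P i j k τ))
    fun hn => ⟨0, fun hp => absurd hp hn⟩
  obtain ⟨g, hg1, hg2⟩ := exists_forall_drift_sub_ne (μ := μ) (R := R) (T := T) hh
    (fun i => a i l₁) hδ3 τ (fun i j => b i l₁ - b j l₁)
  set a' : ι → EuclideanSpace ℝ (Fin d) := fun i => a i +
    (EuclideanSpace.single l₀ (f i - a i l₀) + EuclideanSpace.single l₁ (g i - a i l₁)) with ha'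
  have c0 : (fun i => EuclideanSpace.proj (𝕜 := ℝ) l₀ (a' i)) = f := by
    ext i
    simp [ha', h01]
  have c1 : (fun i => EuclideanSpace.proj (𝕜 := ℝ) l₁ (a' i)) = g := by
    ext i
    simp [ha', h01.symm]
  refine ⟨a', ?_, fun i j hi t ht he => ?_⟩
  · rw [pi_norm_lt_iff hδ]
    intro i
    rw [Pi.sub_apply, ha', add_sub_cancel_left]
    refine (norm_add_le _ _).trans_lt ?_
    rw [PiLp.norm_single, PiLp.norm_single]
    have := hf1 i
    have := hg1 i
    simp only [Real.norm_eq_abs]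
    linarith
  · by_contra hR
    set k := ⌊t / h⌋₊ with hk
    have hk1 : k * h ≤ t := (le_div_iff₀ hh).1 (Nat.floor_le (div_nonneg ht.1 hh.le))
    have hk2 : t < (k + 1) * h := (div_lt_iff₀ hh).1 (Nat.lt_floor_add_one _)
    have e0 := congrArg (EuclideanSpace.proj (𝕜 := ℝ) l₀) he
    have e1 := congrArg (EuclideanSpace.proj (𝕜 := ℝ) l₁) he
    rw [map_sub, map_sub, map_drift, map_drift, c0] at e0
    rw [map_sub, map_sub, map_drift, map_drift, c1] at e1
    simp only [PiLp.proj_apply] at e0 e1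
    have ht' : P i j k t := ⟨hk1, hk2, ht.2, by linarith⟩
    have hτ' := hτ i j k ⟨t, ht'⟩
    have hτt : τ i j k = t := by
      rcases le_total t (τ i j k) with hle | hle
      · exact (hP i j k hi hR _ _ hle ht' hτ').symm
      · exact hP i j k hi hR _ _ hle hτ' ht'
    refine hg2 i j k hi hR hτ'.1 hτ'.2.1 hτ'.2.2.1 ?_
    rw [hτt]
    linarith

end Generic

end

end PressurelessEuler

/-! ### Trajectories and laws of the particle systems. -/

namespace PressurelessEuler

noncomputable section

variable {d : ℕ} {T : ℝ}

variable {ι : Type*} [Fintype ι] [MeasurableSpace ι] {μ : Measure ι} {R : ℕ → Setoid ι} {h : ℝ}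

theorem memLp_stepVelocity (a : ι → EuclideanSpace ℝ (Fin d)) (i : ι) :
    MemLp (stepVelocity μ R h a i) 2 (volume.restrict (Ioo (-1) T)) :=
  MemLp.of_bound (stronglyMeasurable_stepVelocity a i).aestronglyMeasurable _
    (Eventually.of_forall fun t => norm_stepVelocity_le a i t)

/-- The velocity of particle `i`, as an element of `L²`. -/
def stepL2 (d : ℕ) (T : ℝ) (μ : Measure ι) (R : ℕ → Setoid ι) (h : ℝ) (i : ι) :
    (ι → EuclideanSpace ℝ (Fin d)) →ₗ[ℝ] L2 d T where
  toFun a := (memLp_stepVelocity (μ := μ) (R := R) (h := h) a i).toLp _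
  map_add' a a' := by
    rw [← MemLp.toLp_add]
    exact MemLp.toLp_congr _ _ (ae_of_all _ fun t => stepVelocity_add a a' i t)
  map_smul' c a := by
    rw [RingHom.id_apply, ← MemLp.toLp_const_smul]
    exact MemLp.toLp_congr _ _ (ae_of_all _ fun t => stepVelocity_smul c a i t)

theorem stepL2_ae_eq (a : ι → EuclideanSpace ℝ (Fin d)) (i : ι) :
    stepL2 d T μ R h i a =ᵐ[volume.restrict (Ioo (-1) T)] stepVelocity μ R h a i :=
  (memLp_stepVelocity a i).coeFn_toLp

theorem intervalIntegral_stepL2 (a : ι → EuclideanSpace ℝ (Fin d)) (i : ι) {s t : ℝ}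
    (hs : -1 ≤ s) (hst : s ≤ t) (ht : t ≤ T) :
    ∫ r in s..t, stepL2 d T μ R h i a r = ∫ r in s..t, stepVelocity μ R h a i r := by
  rw [intervalIntegral.integral_of_le hst, intervalIntegral.integral_of_le hst,
    integral_Ioc_eq_integral_Ioo, integral_Ioc_eq_integral_Ioo]
  exact integral_congr_ae (ae_mono (Measure.restrict_mono (Ioo_subset_Ioo hs ht) le_rfl)
    (stepL2_ae_eq a i))

/-- The initial position of particle `i` with final position `b i`. -/
def particleStart (d : ℕ) (T : ℝ) (μ : Measure ι) (R : ℕ → Setoid ι) (h : ℝ)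
    (a b : ι → EuclideanSpace ℝ (Fin d)) (i : ι) : EuclideanSpace ℝ (Fin d) :=
  b i - integralOn d T (Ioc (-1) T) (stepL2 d T μ R h i a)

theorem prim_particleStart (a b : ι → EuclideanSpace ℝ (Fin d)) (i : ι) {t : ℝ}
    (ht : t ∈ Icc (-1) T) : prim (particleStart d T μ R h a b i) (stepL2 d T μ R h i a) t =
      b i - drift _ μ R h T i t a := by
  have h1 : (-1 : ℝ) ≤ T := ht.1.trans ht.2
  have e1 := prim_sub_prim (particleStart d T μ R h a b i) (stepL2 d T μ R h i a) ht
    (right_mem_Icc.2 h1)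
  have e2 : prim (particleStart d T μ R h a b i) (stepL2 d T μ R h i a) T = b i := by
    rw [prim, particleStart, intervalIntegral_eq_integralOn _ le_rfl h1 le_rfl, sub_add_cancel]
  rw [e2, intervalIntegral_stepL2 a i ht.1 ht.2 le_rfl] at e1
  rw [drift_apply, ← e1, sub_sub_cancel]

theorem ae_prim_particleStart_affine (a b : ι → EuclideanSpace ℝ (Fin d)) (i : ι) :
    ∀ᵐ t ∂((volume.restrict (Ioo (-1) T)).restrict (Ioo (-1) 0)),
      primCLM d T (particleStart d T μ R h a b i, stepL2 d T μ R h i a) t =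
        (particleStart d T μ R h a b i + a i) + t • a i := by
  filter_upwards [ae_restrict_of_ae (primCLM_ae_eq (particleStart d T μ R h a b i)
    (stepL2 d T μ R h i a)), ae_restrict_mem measurableSet_Ioo,
    ae_restrict_of_ae (ae_restrict_mem measurableSet_Ioo)] with t h1 h2 h3
  rw [h1, prim, intervalIntegral_stepL2 a i le_rfl h2.1.le h3.2.le]
  have : EqOn (stepVelocity μ R h a i) (fun _ => a i) (uIcc (-1) t) := by
    intro r hr
    rw [uIcc_of_le h2.1.le] at hr
    exact stepVelocity_of_neg a i (hr.2.trans_lt h2.2)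
  rw [intervalIntegral.integral_congr this, intervalIntegral.integral_const]
  module

/-- The trajectory of particle `i`. -/
def particle (d : ℕ) (T : ℝ) (μ : Measure ι) (R : ℕ → Setoid ι) (h : ℝ)
    (a b : ι → EuclideanSpace ℝ (Fin d)) (i : ι) : Curve d T :=
  ⟨primCLM d T (particleStart d T μ R h a b i, stepL2 d T μ R h i a),
    _, _, ae_prim_particleStart_affine a b i⟩

theorem isPrimitive_particle (a b : ι → EuclideanSpace ℝ (Fin d)) (i : ι) :
    IsPrimitive (particle d T μ R h a b i) (particleStart d T μ R h a b i)
      (stepL2 d T μ R h i a) :=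
  isPrimitive_iff.2 rfl

theorem position_particle (hT : 0 < T) (a b : ι → EuclideanSpace ℝ (Fin d)) (i : ι) {t : ℝ}
    (ht : t ∈ Icc (-1) T) :
    position (particle d T μ R h a b i) t = b i - drift _ μ R h T i t a := by
  rw [position_eq_prim hT (isPrimitive_particle a b i), prim_particleStart a b i ht]

theorem affineSlope_particle (hT : 0 < T) (a b : ι → EuclideanSpace ℝ (Fin d)) (i : ι) :
    affineSlope d T (particle d T μ R h a b i) = a i :=
  affineSlope_eq hT (ae_prim_particleStart_affine a b i)

theorem affineValue_particle (hT : 0 < T) (a b : ι → EuclideanSpace ℝ (Fin d)) (i : ι) :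
    affineValue d T (particle d T μ R h a b i) = b i - drift _ μ R h T i 0 a := by
  rw [← position_zero hT ⟨_, _, isPrimitive_particle a b i⟩,
    position_particle hT a b i ⟨by norm_num, hT.le⟩]

/-- Trajectories are traced backwards from their end points. Classmates have the same end point, and
since classes only merge they have the same velocity from then on. -/
theorem restrictTail_particle_congr (hh : 0 < h) (hR : Monotone R)
    (a : ι → EuclideanSpace ℝ (Fin d)) {b : ι → EuclideanSpace ℝ (Fin d)} {i j : ι} {k : ℕ}
    (hij : R k i j) (hb : b i = b j) {t : ℝ} (ht : k * h ≤ t) :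
    restrictTail t (particle d T μ R h a b i) = restrictTail t (particle d T μ R h a b j) := by
  refine Lp.ext ?_
  filter_upwards [restrictTail_ae_eq t (particle d T μ R h a b i),
    restrictTail_ae_eq t (particle d T μ R h a b j),
    ae_restrict_of_ae (primCLM_ae_eq (particleStart d T μ R h a b i) (stepL2 d T μ R h i a)),
    ae_restrict_of_ae (primCLM_ae_eq (particleStart d T μ R h a b j) (stepL2 d T μ R h j a)),
    ae_restrict_mem measurableSet_Ioo, ae_restrict_of_ae (ae_restrict_mem measurableSet_Ioo)]
    with r h1 h2 h3 h4 h5 h6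
  rw [h1, h2]
  refine h3.trans (Eq.trans ?_ h4.symm)
  rw [prim_particleStart a b i (Ioo_subset_Icc_self h6),
    prim_particleStart a b j (Ioo_subset_Icc_self h6), hb,
    drift_congr hh hR a hij (ht.trans h5.1.le) h6.2.le]

theorem continuous_particle (i : ι) : Continuous fun p : (ι → EuclideanSpace ℝ (Fin d)) ×
    (ι → EuclideanSpace ℝ (Fin d)) => particle d T μ R h p.1 p.2 i := by
  have h1 : Continuous (stepL2 d T μ R h i) := (stepL2 d T μ R h i).continuous_of_finiteDimensional
  refine Continuous.subtype_mk ((primCLM d T).continuous.comp ?_) _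
  refine Continuous.prodMk ?_ (h1.comp continuous_fst)
  exact ((continuous_apply i).comp continuous_snd).sub
    ((integralOn d T _).continuous.comp (h1.comp continuous_fst))

theorem particle_smul (c : ℝ) (a b : ι → EuclideanSpace ℝ (Fin d)) (i : ι) :
    particle d T μ R h (c • a) (c • b) i = c • particle d T μ R h a b i := by
  refine Subtype.ext ?_
  change primCLM d T _ = c • primCLM d T _
  rw [← map_smul, Prod.smul_mk, map_smul, particleStart, particleStart, map_smul, map_smul,
    smul_sub]
  rfl

/-- A function measurable for the σ-algebra of T_t factors through T_t, and `positionLim` is one. -/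
theorem position_eq_of_restrictTail_eq (hT : 0 < T) {γ γ' : Curve d T} (hγ : IsSobolev γ)
    (hγ' : IsSobolev γ') {t : ℝ} (ht : -1 ≤ t) (htT : t < T)
    (heq : restrictTail t γ = restrictTail t γ') : position γ t = position γ' t := by
  rw [← positionLim_eq hT hγ ht htT, ← positionLim_eq hT hγ' ht htT]
  exact (stronglyMeasurable_positionLim (d := d) (T := T) (le_refl t)).measurable.factorsThrough heq

section Law

variable [MeasurableSingletonClass ι] [IsProbabilityMeasure μ]

/-- The law of the trajectory of a random particle. -/
def particleLaw (d : ℕ) (T : ℝ) (μ : Measure ι) [IsProbabilityMeasure μ] (R : ℕ → Setoid ι)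
    (h : ℝ) (a b : ι → EuclideanSpace ℝ (Fin d)) : ProbabilityMeasure (Curve d T) :=
  ⟨μ.map (particle d T μ R h a b),
    Measure.isProbabilityMeasure_map (Measurable.of_discrete).aemeasurable⟩

theorem coe_particleLaw (a b : ι → EuclideanSpace ℝ (Fin d)) :
    (particleLaw d T μ R h a b : Measure (Curve d T)) = μ.map (particle d T μ R h a b) := rfl

theorem ae_isSobolev_particleLaw (hT : 0 < T) (a b : ι → EuclideanSpace ℝ (Fin d)) :
    ∀ᵐ γ ∂(particleLaw d T μ R h a b : Measure (Curve d T)), IsSobolev γ := by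
  rw [coe_particleLaw, ae_map_iff Measurable.of_discrete.aemeasurable (measurableSet_isSobolev hT)]
  exact Eventually.of_forall fun i => ⟨_, _, isPrimitive_particle a b i⟩

theorem isAdmissible_particleLaw (hT : 0 < T) {a b : ι → EuclideanSpace ℝ (Fin d)}
    (h1 : ∫⁻ i, ‖b i - drift _ μ R h T i 0 a‖ₑ ^ 2 ∂μ ≤ 1)
    (h2 : ∫⁻ i, ‖stepL2 d T μ R h i a‖ₑ ^ 2 ∂μ ≤ 1) :
    IsAdmissible (particleLaw d T μ R h a b) := by
  constructor
  · rw [← lintegral_affineValue_eq hT (ae_isSobolev_particleLaw hT a b), coe_particleLaw,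
      lintegral_map (by fun_prop) Measurable.of_discrete]
    simpa only [affineValue_particle hT] using h1
  · rw [coe_particleLaw, lintegral_map (measurable_energy hT) Measurable.of_discrete]
    simpa only [energy_eq hT (isPrimitive_particle a b _)] using h2

/-- An event about the future of t corresponds to a union of classes of labels, because classmates
share their tails. Class averages and initial velocities have equal integrals over such unions. -/
theorem isDissipative_particleLaw (hT : 0 < T) (hh : 0 < h) (hR : Monotone R)
    {a b : ι → EuclideanSpace ℝ (Fin d)} (hb : ∀ k i j, R k i j → b i = b j)
    (ha : IsAdmissible (particleLaw d T μ R h a b)) :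
    IsDissipative (particleLaw d T μ R h a b) := by
  rw [isDissipative_iff hT]
  refine ⟨ha, ?_⟩
  have hv : ∀ᵐ t ∂(volume.restrict (Ioo 0 T)), ∀ i,
      velocityExt (particle d T μ R h a b i, t) = stepVelocity μ R h a i t := by
    refine ae_mono (restrict_Ioo_zero_le T) (ae_all_iff.2 fun i => ?_)
    filter_upwards [velocityExt_ae_eq hT (isPrimitive_particle a b i),
      stepL2_ae_eq (μ := μ) (R := R) (h := h) a i] with t e1 e2
    exact e1.trans e2
  filter_upwards [velocityExt_ae_eq_condExp_iff hT ha, hv, ae_restrict_mem measurableSet_Ioo]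
    with t hiff ht htI
  rw [hiff]
  rintro _ ⟨A, hA, rfl⟩
  have hB : MeasurableSet (restrictTail t ⁻¹' A : Set (Curve d T)) := measurable_restrictTail t hA
  have hm : AEMeasurable (particle d T μ R h a b) μ := Measurable.of_discrete.aemeasurable
  have hvm : AEStronglyMeasurable (fun γ : Curve d T => velocityExt (γ, t))
      (μ.map (particle d T μ R h a b)) :=
    ((measurable_velocityExt hT).comp (measurable_id.prodMk measurable_const)).aestronglyMeasurable
  rw [coe_particleLaw, setIntegral_map hB hvm hm, setIntegral_map hB (affineSlope d T).continuous.aestronglyMeasurable hm]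
  simp only [affineSlope_particle hT, ht, stepVelocity_of_nonneg a _ htI.1.le]
  refine setIntegral_classAvg μ _ a fun i j hij hi => ?_
  have hk : (⌊t / h⌋₊ : ℝ) * h ≤ t :=
    (le_div_iff₀ hh).1 (Nat.floor_le (div_nonneg htI.1.le hh.le))
  rw [mem_preimage, mem_preimage] at hi ⊢
  rwa [← restrictTail_particle_congr hh hR a hij (hb _ i j hij) hk]

theorem isFiniteSticky_particleLaw (hT : 0 < T) (hh : 0 < h) (hR : Monotone R)
    {a b : ι → EuclideanSpace ℝ (Fin d)} (hb : ∀ k i j, R k i j → b i = b j)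
    (ha : IsAdmissible (particleLaw d T μ R h a b))
    (hn : ∀ i j, 0 < μ.real {i} → ∀ t ∈ Ico 0 T,
      b i - drift _ μ R h T i t a = b j - drift _ μ R h T j t a → R ⌊t / h⌋₊ i j) :
    IsFiniteSticky (particleLaw d T μ R h a b) := by
  -- Labels of zero mass are discarded: the noncrossing property is available only for labels of
  -- positive mass.
  set S : Set (Curve d T) := particle d T μ R h a b '' {i | 0 < μ.real {i}}
  have hSf : S.Finite := (toFinite _).image _
  have hS : ∀ᵐ γ ∂(particleLaw d T μ R h a b : Measure (Curve d T)), γ ∈ S := by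
    rw [coe_particleLaw]
    refine (ae_map_iff (p := (· ∈ S)) Measurable.of_discrete.aemeasurable hSf.measurableSet).2 ?_
    rw [ae_iff_of_countable]
    exact fun i hi => ⟨i, ENNReal.toReal_pos hi (measure_ne_top _ _), rfl⟩
  refine ⟨⟨isDissipative_particleLaw hT hh hR hb ha, S, hS, ?_⟩, S, hSf, hS⟩
  rintro t ht _ ⟨i, hi, rfl⟩ _ ⟨j, hj, rfl⟩
  have htI : t ∈ Icc (-1) T := ⟨by linarith [ht.1], ht.2.le⟩
  constructor
  · exact position_eq_of_restrictTail_eq hT ⟨_, _, isPrimitive_particle a b i⟩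
      ⟨_, _, isPrimitive_particle a b j⟩ htI.1 ht.2
  · intro e
    rw [position_particle hT a b i htI, position_particle hT a b j htI] at e
    have hij := hn i j hi t ht e
    exact restrictTail_particle_congr hh hR a hij (hb _ i j hij)
      ((le_div_iff₀ hh).1 (Nat.floor_le (div_nonneg ht.1 hh.le)))

theorem continuous_particleLaw (b : ι → EuclideanSpace ℝ (Fin d)) :
    Continuous fun a => particleLaw d T μ R h a b := by
  rw [continuous_iff_continuousAt]
  intro a
  refine ProbabilityMeasure.tendsto_iff_forall_integral_tendsto.2 fun φ => ?_
  have e : ∀ a, ∫ γ, φ γ ∂(particleLaw d T μ R h a b : Measure (Curve d T)) =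
      ∑ i, μ.real {i} • φ (particle d T μ R h a b i) := by
    intro a
    rw [coe_particleLaw, integral_map Measurable.of_discrete.aemeasurable
      φ.continuous.aestronglyMeasurable, integral_fintype .of_finite]
  simp only [e]
  have hc : Continuous fun a => ∑ i, μ.real {i} • φ (particle d T μ R h a b i) := by
    refine continuous_finsetSum _ fun i _ => ?_
    have : Continuous fun a => particle d T μ R h a b i :=
      (continuous_particle i).comp (continuous_id.prodMk continuous_const)
    exact (continuous_const (y := μ.real {i})).mul (φ.continuous.comp this)
  exact hc.tendsto a

theorem continuous_lintegral_enorm_sq {V X : Type*} [TopologicalSpace X] [NormedAddCommGroup V]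
    {f : ι → X → V} (hf : ∀ i, Continuous (f i)) :
    Continuous fun x => ∫⁻ i, ‖f i x‖ₑ ^ 2 ∂μ := by
  simp only [lintegral_fintype]
  exact continuous_finsetSum _ fun i _ => (ENNReal.continuous_mul_const (measure_ne_top _ _)).comp
    ((ENNReal.continuous_pow 2).comp (hf i).enorm)

/-- With relations and end points fixed, the law and both moments depend continuously on the initial
velocities. Strict moment bounds therefore survive the small change that removes collisions. -/
theorem particleLaw_mem_closure (hd : 2 ≤ d) (hT : 0 < T) (hh : 0 < h) (hR : Monotone R)
    {a b : ι → EuclideanSpace ℝ (Fin d)} (hb : ∀ k i j, R k i j → b i = b j)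
    (h1 : ∫⁻ i, ‖b i - drift _ μ R h T i 0 a‖ₑ ^ 2 ∂μ < 1)
    (h2 : ∫⁻ i, ‖stepL2 d T μ R h i a‖ₑ ^ 2 ∂μ < 1) :
    particleLaw d T μ R h a b ∈
      closure {η : ProbabilityMeasure (Curve d T) | IsFiniteSticky η} := by
  rw [mem_closure_iff_nhds]
  intro U hU
  have c1 : Continuous fun a : ι → EuclideanSpace ℝ (Fin d) =>
      ∫⁻ i, ‖b i - drift _ μ R h T i 0 a‖ₑ ^ 2 ∂μ := continuous_lintegral_enorm_sq fun i =>
    continuous_const.sub (LinearMap.continuous_of_finiteDimensional _)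
  have c2 : Continuous fun a : ι → EuclideanSpace ℝ (Fin d) =>
      ∫⁻ i, ‖stepL2 d T μ R h i a‖ₑ ^ 2 ∂μ := continuous_lintegral_enorm_sq fun i =>
    LinearMap.continuous_of_finiteDimensional _
  have hnear := (((continuous_particleLaw (T := T) (μ := μ) (R := R) (h := h) b).tendsto
    a).eventually hU).and (((c1.tendsto a).eventually_lt_const h1).and
      ((c2.tendsto a).eventually_lt_const h2))
  obtain ⟨δ, hδ, hball⟩ := Metric.eventually_nhds_iff.1 hnear
  obtain ⟨a', ha', hn⟩ := exists_noncrossing (μ := μ) (R := R) (T := T) hd hh a b hδ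
  obtain ⟨u1, u2, u3⟩ := hball (by rwa [dist_eq_norm])
  exact ⟨_, u1, isFiniteSticky_particleLaw hT hh hR hb
    (isAdmissible_particleLaw hT u2.le u3.le) hn⟩

end Law

end

end PressurelessEuler

/-! ### Conditional expectations and finite discretization. -/

namespace PressurelessEuler

noncomputable section

section ConditionalExpectation

variable {Ω E : Type*} {m₀ : MeasurableSpace Ω} {μ : Measure Ω} [NormedAddCommGroup E]

section

variable [IsProbabilityMeasure μ] [InnerProductSpace ℝ E] [CompleteSpace E]

theorem eLpNorm_sq_eq_condExp_add {m : MeasurableSpace Ω} (hm : m ≤ m₀) {f : Ω → E}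
    (hf : MemLp f 2 μ) :
    eLpNorm f 2 μ ^ 2 = eLpNorm (μ[f | m]) 2 μ ^ 2 + eLpNorm (f - μ[f | m]) 2 μ ^ 2 := by
  have hP := hf.condExpL2_ae_eq_condExp (𝕜 := ℝ) hm
  set F := hf.toLp f with hF
  set G : Lp E 2 μ := (condExpL2 E ℝ hm F : Lp E 2 μ) with hG
  have horth : inner ℝ G (F - G) = 0 := by
    have : Fact (m ≤ m₀) := ⟨hm⟩
    rw [real_inner_comm]
    exact Submodule.starProjection_inner_eq_zero F _ (condExpL2 E ℝ hm F).2
  have e1 : ‖F‖ ^ 2 = ‖G‖ ^ 2 + ‖F - G‖ ^ 2 := by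
    have := norm_add_sq_eq_norm_sq_add_norm_sq_of_inner_eq_zero G (F - G) horth
    rw [add_sub_cancel] at this
    nlinarith
  have n1 : eLpNorm f 2 μ = ‖F‖ₑ := (Lp.enorm_toLp hf).symm
  have n2 : eLpNorm (μ[f | m]) 2 μ = ‖G‖ₑ := by
    rw [Lp.enorm_def]; exact (eLpNorm_congr_ae hP).symm
  have n3 : eLpNorm (f - μ[f | m]) 2 μ = ‖F - G‖ₑ := by
    rw [Lp.enorm_def]
    refine eLpNorm_congr_ae ?_
    filter_upwards [hP, hf.coeFn_toLp, Lp.coeFn_sub F G] with ω h1 h2 h3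
    rw [h3, Pi.sub_apply, Pi.sub_apply, h2, ← h1]
  rw [n1, n2, n3]
  simp only [← ofReal_norm, ← ENNReal.ofReal_pow (norm_nonneg _)]
  rw [← ENNReal.ofReal_add (by positivity) (by positivity), e1]

/-- Conditioning E[f | m'] - S on m gives E[f | m] - S, and conditioning contracts L². Hence a
smaller σ-algebra loses little provided that it can resolve a good approximation S of the
conditional expectation. -/
theorem eLpNorm_condExp_sub_condExp_le {m m' : MeasurableSpace Ω} (hmm : m ≤ m') (hm' : m' ≤ m₀)
    {f S : Ω → E} (hS : MemLp S 2 μ) (hSm : StronglyMeasurable[m] S) :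
    eLpNorm (μ[f | m] - μ[f | m']) 2 μ ≤ 2 * eLpNorm (μ[f | m'] - S) 2 μ := by
  have hSi : Integrable S μ := hS.integrable one_le_two
  have h1 : μ[f | m] - S =ᵐ[μ] μ[μ[f | m'] - S | m] := by
    have e := condExp_of_stronglyMeasurable (μ := μ) (hmm.trans hm') hSm hSi
    filter_upwards [condExp_condExp_of_le (f := f) (μ := μ) hmm hm',
      condExp_sub (μ := μ) integrable_condExp hSi m] with ω a1 a2
    rw [a2, Pi.sub_apply, Pi.sub_apply, a1, e]
  have h2 : eLpNorm (μ[f | m] - S) 2 μ ≤ eLpNorm (μ[f | m'] - S) 2 μ := by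
    rw [eLpNorm_congr_ae h1]
    exact eLpNorm_condExp_le_eLpNorm _ one_le_two
  have e : μ[f | m] - μ[f | m'] = (μ[f | m] - S) - (μ[f | m'] - S) := by abel
  have hSa := hSi.aestronglyMeasurable
  rw [e, two_mul]
  exact (eLpNorm_sub_le (integrable_condExp.aestronglyMeasurable.sub hSa)
    (integrable_condExp.aestronglyMeasurable.sub hSa) one_le_two).trans (add_le_add h2 le_rfl)

end

theorem exists_finite_range_eLpNorm_sub_lt {m : MeasurableSpace Ω} (hm : m ≤ m₀)
    [MeasurableSpace E] [BorelSpace E] {f : Ω → E} (hf : MemLp f 2 μ)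
    (hfm : StronglyMeasurable[m] f) {ε : ℝ≥0∞} (hε : ε ≠ 0) :
    ∃ S : Ω → E, (range S).Finite ∧ (∀ B, MeasurableSet[m] (S ⁻¹' B)) ∧ MemLp S 2 μ ∧
      eLpNorm (f - S) 2 μ < ε := by
  have hf' : MemLp f 2 (μ.trim hm) :=
    ⟨hfm.aestronglyMeasurable, by rw [eLpNorm_trim hm hfm]; exact hf.2⟩
  obtain ⟨g, h1, h2⟩ := @MemLp.exists_simpleFunc_eLpNorm_sub_lt _ m 2 _ _ f (μ.trim hm) hf'
    (by norm_num) _ hε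
  refine ⟨g, g.finite_range, fun B => g.measurableSet_preimage B, memLp_of_memLp_trim hm h2, ?_⟩
  rwa [eLpNorm_trim hm (hfm.sub g.stronglyMeasurable)] at h1

end ConditionalExpectation

section ClassSigma

variable {Ω ι E : Type*} [NormedAddCommGroup E]

/-- The events `{Y ∈ B}`, where `B` is a union of classes of `r`. -/
@[reducible] def classSigma (Y : Ω → ι) (r : Setoid ι) : MeasurableSpace Ω :=
  MeasurableSpace.comap (fun ω => (Quotient.mk r (Y ω))) ⊤

theorem exists_of_measurableSet_classSigma {Y : Ω → ι} {r : Setoid ι} {A : Set Ω}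
    (hA : MeasurableSet[classSigma Y r] A) :
    ∃ B : Set ι, (∀ i j, r i j → i ∈ B → j ∈ B) ∧ Y ⁻¹' B = A := by
  obtain ⟨C, -, rfl⟩ := hA
  refine ⟨Quotient.mk r ⁻¹' C, fun i j hij hi => ?_, rfl⟩
  rw [mem_preimage] at hi ⊢
  rwa [← Quotient.sound hij]

theorem stronglyMeasurable_classSigma [Finite ι] (Y : Ω → ι) {r : Setoid ι} {g : ι → E}
    (hg : ∀ i j, r i j → g i = g j) : StronglyMeasurable[classSigma Y r] (g ∘ Y) := by
  let : MeasurableSpace (Quotient r) := ⊤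
  have : Finite (Quotient r) := Quotient.finite r
  have h1 : StronglyMeasurable (Quotient.lift g hg) := StronglyMeasurable.of_discrete
  exact h1.comp_measurable (comap_measurable _)

variable {m₀ : MeasurableSpace Ω} {μ : Measure Ω} [IsProbabilityMeasure μ] [NormedSpace ℝ E]
  [CompleteSpace E] [Fintype ι] [MeasurableSpace ι] [MeasurableSingletonClass ι]

/-- The mean of `W` on the event `{Y = i}`. -/
def fiberMean (μ : Measure Ω) (W : Ω → E) (Y : Ω → ι) (i : ι) : E :=
  (μ.real (Y ⁻¹' {i}))⁻¹ • ∫ ω in Y ⁻¹' {i}, W ω ∂μ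

theorem setIntegral_fiberMean {W : Ω → E} (hW : Integrable W μ) {Y : Ω → ι} (hY : Measurable Y)
    (B : Set ι) : ∫ i in B, fiberMean μ W Y i ∂(μ.map Y) = ∫ ω in Y ⁻¹' B, W ω ∂μ := by
  classical
  have : IsProbabilityMeasure (μ.map Y) := Measure.isProbabilityMeasure_map hY.aemeasurable
  have hB : MeasurableSet B := B.toFinite.measurableSet
  rw [← integral_indicator hB, integral_fintype .of_finite]
  have e1 : Y ⁻¹' B = ⋃ i ∈ B.toFinset, Y ⁻¹' {i} := by
    ext ω; simp
  rw [e1, integral_biUnion_finset _ (fun i _ => hY (measurableSet_singleton i)) ?_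
    fun i _ => hW.integrableOn]
  · rw [← Finset.sum_subset (Finset.subset_univ B.toFinset)]
    · refine Finset.sum_congr rfl fun i hi => ?_
      rw [indicator_of_mem (mem_toFinset.1 hi), fiberMean,
        map_measureReal_apply hY (measurableSet_singleton i)]
      rcases eq_or_ne (μ.real (Y ⁻¹' {i})) 0 with h0 | h0
      · rw [h0, zero_smul]
        rw [measureReal_eq_zero_iff] at h0
        exact (setIntegral_measure_zero _ h0).symm
      · rw [smul_smul, mul_inv_cancel₀ h0, one_smul]
    · intro i _ hi
      rw [indicator_of_notMem fun h => hi (mem_toFinset.2 h), smul_zero]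
  · intro i _ j _ hij
    exact Disjoint.preimage Y (by simpa using hij)

/-- Identifies class averages on the label space with conditional expectations of W on the original
space; only integrals over unions of classes have to be matched. -/
theorem comp_ae_eq_condExp_classSigma {W : Ω → E} (hW : Integrable W μ) {Y : Ω → ι}
    (hY : Measurable Y) {r : Setoid ι} {g : ι → E} (hg : ∀ i j, r i j → g i = g j)
    (hgB : ∀ B : Set ι, (∀ i j, r i j → i ∈ B → j ∈ B) →
      ∫ i in B, g i ∂(μ.map Y) = ∫ i in B, fiberMean μ W Y i ∂(μ.map Y)) :
    g ∘ Y =ᵐ[μ] μ[W | classSigma Y r] := by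
  have : IsProbabilityMeasure (μ.map Y) := Measure.isProbabilityMeasure_map hY.aemeasurable
  have hle : classSigma Y r ≤ m₀ := by
    intro A hA
    obtain ⟨B, -, rfl⟩ := exists_of_measurableSet_classSigma hA
    exact hY B.toFinite.measurableSet
  have hgi : Integrable g (μ.map Y) := .of_finite
  have hgY : Integrable (g ∘ Y) μ := (integrable_map_measure hgi.1 hY.aemeasurable).1 hgi
  refine ae_eq_condExp_of_forall_setIntegral_eq hle hW (fun s _ _ => hgY.integrableOn)
    (fun A hA _ => ?_) (stronglyMeasurable_classSigma Y hg).aestronglyMeasurable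
  obtain ⟨B, hB, rfl⟩ := exists_of_measurableSet_classSigma hA
  rw [← setIntegral_fiberMean hW hY, ← hgB B hB,
    setIntegral_map B.toFinite.measurableSet hgi.1 hY.aemeasurable]
  rfl

end ClassSigma

/-- Each F k is replaced by a finite-valued S k measurable for 𝓕 k, and a label is the list of all
these values. A union of classes at level k is described by S l with l ≥ k, which is 𝓕 k-measurable
because 𝓕 decreases. -/
theorem exists_discretization {Ω E : Type} {m₀ : MeasurableSpace Ω} {μ : Measure Ω}
    [IsProbabilityMeasure μ] [NormedAddCommGroup E] [InnerProductSpace ℝ E] [CompleteSpace E]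
    [MeasurableSpace E] [BorelSpace E] {𝓕 : ℕ → MeasurableSpace Ω} (h𝓕 : Antitone 𝓕)
    (hle : ∀ k, 𝓕 k ≤ m₀) {F : ℕ → Ω → E} (hF : ∀ k, MemLp (F k) 2 μ)
    (hFm : ∀ k, StronglyMeasurable[𝓕 k] (F k)) (K : ℕ) {ε : ℝ≥0∞} (hε : ε ≠ 0) :
    ∃ (ι : Type) (_ : Fintype ι) (Y : Ω → ι) (r : ℕ → Setoid ι) (s : ℕ → ι → E),
      Monotone r ∧ (∀ i j, r 0 i j → i = j) ∧ (∀ k, r k ≤ r K) ∧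
      (∀ k ≤ K, ∀ B : Set ι, (∀ i j, r k i j → i ∈ B → j ∈ B) → MeasurableSet[𝓕 k] (Y ⁻¹' B)) ∧
      ∀ k ≤ K, (∀ i j, r k i j → s k i = s k j) ∧ MemLp (s k ∘ Y) 2 μ ∧
        eLpNorm (F k - s k ∘ Y) 2 μ < ε := by
  choose S hS1 hS2 hS3 hS4 using fun k =>
    exists_finite_range_eLpNorm_sub_lt (hle k) (hF k) (hFm k) hε
  have : ∀ l : ℕ, Finite (range (S l)) := fun l => (hS1 l).to_subtype
  let ι := ∀ l : Fin (K + 1), range (S l)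
  have : Finite ι := Pi.finite
  let Y : Ω → ι := fun ω l => ⟨S l ω, mem_range_self ω⟩
  -- Labels are related at level k when their entries from k on agree; the cutoff min k K freezes
  -- the relation beyond K.
  let r : ℕ → Setoid ι := fun k =>
    { r := fun i j => ∀ l : Fin (K + 1), min k K ≤ l → i l = j l
      iseqv := ⟨fun _ _ _ => rfl, fun h l hl => (h l hl).symm,
        fun h h' l hl => (h l hl).trans (h' l hl)⟩ }
  let s : ℕ → ι → E := fun k i => i ⟨min k K, by omega⟩
  have hsY : ∀ k ≤ K, s k ∘ Y = S k := by
    intro k hk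
    ext ω
    simp only [s, Y, Function.comp_apply, min_eq_left hk]
  refine ⟨ι, Fintype.ofFinite ι, Y, r, s, ?_, ?_, ?_, ?_, ?_⟩
  · intro k k' hk i j hij l hl
    exact hij l (le_trans (min_le_min_right K hk) hl)
  · intro i j hij
    ext1 l
    exact hij l (by simp)
  · intro k i j hij l hl
    exact hij l (le_trans (by simp) hl)
  · intro k hk B hB
    have e : Y ⁻¹' B = ⋃ i ∈ B, ⋂ l : {l : Fin (K + 1) // k ≤ l}, S l ⁻¹' {(i l : E)} := by
      ext ω
      simp only [mem_preimage, mem_iUnion, mem_iInter, mem_singleton_iff, exists_prop]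
      constructor
      · intro h
        exact ⟨Y ω, h, fun l => rfl⟩
      · rintro ⟨i, hi, h⟩
        refine hB i (Y ω) (fun l hl => ?_) hi
        rw [min_eq_left hk] at hl
        exact Subtype.ext (h ⟨l, hl⟩).symm
    rw [e]
    refine Set.Finite.measurableSet_biUnion B.toFinite fun i _ => ?_
    exact MeasurableSet.iInter fun l => h𝓕 l.2 _ (hS2 _ _)
  · intro k hk
    rw [hsY k hk]
    refine ⟨fun i j hij => ?_, hS3 k, hS4 k⟩
    exact congrArg Subtype.val (hij _ le_rfl)

end

end PressurelessEuler

/-! ### Monotonicity of the conditional second moment, and L² bounds. -/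

namespace PressurelessEuler

noncomputable section

variable {d : ℕ} {T : ℝ} {η : ProbabilityMeasure (Curve d T)}

/-- The second moment of the conditional expectation of the initial velocity given the future. -/
def meanEnergy (η : ProbabilityMeasure (Curve d T)) (t : ℝ) : ℝ :=
  (eLpNorm ((η : Measure (Curve d T))[affineSlope d T | future d T t]) 2
    (η : Measure (Curve d T)) ^ 2).toReal

theorem IsAdmissible.memLp_condExp_affineSlope (hT : 0 < T) (h : IsAdmissible η) (t : ℝ) :
    MemLp ((η : Measure (Curve d T))[affineSlope d T | future d T t]) 2
      (η : Measure (Curve d T)) :=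
  (h.memLp_affineSlope hT).condExp one_le_two

theorem IsAdmissible.eLpNorm_affineSlope_le (hT : 0 < T) (h : IsAdmissible η) :
    eLpNorm (affineSlope d T) 2 (η : Measure (Curve d T)) ≤ 1 := by
  have h1 := h.lintegral_affineSlope_le hT
  rw [← eLpNorm_two_sq] at h1
  exact (pow_le_one_iff two_ne_zero).1 h1

theorem meanEnergy_nonneg (η : ProbabilityMeasure (Curve d T)) (t : ℝ) : 0 ≤ meanEnergy η t :=
  ENNReal.toReal_nonneg

theorem IsAdmissible.meanEnergy_le_one (hT : 0 < T) (h : IsAdmissible η) (t : ℝ) :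
    meanEnergy η t ≤ 1 := by
  refine ENNReal.toReal_le_of_le_ofReal zero_le_one ?_
  rw [ENNReal.ofReal_one]
  exact pow_le_one₀ zero_le
    ((eLpNorm_condExp_le_eLpNorm _ one_le_two).trans (h.eLpNorm_affineSlope_le hT))

theorem IsAdmissible.eLpNorm_condExp_sq_eq (hT : 0 < T) (h : IsAdmissible η) {s t : ℝ}
    (hst : s ≤ t) :
    eLpNorm ((η : Measure (Curve d T))[affineSlope d T | future d T s]) 2
      (η : Measure (Curve d T)) ^ 2 =
    eLpNorm ((η : Measure (Curve d T))[affineSlope d T | future d T t]) 2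
      (η : Measure (Curve d T)) ^ 2 +
    eLpNorm ((η : Measure (Curve d T))[affineSlope d T | future d T s] -
      (η : Measure (Curve d T))[affineSlope d T | future d T t]) 2
      (η : Measure (Curve d T)) ^ 2 := by
  have h1 := eLpNorm_sq_eq_condExp_add (future_le t) (h.memLp_condExp_affineSlope hT s)
  have h2 := condExp_condExp_of_le (μ := (η : Measure (Curve d T))) (f := affineSlope d T)
    (future_anti hst) (future_le s)
  rw [eLpNorm_congr_ae h2, eLpNorm_congr_ae (EventuallyEq.sub (ae_eq_refl _) h2)] at h1
  exact h1

theorem IsAdmissible.eLpNorm_condExp_sq_ne_top (hT : 0 < T) (h : IsAdmissible η) (t : ℝ) :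
    eLpNorm ((η : Measure (Curve d T))[affineSlope d T | future d T t]) 2
      (η : Measure (Curve d T)) ^ 2 ≠ ⊤ :=
  ENNReal.pow_ne_top (h.memLp_condExp_affineSlope hT t).2.ne

theorem IsAdmissible.antitone_meanEnergy (hT : 0 < T) (h : IsAdmissible η) :
    Antitone (meanEnergy η) := fun s t hst =>
  ENNReal.toReal_mono (h.eLpNorm_condExp_sq_ne_top hT s)
    (by rw [h.eLpNorm_condExp_sq_eq hT hst]; exact le_self_add)

/-- Pythagoras for the reverse martingale: a squared increment equals the loss of second moment. -/
theorem IsAdmissible.eLpNorm_condExp_sub_sq (hT : 0 < T) (h : IsAdmissible η) {s t : ℝ}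
    (hst : s ≤ t) :
    eLpNorm ((η : Measure (Curve d T))[affineSlope d T | future d T s] -
      (η : Measure (Curve d T))[affineSlope d T | future d T t]) 2
      (η : Measure (Curve d T)) ^ 2 = ENNReal.ofReal (meanEnergy η s - meanEnergy η t) := by
  rw [ENNReal.ofReal_sub _ (meanEnergy_nonneg η t), meanEnergy, meanEnergy,
    ENNReal.ofReal_toReal (h.eLpNorm_condExp_sq_ne_top hT s),
    ENNReal.ofReal_toReal (h.eLpNorm_condExp_sq_ne_top hT t), h.eLpNorm_condExp_sq_eq hT hst]
  exact (ENNReal.add_sub_cancel_left (h.eLpNorm_condExp_sq_ne_top hT t)).symm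

/-- Shifting telescopes the integral into that of f over (-h, 0) minus that over (T - h, T), so
values in [0, 1] suffice and no regularity of the martingale in time is needed. -/
theorem lintegral_sub_shift_le {f : ℝ → ℝ} (hf : Antitone f) (h0 : ∀ t, 0 ≤ f t)
    (h1 : ∀ t, f t ≤ 1) (hT : 0 ≤ T) {h : ℝ} (hh : 0 ≤ h) :
    ∫⁻ t in Ioo 0 T, ENNReal.ofReal (f (t - h) - f t) ≤ ENNReal.ofReal h := by
  have hi : ∀ a b, IntervalIntegrable f volume a b := fun a b => hf.intervalIntegrable
  have hi' : IntervalIntegrable (fun t => f (t - h)) volume 0 T :=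
    Antitone.intervalIntegrable fun s t hst => hf (sub_le_sub_right hst h)
  have e1 : ∫ t in Ioo 0 T, (f (t - h) - f t) ≤ h := by
    rw [← integral_Ioc_eq_integral_Ioo, ← intervalIntegral.integral_of_le hT,
      intervalIntegral.integral_sub hi' (hi 0 T), intervalIntegral.integral_comp_sub_right,
      intervalIntegral.integral_interval_sub_interval_comm (hi _ _) (hi _ _) (hi _ _)]
    have a1 : ∫ t in (0 - h)..0, f t ≤ ∫ _ in (0 - h)..0, (1 : ℝ) :=
      intervalIntegral.integral_mono_on (by linarith) (hi _ _) intervalIntegrable_const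
        fun t _ => h1 t
    have a2 : 0 ≤ ∫ t in (T - h)..T, f t :=
      intervalIntegral.integral_nonneg (by linarith) fun t _ => h0 t
    rw [intervalIntegral.integral_const, smul_eq_mul] at a1
    linarith
  rw [← ofReal_integral_eq_lintegral_ofReal]
  · exact ENNReal.ofReal_le_ofReal e1
  · have := hi'.sub (hi 0 T)
    rw [intervalIntegrable_iff_integrableOn_Ioo_of_le hT] at this
    exact this
  · exact Eventually.of_forall fun t => sub_nonneg.2 (hf (by linarith))

theorem ennreal_add_sq_le (x y : ℝ≥0∞) : (x + y) ^ 2 ≤ 2 * (x ^ 2 + y ^ 2) := by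
  have := ENNReal.rpow_add_le_mul_rpow_add_rpow x y (p := 2) one_le_two
  norm_num at this
  exact this

/-- The `L²` norm of the velocity. -/
def speedNorm (γ : Curve d T) : ℝ := √(energy γ).toReal

theorem speedNorm_eq (hT : 0 < T) {γ : Curve d T} {c : EuclideanSpace ℝ (Fin d)} {g : L2 d T}
    (h : IsPrimitive γ c g) : speedNorm γ = ‖g‖ := by
  rw [speedNorm, energy_eq hT h, ENNReal.toReal_pow, toReal_enorm, Real.sqrt_sq (norm_nonneg _)]

theorem IsAdmissible.eLpNorm_speedNorm_le (hT : 0 < T) (h : IsAdmissible η) :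
    MemLp speedNorm 2 (η : Measure (Curve d T)) ∧
      eLpNorm speedNorm 2 (η : Measure (Curve d T)) ≤ 1 := by
  have e : ∫⁻ γ, ‖speedNorm γ‖ₑ ^ 2 ∂(η : Measure (Curve d T)) ≤ 1 := by
    refine le_trans (le_of_eq (lintegral_congr_ae ?_)) h.2
    filter_upwards [h.ae_isSobolev hT] with γ hγ
    obtain ⟨c, g, hg⟩ := hγ
    rw [speedNorm_eq hT hg, energy_eq hT hg, enorm_norm]
  refine ⟨memLp_two_of_lintegral_sq_ne_top
    ((measurable_energy hT).ennreal_toReal.sqrt).aestronglyMeasurable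
    (ne_top_of_le_ne_top ENNReal.one_ne_top e), ?_⟩
  rw [← eLpNorm_two_sq] at e
  exact (pow_le_one_iff two_ne_zero).1 e

theorem norm_position_sub_le (hT : 0 < T) {γ : Curve d T} (h : IsSobolev γ) {s t : ℝ}
    (hs : s ∈ Icc (-1) T) (ht : t ∈ Icc (-1) T) :
    ‖position γ t - position γ s‖ ≤ √|t - s| * speedNorm γ := by
  obtain ⟨c, g, hg⟩ := h
  rw [speedNorm_eq hT hg, position_eq_prim hT hg]
  exact norm_prim_sub_prim_le c g hs ht

theorem IsAdmissible.memLp_positionLim (hT : 0 < T) (h : IsAdmissible η) {t : ℝ} (ht : -1 ≤ t)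
    (htT : t < T) : MemLp (positionLim t) 2 (η : Measure (Curve d T)) := by
  refine MemLp.of_le (((h.memLp_affineValue hT).norm).add
    ((h.eLpNorm_speedNorm_le hT).1.const_mul √|t - 0|))
    ((stronglyMeasurable_positionLim le_rfl).mono (future_le t)).aestronglyMeasurable ?_
  filter_upwards [h.ae_isSobolev hT] with γ hγ
  have h1 := norm_position_sub_le hT hγ (s := 0) (t := t) ⟨by norm_num, hT.le⟩ ⟨ht, htT.le⟩
  rw [positionLim_eq hT hγ ht htT]
  refine le_trans ?_ (le_abs_self _)
  have h2 := norm_sub_norm_le (position γ t) (position γ 0)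
  simp only [Pi.add_apply, position_zero hT hγ] at h1 h2 ⊢
  linarith

end

end PressurelessEuler

/-! ### Velocity error of the particle approximation. -/

namespace PressurelessEuler

noncomputable section

variable {d : ℕ} {T : ℝ} {η : ProbabilityMeasure (Curve d T)}

theorem enorm_stepL2_sub_sq (hT : 0 < T) {ι : Type*} [Fintype ι] [MeasurableSpace ι]
    {μ : Measure ι} {R : ℕ → Setoid ι} {h : ℝ} {γ : Curve d T} (hγ : IsSobolev γ)
    (a : ι → EuclideanSpace ℝ (Fin d)) (i : ι) :
    ‖stepL2 d T μ R h i a - (curveData γ).2‖ₑ ^ 2 = ‖a i - affineSlope d T γ‖ₑ ^ 2 +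
      ∫⁻ t in Ioo 0 T, ‖stepVelocity μ R h a i t - velocityExt (γ, t)‖ₑ ^ 2 := by
  have hp := isPrimitive_curveData hγ
  have hv := velocityExt_ae_eq hT hp
  have hle : (volume.restrict (Ioo (-1) 0) : Measure ℝ) ≤ volume.restrict (Ioo (-1) T) :=
    Measure.restrict_mono (Ioo_subset_Ioo_right hT.le) le_rfl
  have hU : ∀ φ : ℝ → ℝ≥0∞, ∫⁻ t in Ioo (-1) T, φ t =
      (∫⁻ t in Ioo (-1) 0, φ t) + ∫⁻ t in Ioo 0 T, φ t := by
    intro φ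
    rw [← Ioc_union_Ioo_eq_Ioo (by norm_num : (-1 : ℝ) ≤ 0) hT, lintegral_union measurableSet_Ioo,
      Measure.restrict_congr_set (Ioo_ae_eq_Ioc (a := (-1 : ℝ)) (b := 0))]
    exact Set.disjoint_left.2 fun t h1 h2 => h2.1.not_ge h1.2
  have e1 : ∫⁻ t in Ioo (-1) T, ‖(stepL2 d T μ R h i a - (curveData γ).2 : L2 d T) t‖ₑ ^ 2 =
      ∫⁻ t in Ioo (-1) T, ‖stepVelocity μ R h a i t - velocityExt (γ, t)‖ₑ ^ 2 := by
    refine lintegral_congr_ae ?_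
    filter_upwards [Lp.coeFn_sub (stepL2 d T μ R h i a) (curveData γ).2,
      stepL2_ae_eq (μ := μ) (R := R) (h := h) (T := T) a i, hv] with t h1 h2 h3
    rw [h1, Pi.sub_apply, h2, h3]
  have e2 : ∫⁻ t in Ioo (-1) 0, ‖stepVelocity μ R h a i t - velocityExt (γ, t)‖ₑ ^ 2 =
      ∫⁻ _ in Ioo (-1 : ℝ) 0, ‖a i - affineSlope d T γ‖ₑ ^ 2 := by
    refine lintegral_congr_ae ?_
    filter_upwards [ae_mono hle hv, derivative_affine hT hp, ae_restrict_mem measurableSet_Ioo]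
      with t h1 h2 h3
    rw [h1, h2, stepVelocity_of_neg a i h3.2]
  rw [← lintegral_enorm_sq_L2, e1, hU, e2]
  simp

theorem measurable_stepVelocity_prod {ι Ω : Type*} [Fintype ι] [MeasurableSpace ι]
    [MeasurableSingletonClass ι] [MeasurableSpace Ω] {μ : Measure ι} {R : ℕ → Setoid ι} {h : ℝ}
    {Y : Ω → ι} (hY : Measurable Y) (a : ι → EuclideanSpace ℝ (Fin d)) :
    Measurable fun p : Ω × ℝ => stepVelocity μ R h a (Y p.1) p.2 := by
  have : Measurable fun q : ι × ℝ => stepVelocity μ R h a q.1 q.2 :=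
    measurable_from_prod_countable_right fun i =>
      (stronglyMeasurable_stepVelocity a i).measurable
  exact this.comp (hY.prodMap measurable_id)

/-- The futures of a curve at the times `0, h, …, n h`, preceded by the whole curve. -/
@[reducible] def futureSeq (d : ℕ) (T h : ℝ) (n : ℕ) : ℕ → MeasurableSpace (Curve d T)
  | 0 => inferInstance
  | k + 1 => future d T ((min k n : ℕ) * h)

theorem antitone_futureSeq {h : ℝ} (hh : 0 ≤ h) (n : ℕ) : Antitone (futureSeq d T h n) := by
  refine antitone_nat_of_succ_le fun k => ?_
  cases k with
  | zero => exact future_le _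
  | succ k =>
    refine future_anti (mul_le_mul_of_nonneg_right ?_ hh)
    exact_mod_cast min_le_min_right n k.le_succ

theorem futureSeq_le (h : ℝ) (n k : ℕ) : futureSeq d T h n k ≤ (inferInstance : MeasurableSpace (Curve d T)) := by
  cases k with
  | zero => exact le_rfl
  | succ k => exact future_le _

/-- Two errors enter: conditioning on classes instead of the full future costs 2ε in L² at each
level, and freezing the velocity over a step costs h after integrating the squared increments in
time. The final positions approximate γ(nh), since T itself has no future to be measured from. -/
theorem IsDissipative.exists_particle_estimate (hT : 0 < T) (hη : IsDissipative η) (n : ℕ)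
    {h : ℝ} (hh : h = T / (n + 1)) {ε : ℝ≥0∞} (hε : ε ≠ 0) :
    ∃ (ι : Type) (_ : Fintype ι) (_ : MeasurableSpace ι) (_ : MeasurableSingletonClass ι)
      (Y : Curve d T → ι) (R : ℕ → Setoid ι) (a b : ι → EuclideanSpace ℝ (Fin d)),
      Measurable Y ∧ Monotone R ∧ (∀ k i j, R k i j → b i = b j) ∧
      ∫⁻ γ, ‖stepL2 d T ((η : Measure (Curve d T)).map Y) R h (Y γ) a - (curveData γ).2‖ₑ ^ 2
        ∂(η : Measure (Curve d T)) ≤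
          (2 * ε) ^ 2 + 2 * ((2 * ε) ^ 2 * ENNReal.ofReal T + ENNReal.ofReal h) ∧
      eLpNorm (positionLim (n * h) - b ∘ Y) 2 (η : Measure (Curve d T)) ≤ ε := by
  have hh0 : 0 < h := by rw [hh]; positivity
  have hnT : n * h < T := by
    rw [hh, mul_div_assoc', div_lt_iff₀ (by positivity)]
    nlinarith
  have hNT : (n + 1) * h = T := by rw [hh]; field_simp
  obtain ⟨ha, hd⟩ := (isDissipative_iff hT).1 hη
  have hWL := ha.memLp_affineSlope hT
  have hW : Integrable (affineSlope d T) (η : Measure (Curve d T)) := hWL.integrable one_le_two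
  -- Level 0 is W itself, level k + 1 its conditional expectation given the future of k h, and level
  -- n + 2 the position at time n h, measurable for the same σ-algebra as level n + 1.
  set F : ℕ → Curve d T → EuclideanSpace ℝ (Fin d) := fun k =>
    if k = n + 2 then positionLim (n * h) else
      (η : Measure (Curve d T))[affineSlope d T | futureSeq d T h n k] with hF
  have hFn : F (n + 2) = positionLim (n * h) := if_pos rfl
  have hFk : ∀ k, k ≤ n + 1 →
      F k = (η : Measure (Curve d T))[affineSlope d T | futureSeq d T h n k] :=
    fun k hk => if_neg (by omega)
  have hFL : ∀ k, MemLp (F k) 2 (η : Measure (Curve d T)) := by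
    intro k
    by_cases hk : k = n + 2
    · rw [hk, hFn]
      exact ha.memLp_positionLim hT (by linarith [mul_nonneg n.cast_nonneg hh0.le]) hnT
    · simp only [hF, if_neg hk]
      exact hWL.condExp one_le_two
  have hFm : ∀ k, StronglyMeasurable[futureSeq d T h n k] (F k) := by
    intro k
    by_cases hk : k = n + 2
    · rw [hk, hFn]
      have e : futureSeq d T h n (n + 2) = future d T (n * h) := by
        rw [futureSeq, min_eq_right n.le_succ]
      rw [e]
      exact stronglyMeasurable_positionLim le_rfl
    · simp only [hF, if_neg hk]
      exact stronglyMeasurable_condExp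
  obtain ⟨ι, hι, Y, r, s, hr, hr0, hrK, hrm, hs⟩ := exists_discretization
    (antitone_futureSeq (d := d) (T := T) hh0.le n) (futureSeq_le h n) hFL hFm (n + 2) hε
  let _ : MeasurableSpace ι := ⊤
  have hY : Measurable Y := fun B _ => hrm 0 (by omega) B fun i j hij hi => hr0 i j hij ▸ hi
  set a := fiberMean (η : Measure (Curve d T)) (affineSlope d T) Y with ha'
  set μ := (η : Measure (Curve d T)).map Y with hμ
  have : IsProbabilityMeasure μ := Measure.isProbabilityMeasure_map hY.aemeasurable
  -- The index shift skips level 0, which resolves all labels and only serves the initial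
  -- velocities. Every class of R k lies in a class of level n + 2, so end points are constant on
  -- it.
  set R : ℕ → Setoid ι := fun k => r (k + 1) with hR
  have hclass : ∀ k ≤ n + 1, ∀ g : ι → EuclideanSpace ℝ (Fin d), (∀ i j, r k i j → g i = g j) →
      (∀ B : Set ι, (∀ i j, r k i j → i ∈ B → j ∈ B) →
        ∫ i in B, g i ∂μ = ∫ i in B, a i ∂μ) →
      eLpNorm (g ∘ Y - (η : Measure (Curve d T))[affineSlope d T | futureSeq d T h n k]) 2
        (η : Measure (Curve d T)) ≤ 2 * ε := by
    intro k hk g hg hgB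
    have h1 := comp_ae_eq_condExp_classSigma hW hY hg hgB
    rw [eLpNorm_congr_ae (h1.sub (ae_eq_refl _))]
    have hsk := hs k (by omega)
    have hle : classSigma Y (r k) ≤ futureSeq d T h n k := by
      intro A hA
      obtain ⟨B, hB, rfl⟩ := exists_of_measurableSet_classSigma hA
      exact hrm k (by omega) B hB
    refine (eLpNorm_condExp_sub_condExp_le hle (futureSeq_le h n k) hsk.2.1
      (stronglyMeasurable_classSigma Y hsk.1)).trans ?_
    rw [← hFk k hk]
    gcongr
    exact hsk.2.2.le
  have hstart : eLpNorm (a ∘ Y - ⇑(affineSlope d T)) 2 (η : Measure (Curve d T)) ≤ 2 * ε := by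
    have h1 := hclass 0 (by omega) a (fun i j hij => by rw [hr0 i j hij]) fun B _ => rfl
    have h2 : (η : Measure (Curve d T))[affineSlope d T | futureSeq d T h n 0] =
        affineSlope d T :=
      condExp_of_stronglyMeasurable le_rfl (affineSlope d T).continuous.stronglyMeasurable hW
    rwa [h2] at h1
  refine ⟨ι, hι, ⊤, ⟨fun _ => trivial⟩, Y, R, a, s (n + 2), hY, fun k k' hk => hr (by omega),
    fun k i j hij => (hs (n + 2) le_rfl).1 i j (hrK _ hij), ?_, ?_⟩
  · have hmeas : Measurable fun p : Curve d T × ℝ =>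
        ‖stepVelocity μ R h a (Y p.1) p.2 - velocityExt p‖ₑ ^ 2 :=
      ((measurable_stepVelocity_prod hY a).sub (measurable_velocityExt hT)).enorm.pow_const 2
    have e1 : ∫⁻ γ, ‖stepL2 d T μ R h (Y γ) a - (curveData γ).2‖ₑ ^ 2
        ∂(η : Measure (Curve d T)) = eLpNorm (a ∘ Y - ⇑(affineSlope d T)) 2
          (η : Measure (Curve d T)) ^ 2 + ∫⁻ t in Ioo 0 T,
          eLpNorm (fun γ => stepVelocity μ R h a (Y γ) t - velocityExt (γ, t)) 2
            (η : Measure (Curve d T)) ^ 2 := by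
      simp only [eLpNorm_two_sq]
      rw [← lintegral_lintegral_swap hmeas.aemeasurable, ← lintegral_add_left]
      · refine lintegral_congr_ae ?_
        filter_upwards [ha.ae_isSobolev hT] with γ hγ using enorm_stepL2_sub_sq hT hγ a (Y γ)
      · have : Measurable (a ∘ Y) := Measurable.of_discrete.comp hY
        exact (this.sub (affineSlope d T).continuous.measurable).enorm.pow_const 2
    rw [e1]
    refine add_le_add (pow_le_pow_left' hstart 2) ?_
    have e2 : ∀ᵐ t ∂(volume.restrict (Ioo 0 T)),
        eLpNorm (fun γ => stepVelocity μ R h a (Y γ) t - velocityExt (γ, t)) 2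
            (η : Measure (Curve d T)) ^ 2 ≤
        2 * ((2 * ε) ^ 2 + ENNReal.ofReal (meanEnergy η (t - h) - meanEnergy η t)) := by
      filter_upwards [hd, ae_restrict_mem measurableSet_Ioo] with t ht htI
      set k := ⌊t / h⌋₊ with hk
      have hkt : k * h ≤ t := (le_div_iff₀ hh0).1 (Nat.floor_le (div_nonneg htI.1.le hh0.le))
      have hkt' : t < (k + 1) * h := (div_lt_iff₀ hh0).1 (Nat.lt_floor_add_one _)
      have hkn : k ≤ n := by
        have : (k : ℝ) * h < (n + 1) * h := hkt.trans_lt (htI.2.trans_eq hNT.symm)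
        have := lt_of_mul_lt_mul_right this hh0.le
        exact Nat.lt_succ_iff.1 (by exact_mod_cast this)
      have hfk : futureSeq d T h n (k + 1) = future d T (k * h) := by
        rw [futureSeq, min_eq_left hkn]
      have h1 := hclass (k + 1) (by omega) (fun i => classAvg _ μ (R k) i a)
        (fun i j hij => classAvg_congr μ hij a) fun B hB => setIntegral_classAvg μ (R k) a hB
      rw [hfk] at h1
      have h2 := ha.eLpNorm_condExp_sub_sq hT hkt
      set M := (η : Measure (Curve d T))[affineSlope d T | future d T (k * h)]
      set M' := (η : Measure (Curve d T))[affineSlope d T | future d T t]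
      -- M and M' are the conditional expectations at k h and at t; by dissipativity M' is the true
      -- velocity.
      have e3 : (fun γ => stepVelocity μ R h a (Y γ) t - velocityExt (γ, t))
          =ᵐ[(η : Measure (Curve d T))] ((fun i => classAvg _ μ (R k) i a) ∘ Y - M) + (M - M') := by
        filter_upwards [ht] with γ hγ
        simp only [Pi.add_apply, Pi.sub_apply, Function.comp_apply]
        rw [stepVelocity_of_nonneg a _ htI.1.le, hγ, sub_add_sub_cancel]
      have hm1 : AEStronglyMeasurable ((fun i => classAvg _ μ (R k) i a) ∘ Y)
          (η : Measure (Curve d T)) :=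
        (Measurable.of_discrete.comp hY).aestronglyMeasurable
      have hM : AEStronglyMeasurable M (η : Measure (Curve d T)) :=
        integrable_condExp.aestronglyMeasurable
      have hM' : AEStronglyMeasurable M' (η : Measure (Curve d T)) :=
        integrable_condExp.aestronglyMeasurable
      rw [eLpNorm_congr_ae e3]
      calc _ ≤ (2 * ε + eLpNorm (M - M') 2 (η : Measure (Curve d T))) ^ 2 :=
            pow_le_pow_left' ((eLpNorm_add_le (hm1.sub hM) (hM.sub hM') one_le_two).trans
              (add_le_add h1 le_rfl)) 2
        _ ≤ 2 * ((2 * ε) ^ 2 + eLpNorm (M - M') 2 (η : Measure (Curve d T)) ^ 2) :=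
            ennreal_add_sq_le _ _
        _ ≤ _ := by
            rw [h2]
            gcongr
            -- Since t - h < k h, the second moment at k h is at most the one at t - h. In the
            -- opening step t - h is negative, where the futures are still defined and decreasing.
            exact ha.antitone_meanEnergy hT (by linarith)
    refine (lintegral_mono_ae e2).trans ?_
    rw [lintegral_const_mul' _ _ (by norm_num), lintegral_add_left measurable_const]
    gcongr
    · simp
    · exact lintegral_sub_shift_le (ha.antitone_meanEnergy hT) (meanEnergy_nonneg η)
        (ha.meanEnergy_le_one hT) hT.le hh0.le
  · have h1 := (hs (n + 2) le_rfl).2.2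
    rw [hFn] at h1
    exact h1.le

end

end PressurelessEuler

/-! ### Density of the finite sticky particle solutions. -/

namespace PressurelessEuler

noncomputable section

variable {d : ℕ} {T : ℝ} {η : ProbabilityMeasure (Curve d T)}

theorem measurable_norm_sub_curveData (hT : 0 < T) (v : L2 d T) :
    Measurable fun γ : Curve d T => ‖v - (curveData γ).2‖ := by
  let _ : MeasurableSpace (EuclideanSpace ℝ (Fin d) × L2 d T) := borel _
  have : BorelSpace (EuclideanSpace ℝ (Fin d) × L2 d T) := ⟨rfl⟩
  have : Continuous fun p : EuclideanSpace ℝ (Fin d) × L2 d T => ‖v - p.2‖ :=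
    (continuous_const.sub continuous_snd).norm
  exact this.measurable.comp (measurable_curveData hT)

theorem measurable_comp_of_countable {ι Ω β : Type*} [Countable ι] [MeasurableSpace ι]
    [MeasurableSingletonClass ι] [MeasurableSpace Ω] [MeasurableSpace β] {f : ι → Ω → β}
    (hf : ∀ i, Measurable (f i)) {Y : Ω → ι} (hY : Measurable Y) :
    Measurable fun ω => f (Y ω) ω := by
  have : Measurable fun q : ι × Ω => f q.1 q.2 := measurable_from_prod_countable_right hf
  exact this.comp (hY.prodMk measurable_id)

theorem curveData_particle (hT : 0 < T) {ι : Type*} [Fintype ι] [MeasurableSpace ι]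
    {μ : Measure ι} {R : ℕ → Setoid ι} {h : ℝ} (a b : ι → EuclideanSpace ℝ (Fin d)) (i : ι) :
    curveData (particle d T μ R h a b i) =
      (particleStart d T μ R h a b i, stepL2 d T μ R h i a) :=
  curveData_eq hT (isPrimitive_particle a b i)

/-- Positions at time 0 are compared by going back from T: the end point b i is near γ(t), which is
within √(T - t)‖γ̇‖ of γ(T), and the velocity error integrates to at most √T times its L² norm. -/
theorem norm_affineValue_particle_sub_le (hT : 0 < T) {ι : Type*} [Fintype ι] [MeasurableSpace ι]
    {μ : Measure ι} {R : ℕ → Setoid ι} {h : ℝ} (a b : ι → EuclideanSpace ℝ (Fin d)) (i : ι)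
    {γ : Curve d T} (hγ : IsSobolev γ) {t : ℝ} (ht : 0 ≤ t) (htT : t < T) :
    ‖affineValue d T (particle d T μ R h a b i) - affineValue d T γ‖ ≤
      ‖positionLim t γ - b i‖ + √(T - t) * speedNorm γ +
        √T * ‖stepL2 d T μ R h i a - (curveData γ).2‖ := by
  have hp := isPrimitive_curveData hγ
  have hpx := isPrimitive_particle (T := T) (μ := μ) (R := R) (h := h) a b i
  have m0 : (0 : ℝ) ∈ Icc (-1) T := ⟨by norm_num, hT.le⟩
  have mT : T ∈ Icc (-1) T := ⟨by linarith, le_rfl⟩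
  have mt : t ∈ Icc (-1) T := ⟨by linarith, htT.le⟩
  have h1 := norm_prim_sub_prim_le
    (particleStart d T μ R h a b i - (curveData γ).1) (stepL2 d T μ R h i a - (curveData γ).2) m0 mT
  rw [prim_sub _ _ _ _ m0, prim_sub _ _ _ _ mT, ← position_eq_prim hT hp,
    ← position_eq_prim hT hpx, position_particle hT a b i mT, position_zero hT hγ,
    position_zero hT ⟨_, _, hpx⟩, drift_apply, intervalIntegral.integral_same, sub_zero,
    sub_zero, abs_of_pos hT] at h1
  have h2 := norm_position_sub_le hT hγ mt mT
  rw [abs_of_nonneg (sub_nonneg.2 htT.le)] at h2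
  rw [positionLim_eq hT hγ (by linarith) htT]
  have e : affineValue d T (particle d T μ R h a b i) - affineValue d T γ =
      (b i - position γ t) - (position γ T - position γ t) - ((b i - position γ T) -
        (affineValue d T (particle d T μ R h a b i) - affineValue d T γ)) := by abel
  rw [e, norm_sub_rev (position γ t)]
  refine (norm_sub_le _ _).trans (add_le_add ((norm_sub_le _ _).trans (add_le_add le_rfl h2)) h1)

theorem exists_nat_error_lt (T : ℝ) {δ : ℝ} (hδ : 0 < δ) : ∃ n : ℕ, ∀ e h : ℝ,
    e = 1 / ((n : ℝ) + 1) → h = T / ((n : ℝ) + 1) →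
    e + √h + (√T + 1) * √((2 * e) ^ 2 + 2 * ((2 * e) ^ 2 * T + h)) ≤ δ := by
  have hc : Continuous fun e : ℝ => e + √(T * e) +
      (√T + 1) * √((2 * e) ^ 2 + 2 * ((2 * e) ^ 2 * T + T * e)) := by fun_prop
  have h0 := (hc.tendsto 0).comp tendsto_one_div_add_atTop_nhds_zero_nat
  simp only [mul_zero, add_zero, Real.sqrt_zero, ne_eq, OfNat.ofNat_ne_zero, not_false_eq_true,
    zero_pow, zero_mul] at h0
  obtain ⟨n, hn⟩ := (h0.eventually_lt_const hδ).exists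
  refine ⟨n, fun e h he hh => ?_⟩
  have : h = T * e := by rw [he, hh]; ring
  rw [this, he]
  exact hn.le

/-- X sends a curve to the trajectory of its label, so the particle law is an image of η and
closeness can be measured in L² of η. The factor c is kept free because X may slightly violate the
moment bounds; scaling initial velocities and end points scales every trajectory. -/
theorem IsDissipative.exists_curve_approx (hd : 2 ≤ d) (hT : 0 < T) (hη : IsDissipative η) {δ : ℝ}
    (hδ : 0 < δ) : ∃ X : Curve d T → Curve d T, Measurable X ∧ (∀ γ, IsSobolev (X γ)) ∧
      AEStronglyMeasurable (fun γ => ‖(curveData (X γ)).2 - (curveData γ).2‖)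
        (η : Measure (Curve d T)) ∧
      eLpNorm (fun γ => affineValue d T (X γ) - affineValue d T γ) 2 (η : Measure (Curve d T)) ≤
        ENNReal.ofReal δ ∧
      eLpNorm (fun γ => ‖(curveData (X γ)).2 - (curveData γ).2‖) 2 (η : Measure (Curve d T)) ≤
        ENNReal.ofReal δ ∧
      ∀ c : ℝ, eLpNorm (fun γ => c • affineValue d T (X γ)) 2 (η : Measure (Curve d T)) < 1 →
        eLpNorm (fun γ => c • (curveData (X γ)).2) 2 (η : Measure (Curve d T)) < 1 →
        ∃ ν ∈ closure {ν : ProbabilityMeasure (Curve d T) | IsFiniteSticky ν},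
          (ν : Measure (Curve d T)) = (η : Measure (Curve d T)).map fun γ => c • X γ := by
  obtain ⟨n, hn⟩ := exists_nat_error_lt T hδ
  set e : ℝ := 1 / ((n : ℝ) + 1) with he
  set h : ℝ := T / ((n : ℝ) + 1) with hh
  specialize hn e h rfl rfl
  have he0 : 0 < e := by positivity
  have hh0 : 0 < h := by positivity
  have hnT : T - n * h = h := by rw [hh]; field_simp; ring
  have ha := hη.1
  obtain ⟨ι, hι, hm, hms, Y, R, a, b, hY, hR, hb, herr, hbe⟩ :=
    hη.exists_particle_estimate hT n hh (ε := ENNReal.ofReal e) (by simpa using he0)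
  set μ := (η : Measure (Curve d T)).map Y with hμ
  have hμp : IsProbabilityMeasure μ := Measure.isProbabilityMeasure_map hY.aemeasurable
  set B : ℝ := (2 * e) ^ 2 + 2 * ((2 * e) ^ 2 * T + h) with hB
  have hB0 : 0 ≤ B := by positivity
  set X : Curve d T → Curve d T := fun γ => particle d T μ R h a b (Y γ) with hX
  have hpm : Measurable (particle d T μ R h a b) := Measurable.of_discrete
  have hXm : Measurable X := hpm.comp hY
  set Δ : Curve d T → ℝ := fun γ => ‖stepL2 d T μ R h (Y γ) a - (curveData γ).2‖ with hΔ
  have hΔm : Measurable Δ := measurable_comp_of_countable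
    (f := fun i (γ : Curve d T) => ‖stepL2 d T μ R h i a - (curveData γ).2‖)
    (fun i => measurable_norm_sub_curveData hT _) hY
  have hΔe : (fun γ => ‖(curveData (X γ)).2 - (curveData γ).2‖) = Δ := by
    ext γ
    simp only [hX, hΔ, curveData_particle hT]
  have hΔn : eLpNorm Δ 2 (η : Measure (Curve d T)) ≤ ENNReal.ofReal √B := by
    refine (ENNReal.pow_le_pow_left_iff two_ne_zero).1 ?_
    rw [eLpNorm_two_sq, ← ENNReal.ofReal_pow (Real.sqrt_nonneg _), Real.sq_sqrt hB0]
    simp only [hΔ, enorm_norm]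
    refine herr.trans (le_of_eq ?_)
    have h2 : (2 : ℝ≥0∞) = ENNReal.ofReal 2 := by simp
    rw [h2, ← ENNReal.ofReal_mul zero_le_two, ← ENNReal.ofReal_pow (by positivity),
      ← ENNReal.ofReal_mul (by positivity), ← ENNReal.ofReal_add (by positivity) hh0.le,
      ← ENNReal.ofReal_mul zero_le_two, ← ENNReal.ofReal_add (by positivity) (by positivity)]
  have hs0 := Real.sqrt_nonneg T
  have hsh := Real.sqrt_nonneg h
  have hsB := Real.sqrt_nonneg B
  have hprod := mul_nonneg hs0 hsB
  refine ⟨X, hXm, fun γ => ⟨_, _, isPrimitive_particle a b (Y γ)⟩, ?_, ?_, ?_, ?_⟩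
  · rw [hΔe]
    exact hΔm.aestronglyMeasurable
  · obtain ⟨hsp1, hsp2⟩ := ha.eLpNorm_speedNorm_le hT
    have hmb : AEStronglyMeasurable (fun γ => positionLim (n * h) γ - b (Y γ))
        (η : Measure (Curve d T)) :=
      ((stronglyMeasurable_positionLim le_rfl).mono (future_le (n * h))).aestronglyMeasurable.sub
        (Measurable.of_discrete.comp hY).aestronglyMeasurable
    have h1 : eLpNorm (fun γ => affineValue d T (X γ) - affineValue d T γ) 2
        (η : Measure (Curve d T)) ≤ eLpNorm ((fun γ => ‖positionLim (n * h) γ - b (Y γ)‖) +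
          √h • speedNorm + √T • Δ) 2 (η : Measure (Curve d T)) := by
      refine eLpNorm_mono_ae_real ?_
      filter_upwards [ha.ae_isSobolev hT] with γ hγ
      have := norm_affineValue_particle_sub_le (μ := μ) (R := R) (h := h) hT a b (Y γ) hγ
        (t := n * h) (by positivity) (by linarith)
      rw [hnT] at this
      exact this
    refine h1.trans ((eLpNorm_add_le (hmb.norm.add (hsp1.1.const_smul _))
      (hΔm.aestronglyMeasurable.const_smul _) one_le_two).trans ((add_le_add
      (eLpNorm_add_le hmb.norm (hsp1.1.const_smul _) one_le_two) le_rfl).trans ?_))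
    rw [eLpNorm_norm, eLpNorm_const_smul, eLpNorm_const_smul]
    calc _ ≤ ENNReal.ofReal e + ‖√h‖ₑ * 1 + ‖√T‖ₑ * ENNReal.ofReal √B := by
          gcongr
          exact hbe
      _ = ENNReal.ofReal (e + √h + √T * √B) := by
        rw [Real.enorm_of_nonneg hsh, Real.enorm_of_nonneg hs0, mul_one,
          ← ENNReal.ofReal_mul hs0, ← ENNReal.ofReal_add he0.le hsh,
          ← ENNReal.ofReal_add (by positivity) hprod]
      _ ≤ _ := ENNReal.ofReal_le_ofReal (by linarith)
  · rw [hΔe]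
    exact hΔn.trans (ENNReal.ofReal_le_ofReal (by linarith))
  · intro c hc1 hc2
    refine ⟨particleLaw d T μ R h (c • a) (c • b), ?_, ?_⟩
    · refine particleLaw_mem_closure hd hT hh0 hR (fun k i j hij => ?_) ?_ ?_
      · rw [Pi.smul_apply, Pi.smul_apply, hb k i j hij]
      · refine lt_of_eq_of_lt (lintegral_map Measurable.of_discrete hY) ?_
        have := pow_lt_one₀ zero_le hc1 two_ne_zero
        rw [eLpNorm_two_sq] at this
        simpa only [hX, affineValue_particle hT, smul_sub, map_smul, Pi.smul_apply] using this
      · refine lt_of_eq_of_lt (lintegral_map Measurable.of_discrete hY) ?_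
        have := pow_lt_one₀ zero_le hc2 two_ne_zero
        rw [eLpNorm_two_sq] at this
        simpa only [hX, curveData_particle hT, map_smul] using this
    · rw [coe_particleLaw, hμ, Measure.map_map Measurable.of_discrete hY]
      congr 1
      ext1 γ
      exact particle_smul c a b (Y γ)

theorem enorm_sub_sq_le (hT : 0 < T) : ∃ C : ℝ≥0, ∀ γ γ' : Curve d T, IsSobolev γ →
    IsSobolev γ' → ‖γ - γ'‖ₑ ^ 2 ≤ C * (‖affineValue d T γ - affineValue d T γ'‖ₑ ^ 2 +
      ‖‖(curveData γ).2 - (curveData γ').2‖‖ₑ ^ 2) := by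
  obtain ⟨C, hC⟩ := exists_enorm_sq_le_energy (d := d) hT
  refine ⟨C, fun γ γ' h h' => ?_⟩
  have hp : IsPrimitive (γ - γ') ((curveData γ).1 - (curveData γ').1)
      ((curveData γ).2 - (curveData γ').2) := by
    rw [isPrimitive_iff, ← Prod.mk_sub_mk, map_sub, Submodule.coe_sub,
      isPrimitive_iff.1 (isPrimitive_curveData h), isPrimitive_iff.1 (isPrimitive_curveData h')]
  have := hC (γ - γ') ⟨_, _, hp⟩
  rwa [position_zero hT ⟨_, _, hp⟩, energy_eq hT hp, map_sub, ← enorm_norm (_ - _ : L2 d T)] at this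

theorem IsDissipative.mem_closure (hd : 2 ≤ d) (hT : 0 < T) (hη : IsDissipative η) :
    η ∈ closure {ν : ProbabilityMeasure (Curve d T) | IsFiniteSticky ν} := by
  have ha := hη.1
  obtain ⟨δ, hδ0, hδlim⟩ : ∃ δ : ℕ → ℝ, (∀ n, 0 < δ n) ∧ Tendsto δ atTop (𝓝 0) :=
    ⟨fun n => 1 / ((n : ℝ) + 1), fun n => by positivity, tendsto_one_div_add_atTop_nhds_zero_nat⟩
  choose X hXm hXS hXΔ hX1 hX2 hX3 using fun n => hη.exists_curve_approx hd hT (hδ0 n)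
  -- The norms of X n are at most 1 + δ n, and c n * (1 + δ n) < 1 gives the strict bounds needed to
  -- remove collisions; c n still tends to 1.
  set c : ℕ → ℝ := fun n => (1 + 2 * δ n)⁻¹ with hc
  have hc0 : ∀ n, 0 < c n := fun n => inv_pos.2 (by linarith [hδ0 n])
  have hclim : Tendsto c atTop (𝓝 1) := by
    have := ((hδlim.const_mul 2).const_add 1).inv₀ (by norm_num)
    simpa using this
  have hlt : ∀ n (x : ℝ≥0∞), x ≤ ENNReal.ofReal (δ n) + 1 → ‖c n‖ₑ * x < 1 := by
    intro n x hx
    calc ‖c n‖ₑ * x ≤ ENNReal.ofReal (c n) * (ENNReal.ofReal (δ n) + 1) := by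
          rw [Real.enorm_of_nonneg (hc0 n).le]
          gcongr
      _ = ENNReal.ofReal (c n * (δ n + 1)) := by
          rw [ENNReal.ofReal_mul (hc0 n).le, ENNReal.ofReal_add (hδ0 n).le zero_le_one,
            ENNReal.ofReal_one]
      _ < 1 := by
          rw [← ENNReal.ofReal_one]
          refine (ENNReal.ofReal_lt_ofReal_iff zero_lt_one).2 ?_
          rw [hc, inv_mul_lt_one₀ (by linarith [hδ0 n])]
          linarith [hδ0 n]
  have hA := ha.memLp_affineValue hT
  have hA1 : eLpNorm (affineValue d T) 2 (η : Measure (Curve d T)) ≤ 1 := by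
    have := ha.1
    rw [← lintegral_affineValue_eq hT (ha.ae_isSobolev hT), ← eLpNorm_two_sq] at this
    exact (pow_le_one_iff two_ne_zero).1 this
  obtain ⟨hsp1, hsp2⟩ := ha.eLpNorm_speedNorm_le hT
  have hν : ∀ n, ∃ ν ∈ closure {ν : ProbabilityMeasure (Curve d T) | IsFiniteSticky ν},
      (ν : Measure (Curve d T)) = (η : Measure (Curve d T)).map fun γ => c n • X n γ := by
    intro n
    refine hX3 n (c n) ?_ ?_
    · have e1 : eLpNorm (fun γ => affineValue d T (X n γ)) 2 (η : Measure (Curve d T)) ≤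
          ENNReal.ofReal (δ n) + 1 := by
        have e2 : (fun γ => affineValue d T (X n γ)) =
            (fun γ => affineValue d T (X n γ) - affineValue d T γ) + ⇑(affineValue d T) := by
          ext1 γ
          simp
        rw [e2]
        refine (eLpNorm_add_le ?_ hA.1 one_le_two).trans (add_le_add (hX1 n) hA1)
        exact ((affineValue d T).continuous.measurable.comp (hXm n)).aestronglyMeasurable.sub hA.1
      have e3 := eLpNorm_const_smul (c n) (fun γ => affineValue d T (X n γ)) 2
        (η : Measure (Curve d T))
      exact e3.trans_lt (hlt n _ e1)
    · have e1 : eLpNorm (fun γ => (curveData (X n γ)).2) 2 (η : Measure (Curve d T)) ≤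
          ENNReal.ofReal (δ n) + 1 := by
        have e2 : eLpNorm (fun γ => (curveData (X n γ)).2) 2 (η : Measure (Curve d T)) ≤
            eLpNorm ((fun γ => ‖(curveData (X n γ)).2 - (curveData γ).2‖) + speedNorm) 2
              (η : Measure (Curve d T)) := by
          refine eLpNorm_mono_ae_real ?_
          filter_upwards [ha.ae_isSobolev hT] with γ hγ
          rw [Pi.add_apply, speedNorm_eq hT (isPrimitive_curveData hγ)]
          exact norm_le_norm_sub_add _ _
        exact e2.trans ((eLpNorm_add_le (hXΔ n) hsp1.1 one_le_two).trans
          (add_le_add (hX2 n) hsp2))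
      have e3 := eLpNorm_const_smul (c n) (fun γ => (curveData (X n γ)).2) 2
        (η : Measure (Curve d T))
      exact e3.trans_lt (hlt n _ e1)
  choose ν hν1 hν2 using hν
  have hid : MemLp (id : Curve d T → Curve d T) 2 (η : Measure (Curve d T)) := by
    obtain ⟨C, hC⟩ := exists_lintegral_enorm_sq_le (d := d) hT
    exact memLp_two_of_lintegral_sq_ne_top measurable_id.aestronglyMeasurable
      (ne_top_of_le_ne_top ENNReal.coe_ne_top (hC η ha))
  obtain ⟨C, hC⟩ := enorm_sub_sq_le (d := d) hT
  have hXid : ∀ n, eLpNorm (X n - id) 2 (η : Measure (Curve d T)) ≤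
      ENNReal.ofReal (2 * (C + 1) * δ n) := by
    intro n
    have p1 := pow_le_pow_left' (hX1 n) 2
    have p2 := pow_le_pow_left' (hX2 n) 2
    rw [eLpNorm_two_sq] at p1 p2
    refine (ENNReal.pow_le_pow_left_iff two_ne_zero).1 ?_
    rw [eLpNorm_two_sq]
    calc ∫⁻ γ, ‖X n γ - γ‖ₑ ^ 2 ∂(η : Measure (Curve d T))
        ≤ ∫⁻ γ, C * (‖affineValue d T (X n γ) - affineValue d T γ‖ₑ ^ 2 +
          ‖‖(curveData (X n γ)).2 - (curveData γ).2‖‖ₑ ^ 2) ∂(η : Measure (Curve d T)) := by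
          refine lintegral_mono_ae ?_
          filter_upwards [ha.ae_isSobolev hT] with γ hγ using hC _ _ (hXS n γ) hγ
      _ = C * (∫⁻ γ, ‖affineValue d T (X n γ) - affineValue d T γ‖ₑ ^ 2
            ∂(η : Measure (Curve d T)) + ∫⁻ γ, ‖‖(curveData (X n γ)).2 - (curveData γ).2‖‖ₑ ^ 2
            ∂(η : Measure (Curve d T))) := by
          rw [lintegral_const_mul' _ _ ENNReal.coe_ne_top, lintegral_add_left]
          exact (((affineValue d T).continuous.measurable.comp (hXm n)).sub
            (affineValue d T).continuous.measurable).enorm.pow_const 2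
      _ ≤ C * (ENNReal.ofReal (δ n) ^ 2 + ENNReal.ofReal (δ n) ^ 2) := by gcongr
      _ = ENNReal.ofReal (C * (δ n ^ 2 + δ n ^ 2)) := by
          rw [← ENNReal.ofReal_pow (hδ0 n).le, ← ENNReal.ofReal_add (sq_nonneg _) (sq_nonneg _),
            ENNReal.ofReal_mul (NNReal.coe_nonneg C), ENNReal.ofReal_coe_nnreal]
      _ ≤ ENNReal.ofReal (2 * (C + 1) * δ n) ^ 2 := by
          have hC0 : (0 : ℝ) ≤ C := C.2
          rw [← ENNReal.ofReal_pow (by have := hδ0 n; positivity)]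
          refine ENNReal.ofReal_le_ofReal ?_
          nlinarith [sq_nonneg (δ n), mul_nonneg hC0 (sq_nonneg (δ n)),
            mul_nonneg (mul_nonneg hC0 hC0) (sq_nonneg (δ n))]
  have hXc : ∀ n, eLpNorm ((fun γ => c n • X n γ) - id) 2 (η : Measure (Curve d T)) ≤
      ‖c n‖ₑ * ENNReal.ofReal (2 * (C + 1) * δ n) +
        ‖c n - 1‖ₑ * eLpNorm (id : Curve d T → Curve d T) 2 (η : Measure (Curve d T)) := by
    intro n
    have e : (fun γ => c n • X n γ) - id = c n • (X n - id) + (c n - 1) • (id : Curve d T → _) := by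
      ext1 γ
      simp only [Pi.sub_apply, Pi.add_apply, Pi.smul_apply, id]
      module
    rw [e]
    refine (eLpNorm_add_le (((hXm n).aestronglyMeasurable.sub hid.1).const_smul _)
      (hid.1.const_smul _) one_le_two).trans ?_
    have hsmul : ∀ (r : ℝ) (f : Curve d T → Curve d T), eLpNorm (r • f) 2
        (η : Measure (Curve d T)) = ‖r‖ₑ * eLpNorm f 2 (η : Measure (Curve d T)) :=
      fun r f => eLpNorm_const_smul (F := Curve d T) r f 2 _
    rw [hsmul, hsmul]
    gcongr
    exact hXid n
  have hlim : Tendsto (fun n => eLpNorm ((fun γ => c n • X n γ) - id) 2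
      (η : Measure (Curve d T))) atTop (𝓝 0) := by
    refine tendsto_of_tendsto_of_tendsto_of_le_of_le tendsto_const_nhds ?_ (fun n => zero_le) hXc
    have l1 : Tendsto (fun n => ‖c n‖ₑ * ENNReal.ofReal (2 * (C + 1) * δ n)) atTop (𝓝 0) := by
      have := ENNReal.Tendsto.mul (hclim.enorm) (Or.inr (by simp))
        (ENNReal.tendsto_ofReal (hδlim.const_mul (2 * ((C : ℝ) + 1)))) (Or.inr (by simp))
      simpa using this
    have l2 : Tendsto (fun n => ‖c n - 1‖ₑ *
        eLpNorm (id : Curve d T → Curve d T) 2 (η : Measure (Curve d T))) atTop (𝓝 0) := by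
      have := ENNReal.Tendsto.mul_const ((hclim.sub_const 1).enorm) (Or.inr hid.2.ne)
      simpa using this
    simpa using l1.add l2
  have hcX : ∀ n, Measurable fun γ => c n • X n γ := fun n => (hXm n).const_smul (c n)
  -- L² convergence to the identity gives convergence in measure, hence in distribution, and the law
  -- of the identity is η.
  have hmeas : TendstoInMeasure (η : Measure (Curve d T)) (fun n γ => c n • X n γ) atTop id :=
    tendstoInMeasure_of_tendsto_eLpNorm two_ne_zero (fun n => (hcX n).aestronglyMeasurable) hid.1
      hlim
  have hdist := (hmeas.tendstoInDistribution fun n => (hcX n).aemeasurable).tendsto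
  have hνlim : Tendsto ν atTop (𝓝 η) := by
    have e1 : ∀ n, (⟨(η : Measure (Curve d T)).map fun γ => c n • X n γ,
        Measure.isProbabilityMeasure_map (hcX n).aemeasurable⟩ :
        ProbabilityMeasure (Curve d T)) = ν n := fun n => Subtype.ext (hν2 n).symm
    have e2 : (⟨(η : Measure (Curve d T)).map id,
        Measure.isProbabilityMeasure_map measurable_id.aemeasurable⟩ :
        ProbabilityMeasure (Curve d T)) = η := Subtype.ext Measure.map_id
    rw [← e2]
    exact hdist.congr e1
  exact isClosed_closure.mem_of_tendsto hνlim (Eventually.of_forall hν1)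

end

end PressurelessEuler

/-! ### The theorem. -/

theorem mainTheorem3 (d : ℕ) (hd : 2 ≤ d) (T : ℝ) (hT : 0 < T) :
    (∀ η : ProbabilityMeasure (PressurelessEuler.Curve d T),
      PressurelessEuler.IsDissipative η →
        ∃ ηs : ℝ → ProbabilityMeasure (PressurelessEuler.Curve d T),
          (∀ ν : ℝ, 0 < ν → PressurelessEuler.IsFiniteSticky (ηs ν)) ∧
            Tendsto ηs (𝓝[>] 0) (𝓝 η)) ∧
      {η : ProbabilityMeasure (PressurelessEuler.Curve d T) | PressurelessEuler.IsDissipative η} =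
        closure {η : ProbabilityMeasure (PressurelessEuler.Curve d T) |
          PressurelessEuler.IsSticky η} := by
  refine ⟨fun η hη => ?_, Subset.antisymm (fun η hη => ?_)
    (closure_minimal (fun η hη => hη.1) (PressurelessEuler.isClosed_setOf_isDissipative hT))⟩
  · obtain ⟨u, hu, hlim⟩ := mem_closure_iff_seq_limit.1 (hη.mem_closure hd hT)
    -- A sequence becomes a family indexed by ν > 0 through n = ⌈1/ν⌉, which tends to infinity as ν
    -- decreases to 0.
    refine ⟨fun ν => u ⌈ν⁻¹⌉₊, fun ν _ => hu _, ?_⟩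
    exact hlim.comp (tendsto_nat_ceil_atTop.comp tendsto_inv_nhdsGT_zero)
  · exact closure_mono (fun ν hν => hν.1) (PressurelessEuler.IsDissipative.mem_closure hd hT hη)
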